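/- **Theorem (coalgebras of the restriction Faà di Bruno comonad are exactly generalized differential restriction categories).** Composition is written in diagrammatic order, and $\overline{f}$ denotes the restriction of $f$. A *Cartesian restriction category* is a restriction category with a chosen restriction terminal object $1$ and chosen binary restriction products $X\times Y$. A *total commutative monoid* in it is a commutative monoid $(A,+,0)$ whose maps $+:A\times A\to A$ and $0:1\to A$ are total; for $f,g:T\to A$ put $f+g:=\langle f,g\rangle +$ and $0:=\,!\,0:T\to A$. A *morphism* of Cartesian restriction categories is a functor that preserves restrictions and the chosen products and terminal object on the nose. For a Cartesian restriction category $\mathbb X$, the Cartesian restriction category $\mathrm{Fa\grave a}(\mathbb X)$ has as objects the pairs $((A,+,0),X)$ of a total commutative monoid and an object of $\mathbb X$. A map $((A,+,0),X)\to((B,+,0),Y)$ is a sequence $(f_*,f_1,f_2,\dots)$ with $f_*:X\to Y$ and $f_n:A^n\times X\to B$, where $\overline{f_n}=\overline{\pi_n f_*}$ and $f_n$ is symmetric and additive in each of its first $n$ variables. Its structure is as follows. * Identities are $(1,\pi_0,0,0,\dots)$. * Composition is $(fg)_*=f_*g_*$ and $$(fg)_n=\sum_{\{b_1,\dots,b_k\}}\langle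 p_{1}f_{|b_1|},\dots,p_{k}f_{|b_k|},\pi_nf_*\rangle g_k ,$$ the sum being over all partitions of the set of the $n$ vector variables into blocks $b_1,\dots,b_k$, where $p_i$ projects to the variables in $b_i$ and to $X$. * The restriction of $f$ is $(\overline{f_*},\overline{\pi_1f_*}\pi_0,\overline{\pi_2f_*}0,\overline{\pi_3f_*}0,\dots)$. * Products are componentwise, with projections $(\pi_i,\pi_0\pi_i,0,0,\dots)$. A morphism $F$ acts by $((A,+,0),X)\mapsto((FA,F{+},F0),FX)$ and $(f_*,f_1,\dots)\mapsto(Ff_*,Ff_1,\dots)$. The counit $\epsilon:\mathrm{Fa\grave a}(\mathbb X)\to\mathbb X$ is $((A,+,0),X)\mapsto X$, $f\mapsto f_*$. The comultiplication $\delta:\mathrm{Fa\grave a}(\mathbb X)\to\mathrm{Fa\grave a}^2(\mathbb X)$ sends $((A,+,0),X)$ to $$\big((((A,+,0),A),(+,\pi_0+,0,\dots),(0,\pi_0 0,0,\dots)),\,((A,+,0),X)\big),$$ and on maps $\delta(f)_*=f$, $(\delta(f)_n)_*=f_n$, and $(\delta(f)_n)_m$ for $m\ge 1$, at the directions $(b_{j,1},\dots,b_{j,n},b_{j,*})_{1\le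 j\le m}$ and the point $(a_1,\dots,a_n,x)$, is the sum, over all injections $\varphi: S\to\{1,\dots,n\}$ with $S\subseteq\{1,\dots,m\}$, of $f_{n+m-|S|}$ at the $n$ arguments obtained from $a_1,\dots,a_n$ by replacing $a_{\varphi(j)}$ by $b_{j,\varphi(j)}$ for each $j\in S$, the $m-|S|$ further arguments $b_{j,*}$ for $j\notin S$, and $x$. A *coalgebra structure* on $\mathbb X$ for the comonad $(\mathrm{Fa\grave a},\epsilon,\delta)$ is a morphism of Cartesian restriction categories $\mathcal D:\mathbb X\to\mathrm{Fa\grave a}(\mathbb X)$ with $\mathcal D\,\epsilon=1_{\mathbb X}$ and $\mathcal D\,\delta=\mathcal D\,\mathrm{Fa\grave a}(\mathcal D)$. A *generalized differential restriction structure* on $\mathbb X$ consists of a total commutative monoid $L(X)=(L_0(X),+_X,0_X)$ for each object $X$, such that $L(L_0(X))=L(X)$, $L(X\times Y)=L(X)\times L(Y)$ and $L(1)=1$, and a map $D[f]:L_0(X)\times X\to L_0(Y)$ for each map $f:X\to Y$, such that (for all, possibly partial, maps $a,b,c,d$ of the appropriate types) * **[DR.1]** $D[+_X]=\pi_0\,+_X$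 and $D[0_X]=\pi_0\,0_X$; * **[DR.2]** $\langle a+b,c\rangle D[f]=\langle a,c\rangle D[f]+\langle b,c\rangle D[f]$ and $\langle 0,a\rangle D[f]=\overline{af}\,0$; * **[DR.3]** $D[\pi_0]=\pi_0\pi_0$ and $D[\pi_1]=\pi_0\pi_1$; * **[DR.4]** $D[\langle f,g\rangle]=\langle D[f],D[g]\rangle$; * **[DR.5]** $D[fg]=\langle D[f],\pi_1f\rangle D[g]$; * **[DR.6]** $\langle\langle a,0\rangle,\langle c,d\rangle\rangle D[D[f]]=\overline{c}\,\langle a,d\rangle D[f]$; * **[DR.7]** $\langle\langle 0,b\rangle,\langle c,d\rangle\rangle D[D[f]]=\langle\langle 0,c\rangle,\langle b,d\rangle\rangle D[D[f]]$; * **[DR.8]** $D[\overline{f}]=\overline{\pi_1f}\,\pi_0$ (equivalently $(1\times\overline f)\pi_0$); * **[DR.9]** $\overline{D[f]}=\overline{\pi_1f}$ (equivalently $1\times\overline f$). Then for every Cartesian restriction category $\mathbb X$, writing $\mathcal D(X)=(L(X),X)$ and $D[f]:=\mathcal D(f)_1$ defines a bijection from the coalgebra structures on $\mathbb X$ for the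 comonad $(\mathrm{Fa\grave a},\epsilon,\delta)$ to the generalized differential restriction structures on $\mathbb X$. That is, the coalgebras are exactly the generalized differential restriction categories. -/

import Mathlib

open CategoryTheory

universe v u v₁ u₁ v₂ u₂

namespace RestrictionFaa

/-! ### Cartesian restriction categories -/

/-- The operations of a Cartesian restriction category, without their laws: composition and
identities, the restriction `rst f` of a map, chosen binary products with projections and pairing,
and a chosen terminal object.  Composition is in diagrammatic order. -/
class CartRestrStruct (C : Type u) extends CategoryStruct.{v} C where
  rst : ∀ {X Y : C}, (X ⟶ Y) → (X ⟶ X)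
  prod : C → C → C
  fst : ∀ X Y : C, prod X Y ⟶ X
  snd : ∀ X Y : C, prod X Y ⟶ Y
  pair : ∀ {T X Y : C}, (T ⟶ X) → (T ⟶ Y) → (T ⟶ prod X Y)
  one : C
  bang : ∀ X : C, X ⟶ one

open CartRestrStruct

/-- The restriction order: `f ≤ g` when `f` is the restriction of `g` to the domain of `f`. -/
def RLe {C : Type u} [CartRestrStruct.{v} C] {X Y : C} (f g : X ⟶ Y) : Prop :=
  rst f ≫ g = f

/-- A map is total when its restriction is the identity. -/
def IsTotal {C : Type u} [CartRestrStruct.{v} C] {X Y : C} (f : X ⟶ Y) : Prop :=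
  rst f = 𝟙 X

/-- The laws of a Cartesian restriction category: a category with the four restriction axioms, a
chosen restriction terminal object and chosen binary restriction products. -/
class IsCartRestrCat (C : Type u) [CartRestrStruct.{v} C] : Prop where
  id_comp : ∀ {X Y : C} (f : X ⟶ Y), 𝟙 X ≫ f = f
  comp_id : ∀ {X Y : C} (f : X ⟶ Y), f ≫ 𝟙 Y = f
  assoc : ∀ {W X Y Z : C} (f : W ⟶ X) (g : X ⟶ Y) (h : Y ⟶ Z), (f ≫ g) ≫ h = f ≫ g ≫ h
  rst_comp_self : ∀ {X Y : C} (f : X ⟶ Y), rst f ≫ f = f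
  rst_comm : ∀ {X Y Z : C} (f : X ⟶ Y) (g : X ⟶ Z), rst f ≫ rst g = rst g ≫ rst f
  rst_rst_comp : ∀ {X Y Z : C} (f : X ⟶ Y) (g : X ⟶ Z), rst (rst f ≫ g) = rst f ≫ rst g
  comp_rst : ∀ {X Y Z : C} (f : X ⟶ Y) (g : Y ⟶ Z), f ≫ rst g = rst (f ≫ g) ≫ f
  bang_total : ∀ X : C, IsTotal (bang X)
  bang_unique : ∀ {X : C} (f : X ⟶ one), IsTotal f → f = bang X
  comp_bang_le : ∀ {X Y : C} (f : X ⟶ Y), RLe (f ≫ bang Y) (bang X)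
  fst_total : ∀ X Y : C, IsTotal (fst X Y)
  snd_total : ∀ X Y : C, IsTotal (snd X Y)
  pair_fst_le : ∀ {T X Y : C} (f : T ⟶ X) (g : T ⟶ Y), RLe (pair f g ≫ fst X Y) f
  pair_snd_le : ∀ {T X Y : C} (f : T ⟶ X) (g : T ⟶ Y), RLe (pair f g ≫ snd X Y) g
  rst_pair : ∀ {T X Y : C} (f : T ⟶ X) (g : T ⟶ Y), rst (pair f g) = rst f ≫ rst g
  pair_unique : ∀ {T X Y : C} (f : T ⟶ X) (g : T ⟶ Y) (h : T ⟶ prod X Y),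
    RLe (h ≫ fst X Y) f → RLe (h ≫ snd X Y) g → rst h = rst f ≫ rst g → h = pair f g

/-- A morphism of the structures above: it preserves composition, identities and restriction, and
it preserves the chosen products, projections and terminal object exactly.  (`Quiver.Hom.cast`
transports a map along equalities of its endpoints.) -/
structure StrictFunctor (C : Type u₁) [CartRestrStruct.{v₁} C] (E : Type u₂)
    [CartRestrStruct.{v₂} E] extends C ⥤q E where
  map_id : ∀ X : C, map (𝟙 X) = 𝟙 (obj X)
  map_comp : ∀ {X Y Z : C} (f : X ⟶ Y) (g : Y ⟶ Z), map (f ≫ g) = map f ≫ map g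
  map_rst : ∀ {X Y : C} (f : X ⟶ Y), map (rst f) = rst (map f)
  obj_prod : ∀ X Y : C, obj (prod X Y) = prod (obj X) (obj Y)
  obj_one : obj one = one
  map_fst : ∀ X Y : C, (map (fst X Y)).cast (obj_prod X Y) rfl = fst (obj X) (obj Y)
  map_snd : ∀ X Y : C, (map (snd X Y)).cast (obj_prod X Y) rfl = snd (obj X) (obj Y)

/-! ### Monoid objects and sums of maps -/

/-- An object with an addition and a zero (the laws are in `MonData.IsTotalCommMonoid`). -/
structure MonData (C : Type u) [CartRestrStruct.{v} C] where
  carrier : C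
  add : prod carrier carrier ⟶ carrier
  zero : one ⟶ carrier

/-- The sum `f + g = ⟨f, g⟩ +` of two maps into a monoid. -/
def MonData.sum {C : Type u} [CartRestrStruct.{v} C] (M : MonData C) {T : C}
    (f g : T ⟶ M.carrier) : T ⟶ M.carrier :=
  pair f g ≫ M.add

/-- The zero map `! 0` into a monoid. -/
def MonData.zeroMap {C : Type u} [CartRestrStruct.{v} C] (M : MonData C) (T : C) :
    T ⟶ M.carrier :=
  bang T ≫ M.zero

/-- The sum of a finite family of maps into a monoid.  (When the monoid is commutative the order
of summation, chosen by `Finset.toList`, is irrelevant.) -/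
noncomputable def MonData.finSum {C : Type u} [CartRestrStruct.{v} C] (M : MonData C) {T : C}
    {ι : Type} (s : Finset ι) (h : ι → (T ⟶ M.carrier)) : T ⟶ M.carrier :=
  (s.toList.map h).foldr M.sum (M.zeroMap T)

/-- `(A, +, 0)` is a total commutative monoid; the equations are those between the projections
from `(A × A) × A`, from `A` and from `A × A`. -/
structure MonData.IsTotalCommMonoid {C : Type u} [CartRestrStruct.{v} C] (M : MonData C) :
    Prop where
  add_total : IsTotal M.add
  zero_total : IsTotal M.zero
  add_assoc :
    M.sum (M.sum (fst (prod M.carrier M.carrier) M.carrier ≫ fst M.carrier M.carrier)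
        (fst (prod M.carrier M.carrier) M.carrier ≫ snd M.carrier M.carrier))
        (snd (prod M.carrier M.carrier) M.carrier) =
      M.sum (fst (prod M.carrier M.carrier) M.carrier ≫ fst M.carrier M.carrier)
        (M.sum (fst (prod M.carrier M.carrier) M.carrier ≫ snd M.carrier M.carrier)
          (snd (prod M.carrier M.carrier) M.carrier))
  zero_add : M.sum (M.zeroMap M.carrier) (𝟙 M.carrier) = 𝟙 M.carrier
  add_comm : M.sum (snd M.carrier M.carrier) (fst M.carrier M.carrier) = M.add

/-- The product monoid, with addition `ex (+ × +)`. -/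
def MonData.prodMon {C : Type u} [CartRestrStruct.{v} C] (M N : MonData C) : MonData C where
  carrier := prod M.carrier N.carrier
  add := pair
    (M.sum (fst _ _ ≫ fst M.carrier N.carrier) (snd _ _ ≫ fst M.carrier N.carrier))
    (N.sum (fst _ _ ≫ snd M.carrier N.carrier) (snd _ _ ≫ snd M.carrier N.carrier))
  zero := pair M.zero N.zero

/-- The monoid structure on the terminal object. -/
def MonData.oneMon (C : Type u) [CartRestrStruct.{v} C] : MonData C where
  carrier := one
  add := bang _
  zero := bang _

/-! ### Powers -/

/-- `pow A n X` is `Aⁿ × X = A × (A × ⋯ × (A × X))`. -/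
def pow {C : Type u} [CartRestrStruct.{v} C] (A : C) : ℕ → C → C
  | 0, X => X
  | n + 1, X => prod A (pow A n X)

/-- The projection of `Aⁿ × X` to its `i`-th factor `A`. -/
def vproj {C : Type u} [CartRestrStruct.{v} C] {A X : C} : (n : ℕ) → Fin n → (pow A n X ⟶ A)
  | 0, i => i.elim0
  | n + 1, i => Fin.cases (motive := fun _ => pow A (n + 1) X ⟶ A)
      (fst A (pow A n X)) (fun j => snd A (pow A n X) ≫ vproj n j) i

/-- The projection of `Aⁿ × X` to its last factor `X`, written `πₙ`. -/
def pproj {C : Type u} [CartRestrStruct.{v} C] {A X : C} : (n : ℕ) → (pow A n X ⟶ X)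
  | 0 => 𝟙 X
  | n + 1 => snd A (pow A n X) ≫ pproj n

/-- The map `⟨a₁, …, aₙ, x⟩` into `Aⁿ × X`. -/
def tup {C : Type u} [CartRestrStruct.{v} C] {T A X : C} :
    (n : ℕ) → (Fin n → (T ⟶ A)) → (T ⟶ X) → (T ⟶ pow A n X)
  | 0, _, x => x
  | n + 1, a, x => pair (a 0) (tup n (fun i => a i.succ) x)

/-! ### The Faà construction

`PreFaa C` carries pairs `((A, +, 0), X)`, sequences `(f_*, f₁, f₂, …)` between them, and all the
operations of the Faà construction.  The Cartesian restriction category Faà(C) consists of those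
objects that satisfy `PreFaa.IsObj` and those sequences that satisfy `FaaSeq.IsMap`, with the
operations of `PreFaa C`. -/

/-- Pairs `((A, +, 0), X)`. -/
structure PreFaa (C : Type u) [CartRestrStruct.{v} C] where
  mon : MonData C
  pt : C

/-- Sequences `(f_*, f₁, f₂, …)` with `f_* : X ⟶ Y` and `fₙ : Aⁿ × X ⟶ B` for `n ≥ 1`. -/
@[ext]
structure FaaSeq {C : Type u} [CartRestrStruct.{v} C] (P Q : PreFaa C) where
  base : P.pt ⟶ Q.pt
  hi : ∀ n : ℕ, 0 < n → (pow P.mon.carrier n P.pt ⟶ Q.mon.carrier)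

/-- The objects of Faà(C): `(A, +, 0)` is a total commutative monoid. -/
def PreFaa.IsObj {C : Type u} [CartRestrStruct.{v} C] (P : PreFaa C) : Prop :=
  P.mon.IsTotalCommMonoid

/-- The maps of Faà(C): the restriction of `fₙ` is that of `πₙ f_*`, and `fₙ` is symmetric and
additive in each of its first `n` variables (additivity is expressed at generalized elements;
`f` being partial, the value at a zero vector is the zero map restricted to its domain). -/
structure FaaSeq.IsMap {C : Type u} [CartRestrStruct.{v} C] {P Q : PreFaa C}
    (f : FaaSeq P Q) : Prop where
  rst_hi : ∀ (n : ℕ) (hn : 0 < n), rst (f.hi n hn) = rst (pproj n ≫ f.base)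
  symm : ∀ (n : ℕ) (hn : 0 < n) (σ : Equiv.Perm (Fin n)),
    tup n (fun i => vproj n (σ i)) (pproj n) ≫ f.hi n hn = f.hi n hn
  map_add : ∀ (n : ℕ) (hn : 0 < n) (T : C) (w : Fin n → (T ⟶ P.mon.carrier)) (x : T ⟶ P.pt)
    (i : Fin n) (a b : T ⟶ P.mon.carrier),
    tup n (Function.update w i (P.mon.sum a b)) x ≫ f.hi n hn =
      Q.mon.sum (tup n (Function.update w i a) x ≫ f.hi n hn)
        (tup n (Function.update w i b) x ≫ f.hi n hn)
  map_zero : ∀ (n : ℕ) (hn : 0 < n) (T : C) (w : Fin n → (T ⟶ P.mon.carrier)) (x : T ⟶ P.pt)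
    (i : Fin n),
    tup n (Function.update w i (P.mon.zeroMap T)) x ≫ f.hi n hn =
      rst (tup n (Function.update w i (P.mon.zeroMap T)) x ≫ f.hi n hn) ≫ Q.mon.zeroMap T

/-- The sequence `(f, g, 0, 0, …)`. -/
def FaaSeq.ofTwo {C : Type u} [CartRestrStruct.{v} C] {P Q : PreFaa C} (f : P.pt ⟶ Q.pt)
    (g : prod P.mon.carrier P.pt ⟶ Q.mon.carrier) : FaaSeq P Q where
  base := f
  hi n _ := match n with
    | 0 => Q.mon.zeroMap _
    | 1 => g
    | n + 2 => Q.mon.zeroMap (pow P.mon.carrier (n + 2) P.pt)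

/-- Composition: `(fg)_* = f_* g_*`, and `(fg)ₙ` is the sum over all partitions of the `n`
variables (that is, over all trees of height 2 and width `n`), with blocks `b₁, …, bₖ`, of
`⟨p₁ f_{|b₁|}, …, pₖ f_{|bₖ|}, πₙ f_*⟩ gₖ`, where `pᵢ` projects to the variables of the block
`bᵢ` and to the point. -/
noncomputable def FaaSeq.comp {C : Type u} [CartRestrStruct.{v} C] {P Q R : PreFaa C}
    (f : FaaSeq P Q) (g : FaaSeq Q R) : FaaSeq P R where
  base := f.base ≫ g.base
  hi n hn := R.mon.finSum Finset.univ fun c : OrderedFinpartition n =>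
    tup c.length
      (fun i => tup (c.partSize i) (fun j => vproj n (c.emb i j)) (pproj n) ≫
        f.hi (c.partSize i) (c.partSize_pos i))
      (pproj n ≫ f.base) ≫ g.hi c.length (c.length_pos hn)

/-- The restriction `(rst f_*, rst (π₁ f_*) π₀, rst (π₂ f_*) 0, rst (π₃ f_*) 0, …)`. -/
def FaaSeq.rstSeq {C : Type u} [CartRestrStruct.{v} C] {P Q : PreFaa C}
    (f : FaaSeq P Q) : FaaSeq P P where
  base := rst f.base
  hi n _ := match n with
    | 0 => P.mon.zeroMap _
    | 1 => rst (snd P.mon.carrier P.pt ≫ f.base) ≫ fst P.mon.carrier P.pt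
    | n + 2 => rst (pproj (A := P.mon.carrier) (n + 2) ≫ f.base) ≫ P.mon.zeroMap _

/-- Composition, identities, restriction and products of the Faà construction. -/
noncomputable instance PreFaa.instStruct (C : Type u) [CartRestrStruct.{v} C] :
    CartRestrStruct.{v} (PreFaa C) where
  Hom P Q := FaaSeq P Q
  id P := FaaSeq.ofTwo (𝟙 P.pt) (fst P.mon.carrier P.pt)
  comp f g := FaaSeq.comp f g
  rst f := FaaSeq.rstSeq f
  prod P Q := ⟨P.mon.prodMon Q.mon, prod P.pt Q.pt⟩
  fst P Q := FaaSeq.ofTwo (fst P.pt Q.pt)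
    (fst (prod P.mon.carrier Q.mon.carrier) (prod P.pt Q.pt) ≫ fst P.mon.carrier Q.mon.carrier)
  snd P Q := FaaSeq.ofTwo (snd P.pt Q.pt)
    (fst (prod P.mon.carrier Q.mon.carrier) (prod P.pt Q.pt) ≫ snd P.mon.carrier Q.mon.carrier)
  pair f g := ⟨pair f.base g.base, fun n hn => pair (f.hi n hn) (g.hi n hn)⟩
  one := ⟨MonData.oneMon C, one⟩
  bang P := ⟨bang P.pt, fun n _ => bang (pow P.mon.carrier n P.pt)⟩

theorem StrictFunctor.obj_pow {C : Type u₁} [CartRestrStruct.{v₁} C] {E : Type u₂}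
    [CartRestrStruct.{v₂} E] (F : StrictFunctor C E) (A X : C) (n : ℕ) :
    F.obj (pow A n X) = pow (F.obj A) n (F.obj X) := by
  induction n with
  | zero => rfl
  | succ n ih => exact (F.obj_prod A (pow A n X)).trans (congrArg (prod (F.obj A)) ih)

/-- The action of Faà on functors: `((A, +, 0), X) ↦ ((FA, F+, F0), FX)` and
`(f_*, f₁, f₂, …) ↦ (F f_*, F f₁, F f₂, …)`. -/
noncomputable def StrictFunctor.faa {C : Type u₁} [CartRestrStruct.{v₁} C] {E : Type u₂}
    [CartRestrStruct.{v₂} E] (F : StrictFunctor C E) : PreFaa C ⥤q PreFaa E where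
  obj P :=
    { mon :=
        { carrier := F.obj P.mon.carrier
          add := (F.map P.mon.add).cast (F.obj_prod _ _) rfl
          zero := (F.map P.mon.zero).cast F.obj_one rfl }
      pt := F.obj P.pt }
  map {P _} f :=
    { base := F.map f.base
      hi := fun n hn => (F.map (f.hi n hn)).cast (F.obj_pow P.mon.carrier P.pt n) rfl }

/-! ### Counit and comultiplication -/

/-- The counit `ε ((A, +, 0), X) = X`, `ε (f_*, f₁, …) = f_*`. -/
noncomputable def counit (C : Type u) [CartRestrStruct.{v} C] : PreFaa C ⥤q C where
  obj P := P.pt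
  map f := f.base

/-- The object part of the comultiplication:
`((A, +, 0), X) ↦ ((((A, +, 0), A), (+, π₀ +, 0, …), (0, π₀ 0, 0, …)), ((A, +, 0), X))`. -/
noncomputable def comultObj {C : Type u} [CartRestrStruct.{v} C] (P : PreFaa C) :
    PreFaa (PreFaa C) where
  mon :=
    { carrier := ⟨P.mon, P.mon.carrier⟩
      add := FaaSeq.ofTwo (P := prod (⟨P.mon, P.mon.carrier⟩ : PreFaa C) ⟨P.mon, P.mon.carrier⟩)
        P.mon.add (fst (prod P.mon.carrier P.mon.carrier) _ ≫ P.mon.add)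
      zero := FaaSeq.ofTwo (P := (one : PreFaa C)) (Q := ⟨P.mon, P.mon.carrier⟩)
        P.mon.zero (fst one one ≫ P.mon.zero) }
  pt := P

/-- In the power `Pⁿ × Q` formed in `PreFaa C` the monoid has as its underlying object the product
of `n` copies of the vectors of `P` and one of the vectors of `Q`; this is the projection to
the vectors of the `i`-th copy of `P`. -/
noncomputable def vecV {C : Type u} [CartRestrStruct.{v} C] {P Q : PreFaa C} :
    (n : ℕ) → Fin n → ((pow P n Q).mon.carrier ⟶ P.mon.carrier)
  | 0, i => i.elim0
  | n + 1, i => Fin.cases (motive := fun _ => (pow P (n + 1) Q).mon.carrier ⟶ P.mon.carrier)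
      (fst P.mon.carrier (pow P n Q).mon.carrier)
      (fun j => snd P.mon.carrier (pow P n Q).mon.carrier ≫ vecV n j) i

/-- The projection to the vectors of `Q`, see `vecV`. -/
noncomputable def vecP {C : Type u} [CartRestrStruct.{v} C] {P Q : PreFaa C} :
    (n : ℕ) → ((pow P n Q).mon.carrier ⟶ Q.mon.carrier)
  | 0 => 𝟙 Q.mon.carrier
  | n + 1 => snd P.mon.carrier (pow P n Q).mon.carrier ≫ vecP n

/-- The points of the `i`-th copy of `P` in the power `Pⁿ × Q` formed in `PreFaa C`. -/
noncomputable def ptV {C : Type u} [CartRestrStruct.{v} C] {P Q : PreFaa C} :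
    (n : ℕ) → Fin n → ((pow P n Q).pt ⟶ P.pt)
  | 0, i => i.elim0
  | n + 1, i => Fin.cases (motive := fun _ => (pow P (n + 1) Q).pt ⟶ P.pt)
      (fst P.pt (pow P n Q).pt) (fun j => snd P.pt (pow P n Q).pt ≫ ptV n j) i

/-- The points of `Q` in the power `Pⁿ × Q` formed in `PreFaa C`. -/
noncomputable def ptP {C : Type u} [CartRestrStruct.{v} C] {P Q : PreFaa C} :
    (n : ℕ) → ((pow P n Q).pt ⟶ Q.pt)
  | 0 => 𝟙 Q.pt
  | n + 1 => snd P.pt (pow P n Q).pt ≫ ptP n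

/-- A choice of which of the `n` arguments of `fₙ` get replaced by a component of which of `m`
direction vectors; each direction vector is used at most once. -/
abbrev Repl (n m : ℕ) : Type :=
  {e : Fin n → Option (Fin m) // ∀ i i' j, e i = some j → e i' = some j → i = i'}

/-- The direction vectors that do not replace an argument. -/
noncomputable def Repl.free {n m : ℕ} (e : Repl n m) : Finset (Fin m) := by
  classical exact Finset.univ.filter fun j => ∀ i, e.1 i ≠ some j

/-- The `m`-th term of the `n`-th term of the comultiplication at `f`.  At the point
`(a₁, …, aₙ, x)` of `Aⁿ × X` and at the directions `(b_{j,1}, …, b_{j,n}, b_{j,*})`, `j = 1, …, m`,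
it is the sum, over all ways to let some of the directions replace distinct arguments `aᵢ` by
`b_{j,i}`, of `f_{n+k}` at the resulting `n` arguments, the `k` remaining `b_{j,*}`, and `x`. -/
noncomputable def comultHi {C : Type u} [CartRestrStruct.{v} C] {P Q : PreFaa C} (f : FaaSeq P Q)
    (n : ℕ) (hn : 0 < n) (m : ℕ) :
    pow (pow (comultObj P).mon.carrier n P).mon.carrier m
      (pow (comultObj P).mon.carrier n P).pt ⟶ Q.mon.carrier :=
  Q.mon.finSum (Finset.univ : Finset (Repl n m)) fun e =>
    tup (n + e.free.card)
      (Fin.append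
        (fun i : Fin n => match e.1 i with
          | some j => vproj m j ≫ vecV (P := (comultObj P).mon.carrier) n i
          | none => pproj m ≫ ptV (P := (comultObj P).mon.carrier) n i)
        (fun l => vproj m (e.free.orderEmbOfFin rfl l) ≫ vecP n))
      (pproj m ≫ ptP n) ≫ f.hi (n + e.free.card) (Nat.add_pos_left hn _)

/-- The comultiplication: `δ(f)_* = f`, and `δ(f)ₙ` is the sequence whose `*`-term is `fₙ` and
whose `m`-th term is `comultHi f n m`. -/
noncomputable def comult (C : Type u) [CartRestrStruct.{v} C] :
    PreFaa C ⥤q PreFaa (PreFaa C) where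
  obj P := comultObj P
  map {P _} f :=
    { base := f
      hi := fun n hn =>
        { base := tup n (fun i => ptV (P := (comultObj P).mon.carrier) n i) (ptP n) ≫ f.hi n hn
          hi := fun m _ => comultHi f n hn m } }

/-! ### Coalgebras -/

/-- A coalgebra structure on a Cartesian restriction category `C` for the comonad (Faà, ε, δ): a
morphism of Cartesian restriction categories from `C` to Faà(C) that satisfies the counit and the
coassociativity equation. -/
structure FaaCoalgebra (C : Type u) [CartRestrStruct.{v} C] extends
    StrictFunctor C (PreFaa C) where
  isObj : ∀ X : C, (obj X).IsObj
  isMap : ∀ {X Y : C} (f : X ⟶ Y), FaaSeq.IsMap (map f)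
  counit_eq : toPrefunctor ⋙q counit C = 𝟭q C
  coassoc : toPrefunctor ⋙q comult C = toPrefunctor ⋙q toStrictFunctor.faa

/-! ### Generalized differential restriction categories -/

/-- The data of a generalized differential restriction structure: monoids
`L X = (L₀ X, +_X, 0_X)` and maps `D[f] : L₀ X × X ⟶ L₀ Y`. -/
structure DiffData (C : Type u) [CartRestrStruct.{v} C] where
  L : C → MonData C
  D : ∀ {X Y : C}, (X ⟶ Y) → (prod (L X).carrier X ⟶ (L Y).carrier)

/-- The axioms of a generalized differential restriction structure.  The equalities `L_L`,
`L_prod` and `L_one` make the two sides of the later axioms maps between the same objects;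
`Quiver.Hom.cast` transports along them. -/
structure DiffData.IsGenDiffRestr {C : Type u} [CartRestrStruct.{v} C] (G : DiffData C) :
    Prop where
  isMonoid : ∀ X : C, (G.L X).IsTotalCommMonoid
  L_L : ∀ X : C, G.L (G.L X).carrier = G.L X
  L_prod : ∀ X Y : C, G.L (prod X Y) = (G.L X).prodMon (G.L Y)
  L_one : G.L one = MonData.oneMon C
  dr1_add : ∀ X : C,
    (G.D (G.L X).add).cast
      (congrArg (fun A => prod A (prod (G.L X).carrier (G.L X).carrier))
        (show (G.L (prod (G.L X).carrier (G.L X).carrier)).carrier =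
            prod (G.L X).carrier (G.L X).carrier by rw [L_prod, L_L]; rfl))
      (congrArg MonData.carrier (L_L X)) =
    fst (prod (G.L X).carrier (G.L X).carrier) _ ≫ (G.L X).add
  dr1_zero : ∀ X : C,
    (G.D (G.L X).zero).cast
      (congrArg (fun M => prod (MonData.carrier M) one) L_one)
      (congrArg MonData.carrier (L_L X)) =
    fst one one ≫ (G.L X).zero
  dr2_add : ∀ {T X Y : C} (f : X ⟶ Y) (a b : T ⟶ (G.L X).carrier) (c : T ⟶ X),
    pair ((G.L X).sum a b) c ≫ G.D f = (G.L Y).sum (pair a c ≫ G.D f) (pair b c ≫ G.D f)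
  dr2_zero : ∀ {T X Y : C} (f : X ⟶ Y) (a : T ⟶ X),
    pair ((G.L X).zeroMap T) a ≫ G.D f = rst (a ≫ f) ≫ (G.L Y).zeroMap T
  dr3_fst : ∀ X Y : C,
    (G.D (fst X Y)).cast (congrArg (fun M => prod (MonData.carrier M) (prod X Y)) (L_prod X Y))
      rfl = fst (prod (G.L X).carrier (G.L Y).carrier) _ ≫ fst _ _
  dr3_snd : ∀ X Y : C,
    (G.D (snd X Y)).cast (congrArg (fun M => prod (MonData.carrier M) (prod X Y)) (L_prod X Y))
      rfl = fst (prod (G.L X).carrier (G.L Y).carrier) _ ≫ snd _ _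
  dr4 : ∀ {X Y Z : C} (f : X ⟶ Y) (g : X ⟶ Z),
    (G.D (pair f g)).cast rfl (congrArg MonData.carrier (L_prod Y Z)) = pair (G.D f) (G.D g)
  dr5 : ∀ {X Y Z : C} (f : X ⟶ Y) (g : Y ⟶ Z),
    G.D (f ≫ g) = pair (G.D f) (snd _ X ≫ f) ≫ G.D g
  dr6 : ∀ {T X Y : C} (f : X ⟶ Y) (a c : T ⟶ (G.L X).carrier) (d : T ⟶ X),
    pair (pair a ((G.L X).zeroMap T)) (pair c d) ≫
      (G.D (G.D f)).cast
        (congrArg (fun A => prod A (prod (G.L X).carrier X))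
          (show (G.L (prod (G.L X).carrier X)).carrier = prod (G.L X).carrier (G.L X).carrier by
            rw [L_prod, L_L]; rfl))
        (congrArg MonData.carrier (L_L Y)) =
    rst c ≫ pair a d ≫ G.D f
  dr7 : ∀ {T X Y : C} (f : X ⟶ Y) (b c : T ⟶ (G.L X).carrier) (d : T ⟶ X),
    pair (pair ((G.L X).zeroMap T) b) (pair c d) ≫
      (G.D (G.D f)).cast
        (congrArg (fun A => prod A (prod (G.L X).carrier X))
          (show (G.L (prod (G.L X).carrier X)).carrier = prod (G.L X).carrier (G.L X).carrier by
            rw [L_prod, L_L]; rfl))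
        (congrArg MonData.carrier (L_L Y)) =
    pair (pair ((G.L X).zeroMap T) c) (pair b d) ≫
      (G.D (G.D f)).cast
        (congrArg (fun A => prod A (prod (G.L X).carrier X))
          (show (G.L (prod (G.L X).carrier X)).carrier = prod (G.L X).carrier (G.L X).carrier by
            rw [L_prod, L_L]; rfl))
        (congrArg MonData.carrier (L_L Y))
  dr8 : ∀ {X Y : C} (f : X ⟶ Y), G.D (rst f) = rst (snd _ X ≫ f) ≫ fst (G.L X).carrier X
  dr9 : ∀ {X Y : C} (f : X ⟶ Y), rst (G.D f) = rst (snd (G.L X).carrier X ≫ f)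

/-- The data `(L, D)` of a coalgebra: `𝒟(X) = (L(X), X)` and `D[f] = 𝒟(f)₁`. -/
noncomputable def FaaCoalgebra.toDiffData {C : Type u} [CartRestrStruct.{v} C]
    (K : FaaCoalgebra C) : DiffData C where
  L X := (K.obj X).mon
  D {X _} f := Quiver.Hom.cast
    (congrArg (prod (K.obj X).mon.carrier) (show (K.obj X).pt = X from
      congrArg (fun F : C ⥤q C => F.obj X) K.counit_eq))
    rfl (FaaSeq.hi (K.map f) 1 Nat.one_pos)

end RestrictionFaa

/-! Both directions rest on one formula. Write fₙ for the terms of 𝒟(f). The first derivative of fₙ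
: Aⁿ × X → B at the point (a, x) in the direction (b₁, …, bₙ, b) should be fₙ₊₁(b, a, x) + Σᵢ fₙ(a
with aᵢ replaced by bᵢ, x), and this is the m = 1 part of coassociativity.

From a coalgebra to a differential structure: for n = 1 the formula reads DDf((a, b), (c, x)) =
f₂(b, c, x) + f₁(a, x). Setting b = 0 gives DR.6. Setting a = 0 and using the symmetry of f₂ gives
DR.7. The object part of coassociativity gives L(L₀ X) = L X and DR.1. The other axioms are the
first-order parts of functoriality, of preservation of products and restrictions, and of the
definition of a Faà map (`IsFaaFamily.laws`). Uniqueness: when all bᵢ = 0, the replaced terms vanish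
and fₙ₊₁ becomes the partial derivative of fₙ in its last variable (`IsFaaFamily.hi_succ`). Hence D
determines every term (`IsFaaFamily.eq_seq`).

From a differential structure to a coalgebra: the same recursion is taken as the definition
(`DiffData.der`, `DiffData.hi`). DR.7 gives symmetry (`hi_symm`), DR.2 together with symmetry gives
additivity (`seq_isMap`), and DR.6 with DR.7 gives linearity in each vector variable (`hi_isLin`).
The displayed formula then holds again (`pair_d_hi`). Composition and comultiplication follow by
induction on the order, differentiating sums term by term. A new variable either forms a block of
its own or joins an existing block (`inc_d_compTerm`, `hi_comp`). A new direction either stays free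
or replaces an untouched argument (`inc_d_replTerm`, `hi_tup_hi`).

Two complications recur. Since maps are partial, a vanishing term is some `rst e ≫ 0`, not the total
zero; it may be dropped only next to a term whose domain lies in that of e. And equations such as
L(L₀ X) = L X are not definitional. The pairs `DiffObj` carry the monoid as separate data, so that
the axioms can be written without transports. -/

namespace RestrictionFaa
open CartRestrStruct

attribute [simp] IsCartRestrCat.id_comp IsCartRestrCat.comp_id IsCartRestrCat.assoc

section Basic

variable {C : Type u} [CartRestrStruct.{v} C] [IsCartRestrCat C]

set_option linter.unusedSectionVars false

open IsCartRestrCat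

/-! ### Restriction categories -/

@[simp] theorem rst_self_comp {X Y : C} (f : X ⟶ Y) : rst f ≫ f = f := rst_comp_self f

@[simp] theorem rst_self_comp_assoc {X Y Z : C} (f : X ⟶ Y) (g : Y ⟶ Z) :
    rst f ≫ f ≫ g = f ≫ g := by rw [← assoc, rst_comp_self]

@[simp] theorem rst_id (X : C) : rst (𝟙 X) = 𝟙 X := by
  simpa using rst_comp_self (𝟙 X)

@[simp] theorem rst_rst {X Y : C} (f : X ⟶ Y) : rst (rst f) = rst f := by
  simpa using rst_rst_comp f (𝟙 X)

@[simp] theorem rst_idem {X Y : C} (f : X ⟶ Y) : rst f ≫ rst f = rst f := by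
  simpa using (rst_rst_comp f f).symm

@[simp] theorem rst_idem_assoc {X Y Z : C} (f : X ⟶ Y) (g : X ⟶ Z) :
    rst f ≫ rst f ≫ g = rst f ≫ g := by rw [← assoc, rst_idem]

theorem rst_left_comm {X Y Z W : C} (f : X ⟶ Y) (g : X ⟶ Z) (h : X ⟶ W) :
    rst f ≫ rst g ≫ h = rst g ≫ rst f ≫ h := by rw [← assoc, rst_comm, assoc]

@[simp] theorem rst_comp_rst_comp {X Y Z : C} (f : X ⟶ Y) (g : Y ⟶ Z) :
    rst f ≫ rst (f ≫ g) = rst (f ≫ g) := by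
  rw [← rst_rst_comp, rst_self_comp_assoc]

@[simp] theorem rst_comp_comp_rst {X Y Z : C} (f : X ⟶ Y) (g : Y ⟶ Z) :
    rst (f ≫ g) ≫ rst f = rst (f ≫ g) := by
  rw [rst_comm, rst_comp_rst_comp]

theorem comp_rst_assoc {W X Y Z : C} (f : W ⟶ X) (g : X ⟶ Y) (h : X ⟶ Z) :
    f ≫ rst g ≫ h = rst (f ≫ g) ≫ f ≫ h := by
  rw [← assoc, comp_rst, assoc]

theorem rst_comp {X Y Z : C} (f : X ⟶ Y) (g : Y ⟶ Z) : rst (f ≫ g) = rst (f ≫ rst g) := by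
  rw [comp_rst, rst_rst_comp, rst_comp_comp_rst]

theorem rst_comp_congr {X Y Z W : C} (f : X ⟶ Y) {g : Y ⟶ Z} {h : Y ⟶ W} (e : rst g = rst h) :
    rst (f ≫ g) = rst (f ≫ h) := by
  rw [rst_comp, e, ← rst_comp]

theorem rst_comp_of_total {X Y Z : C} (f : X ⟶ Y) {g : Y ⟶ Z} (hg : IsTotal g) :
    rst (f ≫ g) = rst f := by
  rw [rst_comp, hg, comp_id]

theorem IsTotal.comp {X Y Z : C} {f : X ⟶ Y} {g : Y ⟶ Z} (hf : IsTotal f) (hg : IsTotal g) :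
    IsTotal (f ≫ g) := (rst_comp_of_total f hg).trans hf

theorem isTotal_id (X : C) : IsTotal (𝟙 X) := rst_id X

/-- `f` absorbs the restriction of any map whose domain contains that of `f`. -/
theorem rst_comp_of_le {X Y Z : C} {e : X ⟶ Z} {f : X ⟶ Y} (h : rst e ≫ rst f = rst f) :
    rst e ≫ f = f := by
  rw [← rst_self_comp f, ← assoc, h]

theorem rst_comp_of_eq {X Y Z : C} {e : X ⟶ Z} {f : X ⟶ Y} (h : rst e = rst f) :
    rst e ≫ f = f := by
  rw [h, rst_self_comp]

/-! ### Products -/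

@[simp] theorem rst_fst_eq (X Y : C) : rst (fst X Y) = 𝟙 _ := fst_total X Y
@[simp] theorem rst_snd_eq (X Y : C) : rst (snd X Y) = 𝟙 _ := snd_total X Y
@[simp] theorem rst_bang_eq (X : C) : rst (bang X) = 𝟙 _ := bang_total X

@[simp] theorem rst_comp_fst {T X Y : C} (f : T ⟶ prod X Y) : rst (f ≫ fst X Y) = rst f :=
  rst_comp_of_total f (fst_total X Y)
@[simp] theorem rst_comp_snd {T X Y : C} (f : T ⟶ prod X Y) : rst (f ≫ snd X Y) = rst f :=
  rst_comp_of_total f (snd_total X Y)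

@[simp] theorem pair_fst {T X Y : C} (f : T ⟶ X) (g : T ⟶ Y) :
    pair f g ≫ fst X Y = rst g ≫ f := by
  have h := pair_fst_le f g
  rw [RLe, rst_comp_fst, rst_pair] at h
  rw [← h, rst_comm, assoc, rst_self_comp]

@[simp] theorem pair_snd {T X Y : C} (f : T ⟶ X) (g : T ⟶ Y) :
    pair f g ≫ snd X Y = rst f ≫ g := by
  have h := pair_snd_le f g
  rw [RLe, rst_comp_snd, rst_pair] at h
  rw [← h, assoc, rst_self_comp]

@[simp] theorem pair_fst_assoc {T X Y Z : C} (f : T ⟶ X) (g : T ⟶ Y) (h : X ⟶ Z) :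
    pair f g ≫ fst X Y ≫ h = rst g ≫ f ≫ h := by
  rw [← assoc, pair_fst, assoc]

@[simp] theorem pair_snd_assoc {T X Y Z : C} (f : T ⟶ X) (g : T ⟶ Y) (h : Y ⟶ Z) :
    pair f g ≫ snd X Y ≫ h = rst f ≫ g ≫ h := by
  rw [← assoc, pair_snd, assoc]

theorem pair_eta {T X Y : C} (h : T ⟶ prod X Y) : pair (h ≫ fst X Y) (h ≫ snd X Y) = h := by
  symm
  apply pair_unique
  · exact rst_comp_self _
  · exact rst_comp_self _
  · simp

theorem prod_hom_ext {T X Y : C} {h k : T ⟶ prod X Y} (h₁ : h ≫ fst X Y = k ≫ fst X Y)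
    (h₂ : h ≫ snd X Y = k ≫ snd X Y) : h = k := by
  rw [← pair_eta h, ← pair_eta k, h₁, h₂]

@[simp] theorem pair_fst_snd (X Y : C) : pair (fst X Y) (snd X Y) = 𝟙 _ := by
  simpa using pair_eta (𝟙 (prod X Y))

theorem comp_pair {S T X Y : C} (h : S ⟶ T) (f : T ⟶ X) (g : T ⟶ Y) :
    h ≫ pair f g = pair (h ≫ f) (h ≫ g) := by
  apply prod_hom_ext <;> simp [comp_rst_assoc]

theorem comp_pair_assoc {S T X Y Z : C} (h : S ⟶ T) (f : T ⟶ X) (g : T ⟶ Y)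
    (k : prod X Y ⟶ Z) : h ≫ pair f g ≫ k = pair (h ≫ f) (h ≫ g) ≫ k := by
  rw [← assoc, comp_pair]

theorem pair_rst_left {T X Y Z : C} (e : T ⟶ Z) (f : T ⟶ X) (g : T ⟶ Y) :
    pair (rst e ≫ f) g = rst e ≫ pair f g := by
  apply prod_hom_ext <;> simp [rst_rst_comp, rst_left_comm]

theorem pair_rst_right {T X Y Z : C} (e : T ⟶ Z) (f : T ⟶ X) (g : T ⟶ Y) :
    pair f (rst e ≫ g) = rst e ≫ pair f g := by
  apply prod_hom_ext <;> simp [rst_rst_comp, rst_left_comm]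

@[simp] theorem rst_comp_pair_left {T X Y : C} (f : T ⟶ X) (g : T ⟶ Y) :
    rst f ≫ pair f g = pair f g := by rw [← pair_rst_left, rst_self_comp]

@[simp] theorem rst_comp_pair_right {T X Y : C} (f : T ⟶ X) (g : T ⟶ Y) :
    rst g ≫ pair f g = pair f g := by rw [← pair_rst_right, rst_self_comp]

/-- A partial map to the terminal object carries no information except its domain. -/
theorem one_hom_eq {X : C} (f : X ⟶ one) : f = rst f ≫ bang X := by
  have h := comp_bang_le f
  rw [← bang_unique (𝟙 (one : C)) (rst_id _), RLe, comp_id] at h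
  exact h.symm

theorem one_hom_ext {X : C} {f g : X ⟶ one} (h : rst f = rst g) : f = g := by
  rw [one_hom_eq f, one_hom_eq g, h]

/-! ### Sums of maps into a monoid -/

namespace MonData

variable {M : MonData C} {S T X : C}

theorem comp_sum (M : MonData C) (h : S ⟶ T) (f g : T ⟶ M.carrier) :
    h ≫ M.sum f g = M.sum (h ≫ f) (h ≫ g) := by
  simp only [sum, comp_pair_assoc]

theorem sum_rst_left (M : MonData C) (e : T ⟶ X) (f g : T ⟶ M.carrier) :
    M.sum (rst e ≫ f) g = rst e ≫ M.sum f g := by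
  simp only [sum, pair_rst_left, assoc]

theorem sum_rst_right (M : MonData C) (e : T ⟶ X) (f g : T ⟶ M.carrier) :
    M.sum f (rst e ≫ g) = rst e ≫ M.sum f g := by
  simp only [sum, pair_rst_right, assoc]

/-- Precomposition with a partial map preserves binary sums strictly, but the zero only up to a
restriction. Hence it distributes over nonempty finite sums only. -/
theorem comp_zeroMap (M : MonData C) (h : S ⟶ T) :
    h ≫ M.zeroMap T = rst h ≫ M.zeroMap S := by
  rw [zeroMap, zeroMap, ← assoc, ← assoc]
  congr 1
  apply one_hom_ext
  rw [rst_comp_of_total _ (bang_total _), rst_comp_of_total _ (bang_total _), rst_rst]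

namespace IsTotalCommMonoid

theorem rst_sum (h : M.IsTotalCommMonoid) (f g : T ⟶ M.carrier) :
    rst (M.sum f g) = rst f ≫ rst g := by
  rw [MonData.sum, rst_comp_of_total _ h.add_total, rst_pair]

theorem zeroMap_total (h : M.IsTotalCommMonoid) (T : C) : IsTotal (M.zeroMap T) :=
  (bang_total T).comp h.zero_total

theorem sum_comm (h : M.IsTotalCommMonoid) (f g : T ⟶ M.carrier) : M.sum f g = M.sum g f := by
  -- The monoid axioms are equations between total projections. Precomposing with a pairing of
  -- partial maps leaves behind restrictions of the components; the sum absorbs them, since its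
  -- domain is the intersection of the domains of its summands.
  have := congrArg (fun k => pair g f ≫ k) h.add_comm
  simp only [comp_sum, pair_fst, pair_snd] at this
  simp only [sum_rst_left, sum_rst_right] at this
  rw [show pair g f ≫ M.add = M.sum g f from rfl] at this
  rw [← this, ← assoc, ← h.rst_sum, rst_self_comp]

theorem sum_assoc (h : M.IsTotalCommMonoid) (f g k : T ⟶ M.carrier) :
    M.sum (M.sum f g) k = M.sum f (M.sum g k) := by
  have := congrArg (fun l => pair (pair f g) k ≫ l) h.add_assoc
  simp only [comp_sum, pair_fst_assoc, pair_fst, pair_snd] at this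
  simp only [sum_rst_left, sum_rst_right, rst_pair, assoc] at this
  have e : ∀ l : T ⟶ M.carrier, rst l = rst f ≫ rst g ≫ rst k →
      rst f ≫ rst g ≫ rst k ≫ rst f ≫ rst k ≫ rst g ≫ l = l := by
    intro l hl
    rw [← rst_self_comp l, hl]
    simp only [assoc, rst_left_comm, rst_idem_assoc]
  rw [e, e] at this
  · exact this
  · simp only [h.rst_sum]
  · simp only [h.rst_sum, assoc]

theorem zero_sum (h : M.IsTotalCommMonoid) (f : T ⟶ M.carrier) :
    M.sum (M.zeroMap T) f = f := by
  have := congrArg (fun l => f ≫ l) h.zero_add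
  rw [comp_sum, comp_zeroMap, comp_id] at this
  rwa [sum_rst_left, rst_comp_of_eq] at this
  rw [h.rst_sum, h.zeroMap_total T, id_comp]

theorem sum_zero (h : M.IsTotalCommMonoid) (f : T ⟶ M.carrier) :
    M.sum f (M.zeroMap T) = f := by
  rw [h.sum_comm, h.zero_sum]

theorem rst_zero_sum (h : M.IsTotalCommMonoid) (f : T ⟶ M.carrier) (e : T ⟶ X) :
    M.sum (rst e ≫ M.zeroMap T) f = rst e ≫ f := by
  rw [sum_rst_left, h.zero_sum]

/-- The partial maps into a total commutative monoid form a commutative monoid. -/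
@[reducible] def addCommMonoid (h : M.IsTotalCommMonoid) (T : C) :
    AddCommMonoid (T ⟶ M.carrier) where
  add := M.sum
  zero := M.zeroMap T
  add_assoc := h.sum_assoc
  zero_add := h.zero_sum
  add_zero := h.sum_zero
  add_comm := h.sum_comm
  nsmul := @nsmulRec _ ⟨M.zeroMap T⟩ ⟨M.sum⟩

theorem finSum_eq (h : M.IsTotalCommMonoid) {ι : Type} (s : Finset ι) (k : ι → (T ⟶ M.carrier)) :
    M.finSum s k = letI := h.addCommMonoid T; ∑ i ∈ s, k i := by
  let := h.addCommMonoid T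
  change _ = ∑ i ∈ s, k i
  rw [← Finset.sum_map_toList]
  rfl

theorem finSum_empty (h : M.IsTotalCommMonoid) {ι : Type} (k : ι → (T ⟶ M.carrier)) :
    M.finSum ∅ k = M.zeroMap T := by
  rw [h.finSum_eq]; rfl

theorem finSum_insert (h : M.IsTotalCommMonoid) {ι : Type} [DecidableEq ι] {s : Finset ι} {i : ι}
    (hi : i ∉ s) (k : ι → (T ⟶ M.carrier)) :
    M.finSum (insert i s) k = M.sum (k i) (M.finSum s k) := by
  let := h.addCommMonoid T
  rw [h.finSum_eq, h.finSum_eq]; exact Finset.sum_insert hi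

theorem finSum_singleton (h : M.IsTotalCommMonoid) {ι : Type} (i : ι) (k : ι → (T ⟶ M.carrier)) :
    M.finSum {i} k = k i := by
  let := h.addCommMonoid T
  rw [h.finSum_eq]; exact Finset.sum_singleton k i

theorem finSum_unique (h : M.IsTotalCommMonoid) {ι : Type} [Fintype ι] [Unique ι]
    (k : ι → (T ⟶ M.carrier)) : M.finSum Finset.univ k = k default := by
  rw [Finset.univ_unique, h.finSum_singleton]

theorem finSum_equiv (h : M.IsTotalCommMonoid) {ι κ : Type} [Fintype ι] [Fintype κ] (e : ι ≃ κ)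
    {k : ι → (T ⟶ M.carrier)} {l : κ → (T ⟶ M.carrier)} (hkl : ∀ i, k i = l (e i)) :
    M.finSum Finset.univ k = M.finSum Finset.univ l := by
  let := h.addCommMonoid T
  rw [h.finSum_eq, h.finSum_eq]; exact Fintype.sum_equiv e k l hkl

theorem finSum_sigma (h : M.IsTotalCommMonoid) {ι : Type} {κ : ι → Type} [Fintype ι]
    [∀ i, Fintype (κ i)] (k : (Σ i, κ i) → (T ⟶ M.carrier)) :
    M.finSum Finset.univ k = M.finSum Finset.univ fun i => M.finSum Finset.univ fun j =>
      k ⟨i, j⟩ := by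
  let := h.addCommMonoid T
  simp only [h.finSum_eq]; exact Fintype.sum_sigma k

theorem finSum_option (h : M.IsTotalCommMonoid) {ι : Type} [Fintype ι]
    (k : Option ι → (T ⟶ M.carrier)) :
    M.finSum Finset.univ k = M.sum (k none) (M.finSum Finset.univ fun i => k (some i)) := by
  let := h.addCommMonoid T
  simp only [h.finSum_eq]; exact Fintype.sum_option k

end IsTotalCommMonoid

theorem finSum_congr {ι : Type} {s : Finset ι} {k l : ι → (T ⟶ M.carrier)}
    (hkl : ∀ i ∈ s, k i = l i) : M.finSum s k = M.finSum s l := by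
  rw [finSum, finSum, List.map_congr_left fun i hi => hkl i (Finset.mem_toList.1 hi)]

namespace IsTotalCommMonoid

/-- A map between hom-sets that preserves binary sums preserves nonempty finite sums. -/
theorem map_finSum {N : MonData C} (hM : M.IsTotalCommMonoid) (hN : N.IsTotalCommMonoid)
    (φ : (T ⟶ M.carrier) → (S ⟶ N.carrier)) (hφ : ∀ f g, φ (M.sum f g) = N.sum (φ f) (φ g))
    {ι : Type} {s : Finset ι} (hs : s.Nonempty) (k : ι → (T ⟶ M.carrier)) :
    φ (M.finSum s k) = N.finSum s fun i => φ (k i) := by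
  classical
  induction hs using Finset.Nonempty.cons_induction with
  | singleton i => rw [hM.finSum_singleton, hN.finSum_singleton]
  | cons i s hi hs ih =>
    rw [Finset.cons_eq_insert, hM.finSum_insert hi, hN.finSum_insert hi, hφ, ih]

theorem comp_finSum (h : M.IsTotalCommMonoid) {ι : Type} {s : Finset ι} (hs : s.Nonempty)
    (e : S ⟶ T) (k : ι → (T ⟶ M.carrier)) :
    e ≫ M.finSum s k = M.finSum s fun i => e ≫ k i :=
  h.map_finSum h (fun f => e ≫ f) (M.comp_sum e) hs k

/-- A sum with finitely many terms `e ≫ 0` added. -/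
theorem sum_finSum_rst_zero (h : M.IsTotalCommMonoid) {ι : Type} (s : Finset ι) {e : T ⟶ X}
    {f : T ⟶ M.carrier} (hf : rst e ≫ f = f) :
    M.sum (M.finSum s fun _ => rst e ≫ M.zeroMap T) f = f := by
  classical
  induction s using Finset.induction_on with
  | empty => rw [h.finSum_empty, h.zero_sum]
  | insert i s hi ih => rw [h.finSum_insert hi, h.sum_assoc, ih, h.rst_zero_sum, hf]

end IsTotalCommMonoid

/-! ### Product monoids -/

variable {N : MonData C}

theorem prodMon_sum (M N : MonData C) (a c : T ⟶ M.carrier) (b d : T ⟶ N.carrier) :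
    (M.prodMon N).sum (pair a b) (pair c d) = pair (M.sum a c) (N.sum b d) := by
  have h : (M.prodMon N).sum (pair a b) (pair c d) =
      rst b ≫ rst d ≫ rst a ≫ rst c ≫ pair (M.sum a c) (N.sum b d) := by
    change pair (pair a b) (pair c d) ≫ pair _ _ = _
    simp only [comp_pair, comp_sum, pair_fst_assoc, pair_snd_assoc, pair_fst, pair_snd]
    simp only [sum_rst_left, sum_rst_right, pair_rst_left, pair_rst_right, rst_pair, assoc,
      rst_left_comm, rst_idem_assoc]
  -- Each of the four restrictions split off belongs to a summand of one of the two sums, which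
  -- absorbs it.
  have h₁ {L : MonData C} (f g : T ⟶ L.carrier) : rst f ≫ L.sum f g = L.sum f g := by
    rw [← sum_rst_left, rst_self_comp]
  have h₂ {L : MonData C} (f g : T ⟶ L.carrier) : rst g ≫ L.sum f g = L.sum f g := by
    rw [← sum_rst_right, rst_self_comp]
  rw [h, ← pair_rst_left, h₂, ← pair_rst_left, h₁, ← pair_rst_right, h₂, ← pair_rst_right, h₁]

theorem prodMon_zeroMap (M N : MonData C) (T : C) :
    (M.prodMon N).zeroMap T = pair (M.zeroMap T) (N.zeroMap T) := by
  simp [prodMon, zeroMap, comp_pair]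

end MonData

end Basic

open IsCartRestrCat

section Tuples

set_option linter.unusedSectionVars false

variable {C : Type u} [CartRestrStruct.{v} C] [IsCartRestrCat C] {S T A B X Y Z : C}

set_option linter.unusedSectionVars false

/-! ### Powers and tuples -/

/-- The first vector of an element of `Aⁿ⁺¹ × X`. -/
def phead (A X : C) (n : ℕ) : pow A (n + 1) X ⟶ A := fst _ _

/-- The projection of `Aⁿ⁺¹ × X` that forgets the first vector. -/
def ptail (A X : C) (n : ℕ) : pow A (n + 1) X ⟶ pow A n X := snd _ _

/-- A vector in front of an element of `Aⁿ × X`. -/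
def pcons {n : ℕ} (a : T ⟶ A) (w : T ⟶ pow A n X) : T ⟶ pow A (n + 1) X := pair a w

theorem phead_total (A X : C) (n : ℕ) : IsTotal (phead A X n) := fst_total _ _

theorem ptail_total (A X : C) (n : ℕ) : IsTotal (ptail A X n) := snd_total _ _

@[simp] theorem rst_phead (A X : C) (n : ℕ) : rst (phead A X n) = 𝟙 _ := fst_total _ _

@[simp] theorem rst_ptail (A X : C) (n : ℕ) : rst (ptail A X n) = 𝟙 _ := snd_total _ _

@[simp] theorem vproj_zero (A X : C) (n : ℕ) :
    vproj (A := A) (X := X) (n + 1) 0 = phead A X n := rfl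

@[simp] theorem vproj_succ (A X : C) (n : ℕ) (i : Fin n) :
    vproj (A := A) (X := X) (n + 1) i.succ = ptail A X n ≫ vproj n i := rfl

theorem pproj_succ (A X : C) (n : ℕ) :
    pproj (A := A) (X := X) (n + 1) = ptail A X n ≫ pproj n := rfl

theorem tup_succ (n : ℕ) (a : Fin (n + 1) → (T ⟶ A)) (x : T ⟶ X) :
    tup (n + 1) a x = pcons (a 0) (tup n (fun i => a i.succ) x) := rfl

section pcons

variable {n : ℕ} (a : T ⟶ A) (w : T ⟶ pow A n X)

theorem comp_pcons (h : S ⟶ T) : h ≫ pcons a w = pcons (h ≫ a) (h ≫ w) := comp_pair h a w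

theorem rst_pcons : rst (pcons a w) = rst a ≫ rst w := rst_pair a w

theorem pcons_phead : pcons a w ≫ phead A X n = rst w ≫ a := pair_fst a w

theorem pcons_ptail : pcons a w ≫ ptail A X n = rst a ≫ w := pair_snd a w

theorem pcons_ptail_assoc (h : pow A n X ⟶ Y) :
    pcons a w ≫ ptail A X n ≫ h = rst a ≫ w ≫ h := pair_snd_assoc a w h

theorem pcons_rst_left (e : T ⟶ Y) : pcons (rst e ≫ a) w = rst e ≫ pcons a w :=
  pair_rst_left e a w

theorem pcons_rst_right (e : T ⟶ Y) : pcons a (rst e ≫ w) = rst e ≫ pcons a w :=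
  pair_rst_right e a w

theorem pcons_eta (w : T ⟶ pow A (n + 1) X) :
    pcons (w ≫ phead A X n) (w ≫ ptail A X n) = w := pair_eta w

@[simp] theorem pcons_phead_ptail (A X : C) (n : ℕ) :
    pcons (phead A X n) (ptail A X n) = 𝟙 _ := pair_fst_snd _ _

end pcons

theorem vproj_total (n : ℕ) (i : Fin n) : IsTotal (vproj (A := A) (X := X) n i) := by
  induction n with
  | zero => exact i.elim0
  | succ n ih =>
    refine Fin.cases ?_ (fun j => ?_) i
    · exact fst_total _ _
    · exact (snd_total _ _).comp (ih j)

theorem pproj_total (n : ℕ) : IsTotal (pproj (A := A) (X := X) n) := by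
  induction n with
  | zero => exact rst_id _
  | succ n ih => exact (snd_total _ _).comp ih

theorem comp_tup (h : S ⟶ T) (n : ℕ) (a : Fin n → (T ⟶ A)) (x : T ⟶ X) :
    h ≫ tup n a x = tup n (fun i => h ≫ a i) (h ≫ x) := by
  induction n with
  | zero => rfl
  | succ n ih => rw [tup_succ, comp_pcons, ih, tup_succ]

theorem comp_tup_assoc (h : S ⟶ T) (n : ℕ) (a : Fin n → (T ⟶ A)) (x : T ⟶ X)
    (k : pow A n X ⟶ Y) : h ≫ tup n a x ≫ k = tup n (fun i => h ≫ a i) (h ≫ x) ≫ k := by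
  rw [← assoc, comp_tup]

theorem tup_vproj (n : ℕ) (a : Fin n → (T ⟶ A)) (x : T ⟶ X) (i : Fin n) :
    tup n a x ≫ vproj n i = rst (tup n a x) ≫ a i := by
  induction n with
  | zero => exact i.elim0
  | succ n ih =>
    refine Fin.cases ?_ (fun j => ?_) i
    · rw [vproj_zero, tup_succ, pcons_phead, rst_pcons, rst_comm, assoc, rst_self_comp]
    · rw [vproj_succ, tup_succ, pcons_ptail_assoc, ih, rst_pcons, assoc]

theorem tup_pproj (n : ℕ) (a : Fin n → (T ⟶ A)) (x : T ⟶ X) :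
    tup n a x ≫ pproj n = rst (tup n a x) ≫ x := by
  induction n with
  | zero => exact (comp_id _).trans (rst_self_comp _).symm
  | succ n ih => rw [pproj_succ, tup_succ, pcons_ptail_assoc, ih, rst_pcons, assoc]

@[simp] theorem tup_self (n : ℕ) : tup n (fun i => vproj (A := A) (X := X) n i) (pproj n) = 𝟙 _ := by
  induction n with
  | zero => rfl
  | succ n ih =>
    rw [tup_succ, pproj_succ]
    simp only [vproj_succ, vproj_zero]
    rw [← comp_tup, ih, comp_id, pcons_phead_ptail]

theorem tup_comp_self {n : ℕ} (h : T ⟶ pow A n X) :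
    tup n (fun i => h ≫ vproj n i) (h ≫ pproj n) = h := by
  rw [← comp_tup, tup_self, comp_id]

theorem rst_comp_rst_tup (n : ℕ) (a : Fin n → (T ⟶ A)) (x : T ⟶ X) :
    rst x ≫ rst (tup n a x) = rst (tup n a x) := by
  have h := congrArg rst (tup_pproj n a x)
  rw [rst_comp_of_total _ (pproj_total n), rst_rst_comp] at h
  rw [rst_comm, ← h]

theorem rst_vec_comp_rst_tup (n : ℕ) (a : Fin n → (T ⟶ A)) (x : T ⟶ X) (i : Fin n) :
    rst (a i) ≫ rst (tup n a x) = rst (tup n a x) := by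
  have h := congrArg rst (tup_vproj n a x i)
  rw [rst_comp_of_total _ (vproj_total n i), rst_rst_comp] at h
  rw [rst_comm, ← h]

theorem rst_tup_congr {n : ℕ} {a : Fin n → (T ⟶ A)} {x : T ⟶ X} {b : Fin n → (T ⟶ B)}
    {y : T ⟶ Y} (hv : ∀ i, rst (a i) = rst (b i)) (hp : rst x = rst y) :
    rst (tup n a x) = rst (tup n b y) := by
  induction n with
  | zero => exact hp
  | succ n ih => rw [tup_succ, tup_succ, rst_pcons, rst_pcons, hv, ih fun i => hv i.succ]

/-- The domain of a tuple is that of its last component when the latter is the smallest. -/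
theorem rst_tup_of_le {n : ℕ} {a : Fin n → (T ⟶ A)} {x : T ⟶ X}
    (h : ∀ i, rst (a i) ≫ rst x = rst x) : rst (tup n a x) = rst x := by
  induction n with
  | zero => rfl
  | succ n ih => rw [tup_succ, rst_pcons, ih fun i => h i.succ, h]

theorem rst_tup_of_total {n : ℕ} {a : Fin n → (T ⟶ A)} {x : T ⟶ X} (h : ∀ i, IsTotal (a i)) :
    rst (tup n a x) = rst x :=
  rst_tup_of_le fun i => by rw [h i, id_comp]

theorem IsTotal.tup {n : ℕ} {a : Fin n → (T ⟶ A)} {x : T ⟶ X} (h : ∀ i, IsTotal (a i))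
    (hx : IsTotal x) : IsTotal (tup n a x) := (rst_tup_of_total h).trans hx

theorem tup_update_rst (n : ℕ) (a : Fin n → (T ⟶ A)) (x : T ⟶ X) (i : Fin n) (b : T ⟶ A)
    (e : T ⟶ Y) :
    tup n (Function.update a i (rst e ≫ b)) x = rst e ≫ tup n (Function.update a i b) x := by
  induction n with
  | zero => exact i.elim0
  | succ n ih =>
    refine Fin.cases ?_ (fun j => ?_) i
    · rw [tup_succ, tup_succ, ← pcons_rst_left]; simp
    · rw [tup_succ, tup_succ, ← pcons_rst_right]
      have h (b) : (fun i : Fin n => Function.update a j.succ b i.succ) =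
          Function.update (fun i : Fin n => a i.succ) j b := by
        funext i
        by_cases hij : i = j
        · subst hij; simp
        · simp [hij, Function.update_of_ne]
      rw [h, h, ih, Function.update_of_ne (Fin.succ_ne_zero j).symm,
        Function.update_of_ne (Fin.succ_ne_zero j).symm]

/-- Selecting entries of a tuple may drop some of them, so the domain can only grow. -/
theorem rst_tup_comp_rst_tup_reindex {m n : ℕ} (σ : Fin m → Fin n) (a : Fin n → (T ⟶ A))
    (x : T ⟶ X) :
    rst (tup n a x) ≫ rst (tup m (fun j => a (σ j)) x) = rst (tup n a x) := by
  have h : tup n a x ≫ tup m (fun j => vproj n (σ j)) (pproj n) =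
      rst (tup n a x) ≫ tup m (fun j => a (σ j)) x := by
    simp only [comp_tup, tup_vproj, tup_pproj]
  have h' := congrArg rst h
  rwa [rst_comp_of_total _ (IsTotal.tup (fun _ => vproj_total _ _) (pproj_total _)),
    rst_rst_comp, eq_comm] at h'

theorem tup_comp_reindex {m n : ℕ} (σ : Fin m → Fin n) (a : Fin n → (T ⟶ A)) (x : T ⟶ X) :
    tup n a x ≫ tup m (fun j => vproj n (σ j)) (pproj n) =
      rst (tup n a x) ≫ tup m (fun j => a (σ j)) x := by
  simp only [comp_tup, tup_vproj, tup_pproj]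

theorem tup_comp_perm {n : ℕ} (σ : Equiv.Perm (Fin n)) (a : Fin n → (T ⟶ A)) (x : T ⟶ X) :
    tup n a x ≫ tup n (fun j => vproj n (σ j)) (pproj n) = tup n (fun j => a (σ j)) x := by
  rw [tup_comp_reindex]
  apply rst_comp_of_le
  -- For a permutation the selection can be undone: the inclusion of domains for `σ.symm` is the one
  -- that is needed here.
  rw [rst_comm]
  simpa using rst_tup_comp_rst_tup_reindex (fun j => σ.symm j) (fun j => a (σ j)) x

theorem tup_congr {n : ℕ} {a b : Fin n → (T ⟶ A)} {x y : T ⟶ X} (h : ∀ i, a i = b i)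
    (hx : x = y) : tup n a x = tup n b y := by
  rw [funext h, hx]

end Tuples

namespace MonData.IsTotalCommMonoid

variable {C : Type u} [CartRestrStruct.{v} C] [IsCartRestrCat C] {M : MonData C} {T X : C}

/-- Terms `e ≫ 0` may be left out of a sum that contains a term whose domain lies in that
of `e`. -/
theorem finSum_sum_of_injective (h : M.IsTotalCommMonoid) {ι κ : Type} [Fintype ι] [Fintype κ]
    {φ : κ → ι} (hφ : Function.Injective φ) {t : ι → (T ⟶ M.carrier)} {e : T ⟶ X}
    (ht : ∀ i, (∀ j, φ j ≠ i) → t i = rst e ≫ M.zeroMap T) {s : T ⟶ M.carrier}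
    (hs : rst e ≫ s = s) :
    M.sum (M.finSum Finset.univ t) s = M.sum (M.finSum Finset.univ fun j => t (φ j)) s := by
  classical
  let := h.addCommMonoid T
  have h₁ : M.finSum Finset.univ t = M.sum (M.finSum Finset.univ fun j => t (φ j))
      (M.finSum (Finset.univ.map ⟨φ, hφ⟩)ᶜ fun i => t i) := by
    simp only [h.finSum_eq]
    have h₂ := Finset.sum_add_sum_compl (Finset.univ.map ⟨φ, hφ⟩) t
    rw [Finset.sum_map] at h₂
    exact h₂.symm
  have h₂ : ∀ i ∈ (Finset.univ.map ⟨φ, hφ⟩)ᶜ, t i = rst e ≫ M.zeroMap T := fun i hi =>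
    ht i fun j hj => by simp [← hj] at hi
  rw [h₁, h.sum_assoc, MonData.finSum_congr h₂, h.sum_finSum_rst_zero _ hs]

end MonData.IsTotalCommMonoid

/-! ### Evaluation of symmetric sequences -/

namespace FaaSeq

variable {C : Type u} [CartRestrStruct.{v} C] [IsCartRestrCat C] {P Q : PreFaa C} {S T : C}
  {ι κ : Type} [Fintype ι] [Nonempty ι] [Fintype κ] [Nonempty κ]

/-- The value of `fₙ` at a family of vectors indexed by a finite type with `n` elements. -/
noncomputable def ev (f : FaaSeq P Q) (a : ι → (T ⟶ P.mon.carrier)) (x : T ⟶ P.pt) :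
    T ⟶ Q.mon.carrier :=
  tup (Fintype.card ι) (fun i => a ((Fintype.equivFin ι).symm i)) x ≫
    f.hi (Fintype.card ι) Fintype.card_pos

theorem comp_ev (f : FaaSeq P Q) (h : S ⟶ T) (a : ι → (T ⟶ P.mon.carrier)) (x : T ⟶ P.pt) :
    h ≫ f.ev a x = f.ev (fun i => h ≫ a i) (h ≫ x) := by
  rw [ev, comp_tup_assoc, ev]

theorem IsMap.symm_apply {f : FaaSeq P Q} (hf : f.IsMap) (n : ℕ) (hn : 0 < n)
    (σ : Equiv.Perm (Fin n)) (a : Fin n → (T ⟶ P.mon.carrier)) (x : T ⟶ P.pt) :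
    tup n (fun i => a (σ i)) x ≫ f.hi n hn = tup n a x ≫ f.hi n hn := by
  rw [← tup_comp_perm, assoc, hf.symm]

/-- Symmetry makes the enumeration chosen in `ev` immaterial. Arguments can therefore be indexed by
types such as `Option ι` or sums, in which a new variable has a natural place. -/
theorem IsMap.ev_eq {f : FaaSeq P Q} (hf : f.IsMap) {n : ℕ} (hn : 0 < n) (e : Fin n ≃ ι)
    (a : ι → (T ⟶ P.mon.carrier)) (x : T ⟶ P.pt) :
    f.ev a x = tup n (fun i => a (e i)) x ≫ f.hi n hn := by
  obtain rfl : n = Fintype.card ι := by simpa using Fintype.card_congr e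
  rw [ev, ← hf.symm_apply _ _ (e.trans (Fintype.equivFin ι))]
  simp

theorem IsMap.ev_reindex {f : FaaSeq P Q} (hf : f.IsMap) (e : ι ≃ κ)
    (a : κ → (T ⟶ P.mon.carrier)) (x : T ⟶ P.pt) :
    f.ev (fun i => a (e i)) x = f.ev a x := by
  rw [hf.ev_eq Fintype.card_pos ((Fintype.equivFin ι).symm.trans e)]; rfl

theorem IsMap.rst_ev {f : FaaSeq P Q} (hf : f.IsMap) {a : ι → (T ⟶ P.mon.carrier)} {x : T ⟶ P.pt}
    (h : ∀ i, rst (a i) ≫ rst x = rst x) : rst (f.ev a x) = rst (x ≫ f.base) := by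
  rw [ev, rst_comp_congr _ (hf.rst_hi _ _), ← assoc, tup_pproj, assoc, rst_rst_comp,
    rst_tup_of_le fun i => h _, rst_comp_rst_comp]

theorem IsMap.rst_tup_hi {f : FaaSeq P Q} (hf : f.IsMap) (n : ℕ) (hn : 0 < n)
    {a : Fin n → (T ⟶ P.mon.carrier)} {x : T ⟶ P.pt}
    (h : ∀ i, rst (a i) ≫ rst x = rst x) : rst (tup n a x ≫ f.hi n hn) = rst (x ≫ f.base) := by
  rw [rst_comp_congr _ (hf.rst_hi _ _), ← assoc, tup_pproj, assoc, rst_rst_comp,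
    rst_tup_of_le fun i => h _, rst_comp_rst_comp]

/-- A value with a zero vector among its arguments. -/
theorem IsMap.tup_update_zero {f : FaaSeq P Q} (hf : f.IsMap) (hP : P.mon.IsTotalCommMonoid)
    {n : ℕ} (hn : 0 < n) {a : Fin n → (T ⟶ P.mon.carrier)} {x : T ⟶ P.pt}
    (h : ∀ i, rst (a i) ≫ rst x = rst x) (i : Fin n) :
    tup n (Function.update a i (P.mon.zeroMap T)) x ≫ f.hi n hn =
      rst (x ≫ f.base) ≫ Q.mon.zeroMap T := by
  rw [hf.map_zero, hf.rst_tup_hi n hn]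
  intro j
  by_cases hij : j = i
  · subst hij; rw [Function.update_self, hP.zeroMap_total, id_comp]
  · rw [Function.update_of_ne hij, h]

theorem IsMap.ev_zero {f : FaaSeq P Q} (hf : f.IsMap) (hP : P.mon.IsTotalCommMonoid)
    {a : ι → (T ⟶ P.mon.carrier)} {x : T ⟶ P.pt} (h : ∀ i, rst (a i) ≫ rst x = rst x) (i : ι)
    (hi : a i = P.mon.zeroMap T) : f.ev a x = rst (x ≫ f.base) ≫ Q.mon.zeroMap T := by
  rw [← hf.tup_update_zero hP Fintype.card_pos
    (a := fun j => a ((Fintype.equivFin ι).symm j)) (fun j => h _) (Fintype.equivFin ι i), ev]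
  congr 2
  refine (Function.update_eq_self_iff.2 ?_).symm
  rw [Equiv.symm_apply_apply, hi]

end FaaSeq

/-! ### Replacements -/

namespace Repl

variable {n m : ℕ}

theorem mem_free {e : Repl n m} {j : Fin m} : j ∈ e.free ↔ ∀ i, e.1 i ≠ some j := by
  simp [free]

instance : Unique (Repl n 0) where
  default := ⟨fun _ => none, by simp⟩
  uniq e := Subtype.ext (funext fun i => by
    change e.1 i = none
    rcases h : e.1 i with _ | j
    · rfl
    · exact j.elim0)

/-- A new direction vector either stays free or replaces an argument not yet replaced. -/
def extend (e : Repl n m) (o : Option {i // e.1 i = none}) : Repl n (m + 1) :=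
  ⟨fun i => if o.map Subtype.val = some i then some 0 else (e.1 i).map Fin.succ, by
    intro i i' j hi hi'
    dsimp only at hi hi'
    split_ifs at hi with h <;> split_ifs at hi' with h'
    · rw [h] at h'; simpa using h'
    · simp only [Option.some.injEq] at hi
      subst hi
      simp [Fin.succ_ne_zero] at hi'
    · simp only [Option.some.injEq] at hi'
      subst hi'
      simp [Fin.succ_ne_zero] at hi
    · simp only [Option.map_eq_some_iff] at hi hi'
      obtain ⟨k, hk, rfl⟩ := hi
      obtain ⟨k', hk', hkk⟩ := hi'
      rw [Fin.succ_inj] at hkk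
      subst hkk
      exact e.2 i i' _ hk hk'⟩

theorem extend_none_apply (e : Repl n m) (i : Fin n) :
    (e.extend none).1 i = (e.1 i).map Fin.succ := by simp [extend]

theorem extend_some_self (e : Repl n m) (i : {i // e.1 i = none}) :
    (e.extend (some i)).1 i = some 0 := by simp [extend]

theorem extend_some_of_ne (e : Repl n m) (i : {i // e.1 i = none}) {i' : Fin n} (h : i' ≠ i.1) :
    (e.extend (some i)).1 i' = (e.1 i').map Fin.succ := by simp [extend, h.symm]

/-- This is the combinatorics of differentiating once more: a replacement for m + 1 directions is
one for the last m, together with the fate of direction 0. Injectivity of replacements ensures that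
direction 0 replaces at most one argument. -/
theorem extend_bijective : Function.Bijective
    fun p : (Σ e : Repl n m, Option {i // e.1 i = none}) => p.1.extend p.2 := by
  constructor
  · rintro ⟨e, o⟩ ⟨e', o'⟩ h
    -- `key` recovers `e` from its extension by looking at the directions other than 0; `key'`
    -- recovers `o` as the place where direction 0 is used.
    have key : ∀ (e : Repl n m) (o : Option {i // e.1 i = none}) (i : Fin n) (j : Fin m),
        e.1 i = some j ↔ (e.extend o).1 i = some j.succ := by
      intro e o i j
      rcases o with _ | i₀
      · rw [extend_none_apply]; simp
      · by_cases hi : i = i₀.1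
        · subst hi; simp [extend_some_self, i₀.2, (Fin.succ_ne_zero j).symm]
        · rw [extend_some_of_ne _ _ hi]; simp
    have key' : ∀ (e : Repl n m) (o : Option {i // e.1 i = none}) (i : Fin n),
        o.map Subtype.val = some i ↔ (e.extend o).1 i = some 0 := by
      intro e o i
      simp only [extend]
      split_ifs with hi
      · simp [hi]
      · simp only [hi, false_iff]
        simp [Fin.succ_ne_zero]
    simp only at h
    obtain rfl : e = e' := by
      apply Subtype.ext; funext i; apply Option.ext; intro j
      rw [key e o, key e' o', h]
    congr 1
    apply Option.map_injective Subtype.val_injective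
    apply Option.ext; intro i
    rw [key', key', h]
  · intro e'
    -- The preimage forgets direction 0 and shifts the others down.
    let e : Repl n m := ⟨fun i => (e'.1 i).bind fun j =>
        Fin.cases (motive := fun _ => Option (Fin m)) none some j, by
      intro i i' j hi hi'
      have aux : ∀ i, ((e'.1 i).bind fun j =>
          Fin.cases (motive := fun _ => Option (Fin m)) none some j) = some j →
          e'.1 i = some j.succ := by
        intro i hi
        rw [Option.bind_eq_some_iff] at hi
        obtain ⟨k, hk, hk'⟩ := hi
        revert hk hk'
        refine Fin.cases (by simp) (fun k => ?_) k
        simp +contextual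
      exact e'.2 i i' _ (aux i hi) (aux i' hi')⟩
    have he : ∀ i, e'.1 i ≠ some 0 → (e.1 i).map Fin.succ = e'.1 i := by
      intro i hi
      simp only [e]
      rcases h : e'.1 i with _ | j
      · rfl
      · rw [h] at hi
        revert hi
        refine Fin.cases (by simp) (fun k => ?_) j
        simp
    by_cases h : ∃ i, e'.1 i = some 0
    · obtain ⟨i, hi⟩ := h
      have hi' : e.1 i = none := by simp [e, hi]
      refine ⟨⟨e, some ⟨i, hi'⟩⟩, Subtype.ext (funext fun k => ?_)⟩
      by_cases hk : k = i
      · subst hk; rw [hi]; exact extend_some_self e ⟨k, hi'⟩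
      · refine (extend_some_of_ne e ⟨i, hi'⟩ hk).trans (he k fun h0 => hk (e'.2 _ _ _ h0 hi))
    · push Not at h
      refine ⟨⟨e, none⟩, Subtype.ext (funext fun k => ?_)⟩
      exact (extend_none_apply e k).trans (he k (h k))

theorem zero_mem_free_extend_none (e : Repl n m) : 0 ∈ (e.extend none).free := by
  rw [mem_free]; intro i; rw [extend_none_apply]; simp [Fin.succ_ne_zero]

theorem succ_mem_free_extend {e : Repl n m} {o : Option {i // e.1 i = none}} {j : Fin m} :
    j.succ ∈ (e.extend o).free ↔ j ∈ e.free := by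
  rw [mem_free, mem_free]
  refine forall_congr' fun i => not_congr ?_
  rcases o with _ | i₀
  · rw [extend_none_apply]; simp
  · by_cases hi : i = i₀.1
    · subst hi; simp [extend_some_self, i₀.2, (Fin.succ_ne_zero j).symm]
    · rw [extend_some_of_ne _ _ hi]; simp

theorem zero_notMem_free_extend_some (e : Repl n m) (i : {i // e.1 i = none}) :
    0 ∉ (e.extend (some i)).free := by
  rw [mem_free]; push Not; exact ⟨i, extend_some_self e i⟩

/-- The free direction vectors of `e.extend none`. -/
noncomputable def freeExtendNone (e : Repl n m) :
    Option {j // j ∈ e.free} ≃ {j // j ∈ (e.extend none).free} :=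
  Equiv.ofBijective
    (fun o => o.elim ⟨0, zero_mem_free_extend_none e⟩ fun j =>
      ⟨j.1.succ, succ_mem_free_extend.2 j.2⟩) <| by
    constructor
    · rintro (_ | j) (_ | k) h
      · rfl
      · exact absurd (congrArg Subtype.val h) (Fin.succ_ne_zero _).symm
      · exact absurd (congrArg Subtype.val h) (Fin.succ_ne_zero _)
      · have := Fin.succ_injective _ (congrArg Subtype.val h)
        rw [Subtype.ext this]
    · rintro ⟨j, hj⟩
      revert hj
      refine Fin.cases (fun _ => ⟨none, rfl⟩) (fun k hk => ?_) j
      exact ⟨some ⟨k, succ_mem_free_extend.1 hk⟩, rfl⟩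

/-- The free direction vectors of `e.extend (some i)`. -/
noncomputable def freeExtendSome (e : Repl n m) (i : {i // e.1 i = none}) :
    {j // j ∈ e.free} ≃ {j // j ∈ (e.extend (some i)).free} :=
  Equiv.ofBijective (fun j => ⟨j.1.succ, succ_mem_free_extend.2 j.2⟩) <| by
    constructor
    · intro j k h
      exact Subtype.ext (Fin.succ_injective _ (congrArg Subtype.val h))
    · rintro ⟨j, hj⟩
      revert hj
      refine Fin.cases (fun h => absurd h (zero_notMem_free_extend_some e i)) (fun k hk => ?_) j
      exact ⟨⟨k, succ_mem_free_extend.1 hk⟩, rfl⟩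

end Repl

/-! ### Objects with their monoids -/

section DiffObj

variable {C : Type u} [CartRestrStruct.{v} C]

/-- The equations between the monoids of a generalized differential restriction structure. -/
class DiffData.IsCoherent (G : DiffData C) : Prop where
  isMonoid : ∀ X : C, (G.L X).IsTotalCommMonoid
  L_L : ∀ X : C, G.L (G.L X).carrier = G.L X
  L_prod : ∀ X Y : C, G.L (prod X Y) = (G.L X).prodMon (G.L Y)
  L_one : G.L one = MonData.oneMon C

/-- A pair of a monoid `M` and an object `X` with `L X = M`.  Passing from objects to such pairs
makes the equations of `IsCoherent` hold by definition. -/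
structure DiffObj (G : DiffData C) extends PreFaa C where
  L_pt : G.L pt = mon

/-- The addition of `MonData.powMon`. -/
def MonData.powAdd (M N : MonData C) :
    (n : ℕ) → (prod (RestrictionFaa.pow M.carrier n N.carrier)
      (RestrictionFaa.pow M.carrier n N.carrier) ⟶ RestrictionFaa.pow M.carrier n N.carrier) ×'
      (one ⟶ RestrictionFaa.pow M.carrier n N.carrier)
  | 0 => ⟨N.add, N.zero⟩
  | n + 1 => ⟨(M.prodMon ⟨_, (powAdd M N n).1, (powAdd M N n).2⟩).add,
      (M.prodMon ⟨_, (powAdd M N n).1, (powAdd M N n).2⟩).zero⟩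

/-- The monoid `Mⁿ × N`. -/
abbrev MonData.powMon (M N : MonData C) (n : ℕ) : MonData C where
  carrier := RestrictionFaa.pow M.carrier n N.carrier
  add := (M.powAdd N n).1
  zero := (M.powAdd N n).2

namespace DiffObj

variable {G : DiffData C}

/-- The pair `(L X, X)`. -/
abbrev of (G : DiffData C) (X : C) : DiffObj G := ⟨⟨G.L X, X⟩, rfl⟩

/-- The monoid component can be substituted away. After this the transports in `DiffData.d` are
along reflexive equations, and the two forms of each axiom agree definitionally. -/
theorem exists_eq_of (P : DiffObj G) : ∃ X, P = of G X := by
  obtain ⟨⟨M, X⟩, h⟩ := P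
  change G.L X = M at h
  subst h
  exact ⟨X, rfl⟩

variable [G.IsCoherent]

theorem isMonoid (P : DiffObj G) : P.mon.IsTotalCommMonoid := by
  rw [← P.L_pt]; exact DiffData.IsCoherent.isMonoid _

/-- The object of vectors. -/
abbrev vec (P : DiffObj G) : DiffObj G :=
  ⟨⟨P.mon, P.mon.carrier⟩, by
    have h := DiffData.IsCoherent.L_L (G := G) P.pt
    rwa [P.L_pt] at h⟩

/-- The product. -/
abbrev prod (P Q : DiffObj G) : DiffObj G :=
  ⟨⟨⟨CartRestrStruct.prod P.mon.carrier Q.mon.carrier, (P.mon.prodMon Q.mon).add,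
    (P.mon.prodMon Q.mon).zero⟩, CartRestrStruct.prod P.pt Q.pt⟩, by
    have h := DiffData.IsCoherent.L_prod (G := G) P.pt Q.pt
    rwa [P.L_pt, Q.L_pt] at h⟩

/-- The terminal object. -/
abbrev one : DiffObj G :=
  ⟨⟨⟨CartRestrStruct.one, bang _, bang _⟩, CartRestrStruct.one⟩, DiffData.IsCoherent.L_one⟩

/-- The object `Aⁿ × X`. -/
abbrev pow (P : DiffObj G) (n : ℕ) : DiffObj G :=
  ⟨⟨P.mon.powMon P.mon n, RestrictionFaa.pow P.mon.carrier n P.pt⟩, by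
    induction n with
    | zero => exact P.L_pt
    | succ n ih => exact (P.vec.prod (Q := ⟨⟨P.mon.powMon P.mon n, _⟩, ih⟩)).L_pt⟩

end DiffObj

namespace DiffData

variable (G : DiffData C)

/-- The derivative of a map, without transports. -/
def d (P Q : DiffObj G) (f : P.pt ⟶ Q.pt) : prod P.mon.carrier P.pt ⟶ Q.mon.carrier :=
  (G.D f).cast (congrArg (fun M => prod (MonData.carrier M) P.pt) P.L_pt)
    (congrArg MonData.carrier Q.L_pt)

/-- The axioms of a generalized differential restriction structure, without transports. -/
class Laws [G.IsCoherent] : Prop where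
  d_add : ∀ P : DiffObj G, G.d (P.vec.prod P.vec) P.vec P.mon.add =
    fst (prod P.mon.carrier P.mon.carrier) (prod P.mon.carrier P.mon.carrier) ≫ P.mon.add
  d_zero : ∀ P : DiffObj G, G.d .one P.vec P.mon.zero = fst one one ≫ P.mon.zero
  pair_sum_d : ∀ (P Q : DiffObj G) {T : C} (f : P.pt ⟶ Q.pt) (a b : T ⟶ P.mon.carrier)
    (c : T ⟶ P.pt), pair (P.mon.sum a b) c ≫ G.d P Q f =
      Q.mon.sum (pair a c ≫ G.d P Q f) (pair b c ≫ G.d P Q f)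
  pair_zero_d : ∀ (P Q : DiffObj G) {T : C} (f : P.pt ⟶ Q.pt) (a : T ⟶ P.pt),
    pair (P.mon.zeroMap T) a ≫ G.d P Q f = rst (a ≫ f) ≫ Q.mon.zeroMap T
  d_fst : ∀ P Q : DiffObj G, G.d (P.prod Q) P (fst P.pt Q.pt) =
    fst (prod P.mon.carrier Q.mon.carrier) (prod P.pt Q.pt) ≫ fst P.mon.carrier Q.mon.carrier
  d_snd : ∀ P Q : DiffObj G, G.d (P.prod Q) Q (snd P.pt Q.pt) =
    fst (prod P.mon.carrier Q.mon.carrier) (prod P.pt Q.pt) ≫ snd P.mon.carrier Q.mon.carrier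
  d_pair : ∀ (P Q R : DiffObj G) (f : P.pt ⟶ Q.pt) (g : P.pt ⟶ R.pt),
    G.d P (Q.prod R) (pair f g) = pair (G.d P Q f) (G.d P R g)
  d_comp : ∀ (P Q R : DiffObj G) (f : P.pt ⟶ Q.pt) (g : Q.pt ⟶ R.pt),
    G.d P R (f ≫ g) = pair (G.d P Q f) (snd P.mon.carrier P.pt ≫ f) ≫ G.d Q R g
  d_d_linear : ∀ (P Q : DiffObj G) {T : C} (f : P.pt ⟶ Q.pt) (a c : T ⟶ P.mon.carrier)
    (x : T ⟶ P.pt),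
    pair (pair a (P.mon.zeroMap T)) (pair c x) ≫ G.d (P.vec.prod P) Q.vec (G.d P Q f) =
      rst c ≫ pair a x ≫ G.d P Q f
  d_d_symm : ∀ (P Q : DiffObj G) {T : C} (f : P.pt ⟶ Q.pt) (b c : T ⟶ P.mon.carrier)
    (x : T ⟶ P.pt),
    pair (pair (P.mon.zeroMap T) b) (pair c x) ≫ G.d (P.vec.prod P) Q.vec (G.d P Q f) =
      pair (pair (P.mon.zeroMap T) c) (pair b x) ≫ G.d (P.vec.prod P) Q.vec (G.d P Q f)
  d_rst : ∀ (P Q : DiffObj G) (f : P.pt ⟶ Q.pt), G.d P P (rst f) =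
    rst (snd P.mon.carrier P.pt ≫ f) ≫ fst P.mon.carrier P.pt
  rst_d : ∀ (P Q : DiffObj G) (f : P.pt ⟶ Q.pt),
    rst (G.d P Q f) = rst (snd P.mon.carrier P.pt ≫ f)

variable {G}

theorem IsGenDiffRestr.isCoherent (h : G.IsGenDiffRestr) : G.IsCoherent :=
  ⟨h.isMonoid, h.L_L, h.L_prod, h.L_one⟩

theorem IsGenDiffRestr.laws [G.IsCoherent] (h : G.IsGenDiffRestr) : G.Laws where
  d_add := by
    intro P
    obtain ⟨X, rfl⟩ := P.exists_eq_of
    exact h.dr1_add X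
  d_zero := by
    intro P
    obtain ⟨X, rfl⟩ := P.exists_eq_of
    exact h.dr1_zero X
  pair_sum_d := by
    intro P Q
    obtain ⟨X, rfl⟩ := P.exists_eq_of
    obtain ⟨Y, rfl⟩ := Q.exists_eq_of
    exact h.dr2_add
  pair_zero_d := by
    intro P Q
    obtain ⟨X, rfl⟩ := P.exists_eq_of
    obtain ⟨Y, rfl⟩ := Q.exists_eq_of
    exact h.dr2_zero
  d_fst := by
    intro P Q
    obtain ⟨X, rfl⟩ := P.exists_eq_of
    obtain ⟨Y, rfl⟩ := Q.exists_eq_of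
    exact h.dr3_fst X Y
  d_snd := by
    intro P Q
    obtain ⟨X, rfl⟩ := P.exists_eq_of
    obtain ⟨Y, rfl⟩ := Q.exists_eq_of
    exact h.dr3_snd X Y
  d_pair := by
    intro P Q R
    obtain ⟨X, rfl⟩ := P.exists_eq_of
    obtain ⟨Y, rfl⟩ := Q.exists_eq_of
    obtain ⟨Z, rfl⟩ := R.exists_eq_of
    exact h.dr4
  d_comp := by
    intro P Q R
    obtain ⟨X, rfl⟩ := P.exists_eq_of
    obtain ⟨Y, rfl⟩ := Q.exists_eq_of
    obtain ⟨Z, rfl⟩ := R.exists_eq_of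
    exact h.dr5
  d_d_linear := by
    intro P Q
    obtain ⟨X, rfl⟩ := P.exists_eq_of
    obtain ⟨Y, rfl⟩ := Q.exists_eq_of
    exact h.dr6
  d_d_symm := by
    intro P Q
    obtain ⟨X, rfl⟩ := P.exists_eq_of
    obtain ⟨Y, rfl⟩ := Q.exists_eq_of
    exact h.dr7
  d_rst := by
    intro P Q
    obtain ⟨X, rfl⟩ := P.exists_eq_of
    obtain ⟨Y, rfl⟩ := Q.exists_eq_of
    exact h.dr8
  rst_d := by
    intro P Q
    obtain ⟨X, rfl⟩ := P.exists_eq_of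
    obtain ⟨Y, rfl⟩ := Q.exists_eq_of
    exact h.dr9

theorem Laws.isGenDiffRestr [hG : G.IsCoherent] (h : G.Laws) : G.IsGenDiffRestr where
  isMonoid := hG.isMonoid
  L_L := hG.L_L
  L_prod := hG.L_prod
  L_one := hG.L_one
  dr1_add X := h.d_add (.of G X)
  dr1_zero X := h.d_zero (.of G X)
  dr2_add := h.pair_sum_d (.of G _) (.of G _)
  dr2_zero := h.pair_zero_d (.of G _) (.of G _)
  dr3_fst X Y := h.d_fst (.of G X) (.of G Y)
  dr3_snd X Y := h.d_snd (.of G X) (.of G Y)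
  dr4 := h.d_pair (.of G _) (.of G _) (.of G _)
  dr5 := h.d_comp (.of G _) (.of G _) (.of G _)
  dr6 := h.d_d_linear (.of G _) (.of G _)
  dr7 := h.d_d_symm (.of G _) (.of G _)
  dr8 := h.d_rst (.of G _) (.of G _)
  dr9 := h.rst_d (.of G _) (.of G _)

end DiffData

end DiffObj

/-! ### Sums and zeros in the monoids of powers -/

section PowMon

set_option linter.unusedSectionVars false

variable {C : Type u} [CartRestrStruct.{v} C] [IsCartRestrCat C] {T : C}

theorem MonData.powMon_sum (M N : MonData C) (n : ℕ) (a b : Fin n → (T ⟶ M.carrier))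
    (x y : T ⟶ N.carrier) :
    (M.powMon N n).sum (tup n a x) (tup n b y) = tup n (fun i => M.sum (a i) (b i)) (N.sum x y) := by
  induction n with
  | zero => rfl
  | succ n ih =>
    rw [tup_succ n fun i => M.sum (a i) (b i), ← ih]
    exact MonData.prodMon_sum M (M.powMon N n) _ _ _ _

theorem MonData.powMon_zeroMap (M N : MonData C) (n : ℕ) (T : C) :
    (M.powMon N n).zeroMap T = tup n (fun _ => M.zeroMap T) (N.zeroMap T) := by
  induction n with
  | zero => rfl
  | succ n ih =>
    rw [tup_succ, ← ih]
    exact MonData.prodMon_zeroMap M (M.powMon N n) _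

end PowMon

/-! ### Higher derivatives: construction, linearity and symmetry -/

section HigherDerivatives

set_option linter.unusedSectionVars false

variable {C : Type u} [CartRestrStruct.{v} C] [IsCartRestrCat C] {G : DiffData C} [G.IsCoherent]
  [hG : G.Laws] (P Q R : DiffObj G) {T Z : C}

namespace DiffData

/-! ### First consequences of the axioms -/

@[simp] theorem zeroMap_rst (P : DiffObj G) (T : C) : rst (P.mon.zeroMap T) = 𝟙 T :=
  P.isMonoid.zeroMap_total T

/-- When D[g] ignores the point, the chain rule loses its second component. The restriction this
leaves is that of f, which by DR.9 is already the domain of D[f]. -/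
theorem d_comp_linear (f : P.pt ⟶ Q.pt) {g : Q.pt ⟶ R.pt} {g' : Q.mon.carrier ⟶ R.mon.carrier}
    (hg : G.d Q R g = fst Q.mon.carrier Q.pt ≫ g') : G.d P R (f ≫ g) = G.d P Q f ≫ g' := by
  rw [hG.d_comp P Q R, hg, pair_fst_assoc, ← hG.rst_d, rst_self_comp_assoc]

@[simp] theorem d_id : G.d P P (𝟙 P.pt) = fst P.mon.carrier P.pt := by
  have h := hG.d_rst P P (𝟙 P.pt)
  simpa using h

theorem d_bang : G.d P .one (bang P.pt) = bang _ := by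
  apply one_hom_ext
  rw [hG.rst_d, rst_comp_of_total _ (bang_total _)]
  simp

theorem d_zeroMap : G.d P Q.vec (Q.mon.zeroMap P.pt) = Q.mon.zeroMap _ := by
  rw [MonData.zeroMap, d_comp_linear P .one Q.vec _ (hG.d_zero Q), d_bang]; rfl

theorem d_sum (f g : P.pt ⟶ Q.mon.carrier) :
    G.d P Q.vec (Q.mon.sum f g) = Q.mon.sum (G.d P Q.vec f) (G.d P Q.vec g) := by
  rw [MonData.sum, d_comp_linear P (Q.vec.prod Q.vec) Q.vec _ (hG.d_add Q), hG.d_pair P Q.vec Q.vec]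
  rfl

theorem d_finSum {ι : Type} {s : Finset ι} (hs : s.Nonempty) (f : ι → (P.pt ⟶ Q.mon.carrier)) :
    G.d P Q.vec (Q.mon.finSum s f) = Q.mon.finSum s fun i => G.d P Q.vec (f i) :=
  Q.isMonoid.map_finSum Q.isMonoid (G.d P Q.vec) (d_sum P Q) hs f

theorem d_rst_comp (e : P.pt ⟶ Z) (f : P.pt ⟶ Q.pt) :
    G.d P Q (rst e ≫ f) = rst (snd P.mon.carrier P.pt ≫ e) ≫ G.d P Q f := by
  rw [hG.d_comp P P Q, hG.d_rst P (.of G Z) e, comp_rst, pair_rst_left, pair_rst_right,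
    pair_fst_snd]
  simp

@[simp] theorem rst_tup_zeroMap (n : ℕ) {X : C} (x : T ⟶ X) :
    rst (tup n (fun _ => P.mon.zeroMap T) x) = rst x :=
  rst_tup_of_total fun _ => P.isMonoid.zeroMap_total T

/-! ### Derivatives of tuples -/

theorem d_phead (n : ℕ) : G.d (P.pow (n + 1)) P.vec (phead P.mon.carrier P.pt n) =
    fst _ _ ≫ phead P.mon.carrier P.mon.carrier n := hG.d_fst P.vec (P.pow n)

theorem d_ptail (n : ℕ) : G.d (P.pow (n + 1)) (P.pow n) (ptail P.mon.carrier P.pt n) =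
    fst _ _ ≫ ptail P.mon.carrier P.mon.carrier n := hG.d_snd P.vec (P.pow n)

theorem d_pcons {n : ℕ} (a : R.pt ⟶ P.mon.carrier) (w : R.pt ⟶ (P.pow n).pt) :
    G.d R (P.pow (n + 1)) (pcons a w) = pcons (G.d R P.vec a) (G.d R (P.pow n) w) :=
  hG.d_pair R P.vec (P.pow n) a w

theorem d_tup (n : ℕ) (a : Fin n → (R.pt ⟶ P.mon.carrier)) (x : R.pt ⟶ P.pt) :
    G.d R (P.pow n) (tup n a x) = tup n (fun i => G.d R P.vec (a i)) (G.d R P x) := by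
  induction n with
  | zero => rfl
  | succ n ih => rw [tup_succ, d_pcons, ih, tup_succ]

theorem d_vproj (n : ℕ) (i : Fin n) : G.d (P.pow n) P.vec (vproj n i) = fst _ _ ≫ vproj n i := by
  induction n with
  | zero => exact i.elim0
  | succ n ih =>
    refine Fin.cases (d_phead P n) (fun j => ?_) i
    rw [vproj_succ, d_comp_linear _ (P.pow n) _ _ (ih j), d_ptail, assoc, vproj_succ]

theorem d_pproj (n : ℕ) : G.d (P.pow n) P (pproj n) = fst _ _ ≫ pproj n := by
  induction n with
  | zero => exact (d_id P).trans (comp_id _).symm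
  | succ n ih => rw [pproj_succ, d_comp_linear _ (P.pow n) _ _ ih, d_ptail, assoc, pproj_succ]

/-! ### The derivative in the direction of the last variable -/

/-- The vector `(0, …, 0, b)` at the point `(a, x)`, for `(b, a, x)` in `Aⁿ⁺¹ × X`. -/
def inc (P : DiffObj G) (n : ℕ) : pow P.mon.carrier (n + 1) P.pt ⟶
    prod (pow P.mon.carrier n P.mon.carrier) (pow P.mon.carrier n P.pt) :=
  pair (tup n (fun _ => P.mon.zeroMap _) (phead _ _ n)) (ptail _ _ n)

/-- The derivative of a map on `Aⁿ × X` in the directions `(0, …, 0, b)`; the direction `b` becomes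
the first variable. -/
def der {P : DiffObj G} (Q : DiffObj G) {n : ℕ} (g : pow P.mon.carrier n P.pt ⟶ Q.pt) :
    pow P.mon.carrier (n + 1) P.pt ⟶ Q.mon.carrier :=
  inc P n ≫ G.d (P.pow n) Q g

/-- The higher derivatives of a map (the value for `n = 0` is irrelevant). -/
def hi (P Q : DiffObj G) (f : P.pt ⟶ Q.pt) : (n : ℕ) → (pow P.mon.carrier n P.pt ⟶ Q.mon.carrier)
  | 0 => Q.mon.zeroMap _
  | 1 => G.d P Q f
  | n + 2 => der Q.vec (hi P Q f (n + 1))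

variable {P}

theorem tup_zeroMap_pcons {n : ℕ} (u : T ⟶ P.mon.carrier) (w : T ⟶ (P.pow n).pt) :
    pcons u w ≫ inc P n = pair (tup n (fun _ => P.mon.zeroMap T) u) w := by
  have h₁ : tup n (fun _ => pcons u w ≫ P.mon.zeroMap _) (pcons u w ≫ phead _ _ n) =
      rst w ≫ rst u ≫ tup n (fun _ => P.mon.zeroMap T) u := by
    rw [← assoc, rst_comm w u, ← rst_pcons, comp_tup, pcons_phead]
    apply tup_congr (fun _ => P.mon.comp_zeroMap _)
    rw [rst_pcons, assoc, rst_left_comm, rst_self_comp]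
  have h₂ : rst u ≫ tup n (fun _ => P.mon.zeroMap T) u = tup n (fun _ => P.mon.zeroMap T) u :=
    rst_comp_of_le (rst_comp_rst_tup _ _ _)
  have h₃ : rst (tup n (fun _ => P.mon.zeroMap T) u) = rst u :=
    rst_tup_of_total fun _ => P.isMonoid.zeroMap_total T
  rw [inc, comp_pair, comp_tup, h₁, h₂, pcons_ptail, pair_rst_left, pair_rst_right,
    rst_comp_of_le, rst_comp_of_le]
  · rw [rst_pair, h₃, rst_idem_assoc]
  · rw [← pair_rst_right, rst_pair, h₃, rst_rst_comp]
    rw [rst_left_comm, rst_left_comm w u, rst_idem, ← assoc, rst_idem, rst_comm]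

theorem inc_zero : inc P 0 = 𝟙 _ := pair_fst_snd _ _

/-- A⁰ × X is X and `inc P 0` is the identity, so arity 0 can serve as the base of inductions in
which `hi` itself has only a default value. -/
theorem der_zero (f : P.pt ⟶ Q.pt) : der (n := 0) Q f = G.d P Q f :=
  (congrArg (fun h => h ≫ G.d P Q f) inc_zero).trans (id_comp _)

variable {Q} {n : ℕ} (g : pow P.mon.carrier n P.pt ⟶ Q.pt)

theorem pcons_der (u : T ⟶ P.mon.carrier) (w : T ⟶ pow P.mon.carrier n P.pt) :
    pcons u w ≫ der Q g = pair (tup n (fun _ => P.mon.zeroMap T) u) w ≫ G.d (P.pow n) Q g := by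
  rw [der, ← assoc, tup_zeroMap_pcons]

theorem hi_succ (f : P.pt ⟶ Q.pt) {n : ℕ} (hn : 0 < n) :
    hi P Q f (n + 1) = der Q.vec (hi P Q f n) := by
  obtain ⟨n, rfl⟩ := Nat.exists_eq_succ_of_ne_zero hn.ne'
  rfl

theorem rst_inc_comp (k : pow P.mon.carrier n P.pt ⟶ Z) :
    rst (inc P n ≫ snd _ _ ≫ k) = rst (ptail _ _ n ≫ k) := by
  rw [inc, pair_snd_assoc, rst_tup_of_total fun _ => P.isMonoid.zeroMap_total _, rst_phead, id_comp]

theorem rst_der : rst (der Q g) = rst (ptail _ _ n ≫ g) :=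
  (rst_comp_congr (inc P n) (hG.rst_d (P.pow n) Q g)).trans (rst_inc_comp g)

theorem rst_hi (f : P.pt ⟶ Q.pt) (hn : 0 < n) : rst (hi P Q f n) = rst (pproj n ≫ f) := by
  induction n with
  | zero => exact absurd hn (lt_irrefl 0)
  | succ n ih =>
    rcases Nat.eq_zero_or_pos n with rfl | h
    · change rst (G.d P Q f) = _
      rw [hG.rst_d]
      change _ = rst ((snd _ _ ≫ 𝟙 _) ≫ f)
      rw [comp_id]
    · rw [hi_succ f h, rst_der, rst_comp_congr _ (ih h), pproj_succ, assoc]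

theorem d_inc (P : DiffObj G) (n : ℕ) :
    G.d (P.pow (n + 1)) ((P.pow n).vec.prod (P.pow n)) (inc P n) =
      pair (tup n (fun _ => P.mon.zeroMap _) (fst _ _ ≫ phead _ _ n)) (fst _ _ ≫ ptail _ _ n) := by
  rw [inc, hG.d_pair _ (P.pow n).vec (P.pow n), d_ptail]
  congr 1
  refine (d_tup P.vec _ n _ _).trans ?_
  exact tup_congr (fun _ => d_zeroMap _ _) (d_phead P n)

/-- The derivative of `der g`. -/
theorem pair_d_der (a : T ⟶ pow P.mon.carrier (n + 1) P.mon.carrier)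
    (w : T ⟶ pow P.mon.carrier (n + 1) P.pt) :
    pair a w ≫ G.d (P.pow (n + 1)) Q.vec (der Q g) =
      pair (pair (tup n (fun _ => P.mon.zeroMap T) (a ≫ phead _ _ n)) (a ≫ ptail _ _ n))
        (pair (tup n (fun _ => P.mon.zeroMap T) (w ≫ phead _ _ n)) (w ≫ ptail _ _ n)) ≫
      G.d ((P.pow n).vec.prod (P.pow n)) Q.vec (G.d (P.pow n) Q g) := by
  have h₁ : pair a w ≫ tup n (fun _ => P.mon.zeroMap _) (fst _ _ ≫ phead _ _ n) =
      rst a ≫ rst w ≫ tup n (fun _ => P.mon.zeroMap T) (a ≫ phead _ _ n) := by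
    rw [← assoc, ← rst_pair, comp_tup, pair_fst_assoc, comp_tup]
    apply tup_congr (fun _ => P.mon.comp_zeroMap _)
    rw [rst_pair, assoc, rst_left_comm, rst_self_comp_assoc]
  have h₂ : w ≫ inc P n =
      pair (tup n (fun _ => P.mon.zeroMap T) (w ≫ phead _ _ n)) (w ≫ ptail _ _ n) := by
    rw [← tup_zeroMap_pcons, pcons_eta]
  -- The chain rule through `inc`, which is linear: its derivative pads the direction with zeros
  -- just as `inc` pads the point.
  rw [show G.d (P.pow (n + 1)) Q.vec (der Q g) = _ from
    hG.d_comp (P.pow (n + 1)) ((P.pow n).vec.prod (P.pow n)) Q.vec (inc P n) _, d_inc,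
    comp_pair_assoc, comp_pair, h₁, pair_fst_assoc, pair_snd_assoc, h₂]
  congr 1
  simp only [pair_rst_left, pair_rst_right]
  simp only [rst_left_comm, rst_idem_assoc]
  have h₃ : rst (pair (pair (tup n (fun _ => P.mon.zeroMap T) (a ≫ phead _ _ n)) (a ≫ ptail _ _ n))
      (pair (tup n (fun _ => P.mon.zeroMap T) (w ≫ phead _ _ n)) (w ≫ ptail _ _ n))) =
      rst a ≫ rst w := by
    simp only [rst_pair, rst_tup_zeroMap, rst_comp_of_total _ (phead_total _ _ _),
      rst_comp_of_total _ (ptail_total _ _ _), rst_idem]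
  have h₄ {S : C} {k : T ⟶ S} (hk : rst k = rst a ≫ rst w) : rst a ≫ rst w ≫ k = k := by
    rw [← assoc, ← hk, rst_self_comp]
  exact h₄ h₃

variable (P) in
/-- The vector of `Aⁿ × A` with `i`-th component `b` and all others `0`. -/
def single (n : ℕ) (i : Fin n) (b : T ⟶ P.mon.carrier) : T ⟶ pow P.mon.carrier n P.mon.carrier :=
  tup n (Function.update (fun _ => P.mon.zeroMap T) i b) (P.mon.zeroMap T)

variable (P) in
theorem single_zero (n : ℕ) (b : T ⟶ P.mon.carrier) :
    single P (n + 1) 0 b = pcons b ((P.pow n).mon.zeroMap T) := by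
  rw [single, tup_succ, MonData.powMon_zeroMap]
  simp

theorem update_comp_succ {n : ℕ} {α : Type*} (a : Fin (n + 1) → α) (j : Fin n) (b : α) :
    (fun i : Fin n => Function.update a j.succ b i.succ) =
      Function.update (fun i : Fin n => a i.succ) j b := by
  funext i
  by_cases hij : i = j
  · subst hij; simp
  · simp [hij, Function.update_of_ne]

variable (P) in
theorem single_succ (n : ℕ) (j : Fin n) (b : T ⟶ P.mon.carrier) :
    single P (n + 1) j.succ b = pcons (P.mon.zeroMap T) (single P n j b) := by
  rw [single, tup_succ, update_comp_succ, Function.update_of_ne (Fin.succ_ne_zero j).symm, single]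

variable (P) in
theorem single_zeroMap (n : ℕ) (i : Fin n) :
    single P n i (P.mon.zeroMap T) = (P.pow n).mon.zeroMap T := by
  rw [single, MonData.powMon_zeroMap, Function.update_eq_self_iff.2 rfl]

theorem comp_single {S : C} (n : ℕ) (i : Fin n) (h : S ⟶ T) (b : T ⟶ P.mon.carrier) :
    h ≫ single P n i b = rst h ≫ single P n i (h ≫ b) := by
  rw [single, single, comp_tup, comp_tup, MonData.comp_zeroMap]
  refine tup_congr (fun j => ?_) rfl
  by_cases hij : j = i
  · subst hij; simp
  · simp [hij, MonData.comp_zeroMap P.mon h]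

theorem comp_single_of_total {S : C} (n : ℕ) (i : Fin n) {h : S ⟶ T} (hh : rst h = 𝟙 S)
    (b : T ⟶ P.mon.carrier) : h ≫ single P n i b = single P n i (h ≫ b) := by
  rw [comp_single, hh, id_comp]

theorem single_rst (n : ℕ) (i : Fin n) (e : T ⟶ Z) (b : T ⟶ P.mon.carrier) :
    single P n i (rst e ≫ b) = rst e ≫ single P n i b := tup_update_rst _ _ _ _ _ _

/-- The vector is b followed by the total map `single P n i (𝟙 _)`, so its domain is that of b. -/
theorem rst_single (n : ℕ) (i : Fin n) (b : T ⟶ P.mon.carrier) :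
    rst (single P n i b) = rst b := by
  have h : single P n i b = rst b ≫ single P n i b := by rw [← single_rst, rst_self_comp]
  have h' : b ≫ single P n i (𝟙 _) = rst b ≫ single P n i b := by rw [comp_single, comp_id]
  rw [h, ← h', rst_comp_of_total]
  refine IsTotal.tup (fun j => ?_) (P.isMonoid.zeroMap_total _)
  by_cases hij : j = i
  · subst hij; simpa using isTotal_id _
  · simpa [hij] using P.isMonoid.zeroMap_total _

theorem comp_tup_update {S A X : C} (n : ℕ) (h : S ⟶ T) (a : Fin n → (T ⟶ A)) (i : Fin n)
    (b : T ⟶ A) (x : T ⟶ X) : h ≫ tup n (Function.update a i b) x =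
      tup n (Function.update (fun j => h ≫ a j) i (h ≫ b)) (h ≫ x) := by
  rw [comp_tup]
  refine tup_congr (fun j => ?_) rfl
  by_cases hij : j = i
  · subst hij; simp
  · simp [hij]

variable (P) in
theorem d_tup_update (n : ℕ) (a : Fin n → (R.pt ⟶ P.mon.carrier)) (i : Fin n)
    (b : R.pt ⟶ P.mon.carrier) (x : R.pt ⟶ P.pt) :
    G.d R (P.pow n) (tup n (Function.update a i b) x) =
      tup n (Function.update (fun j => G.d R P.vec (a j)) i (G.d R P.vec b)) (G.d R P x) := by
  refine (d_tup P R n _ _).trans (tup_congr (fun j => ?_) rfl)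
  by_cases hij : j = i
  · subst hij; simp
  · simp [hij]

theorem tup_update_zero {A X : C} {n : ℕ} (b : T ⟶ A) (w : T ⟶ RestrictionFaa.pow A (n + 1) X) :
    tup (n + 1) (Function.update (fun j => w ≫ vproj (n + 1) j) 0 b) (w ≫ pproj (n + 1)) =
      pcons b (w ≫ ptail A X n) := by
  rw [tup_succ, Function.update_self, ← tup_comp_self (w ≫ ptail A X n)]
  simp [pproj_succ]

theorem tup_update_succ {A X : C} {n : ℕ} (j : Fin n) (b : T ⟶ A)
    (w : T ⟶ RestrictionFaa.pow A (n + 1) X) :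
    tup (n + 1) (Function.update (fun j => w ≫ vproj (n + 1) j) j.succ b) (w ≫ pproj (n + 1)) =
      pcons (w ≫ phead A X n) (tup n (Function.update (fun j => (w ≫ ptail A X n) ≫ vproj n j) j b)
        ((w ≫ ptail A X n) ≫ pproj n)) := by
  rw [tup_succ, update_comp_succ, Function.update_of_ne (Fin.succ_ne_zero j).symm]
  simp [pproj_succ]

variable (P) in
theorem d_single (n : ℕ) (i : Fin n) (b : R.pt ⟶ P.mon.carrier) :
    G.d R (P.pow n).vec (single P n i b) = single P n i (G.d R P.vec b) := by
  refine (d_tup P.vec R n _ _).trans (tup_congr (fun j => ?_) (d_zeroMap _ _))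
  by_cases hij : j = i
  · subst hij; simp
  · simp [hij, d_zeroMap]

/-- `g` is linear in each of its first `n` variables in the sense that its partial derivative in
this variable is given by `g` itself. -/
def IsLin {P Q : DiffObj G} {n : ℕ} (g : pow P.mon.carrier n P.pt ⟶ Q.mon.carrier) : Prop :=
  ∀ ⦃T : C⦄ (i : Fin n) (b : T ⟶ P.mon.carrier) (w : T ⟶ pow P.mon.carrier n P.pt),
    pair (single P n i b) w ≫ G.d (P.pow n) Q.vec g =
      tup n (Function.update (fun j => w ≫ vproj n j) i b) (w ≫ pproj n) ≫ g

variable {R} in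
-- The new variable enters `der g` as a direction. Moving it by b gives a second derivative of g at
-- ((0, …, 0, b), 0), which DR.6 reduces to a first derivative in the direction (0, …, 0, b).
theorem der_lin_zero (b : T ⟶ P.mon.carrier) (w : T ⟶ pow P.mon.carrier (n + 1) P.pt) :
    pair (single P (n + 1) 0 b) w ≫ G.d (P.pow (n + 1)) Q.vec (der Q g) =
      pcons b (w ≫ ptail _ _ n) ≫ der Q g := by
  rw [pair_d_der, single_zero, pcons_phead, pcons_ptail, pair_rst_right, pair_rst_left,
    assoc, hG.d_d_linear (P.pow n) Q, pcons_der, zeroMap_rst, id_comp, rst_tup_zeroMap,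
    ← assoc, ← assoc]
  congr 1
  rw [rst_comp_of_total _ (phead_total _ _ _), assoc, ← pair_rst_right, rst_self_comp_assoc]
  exact rst_comp_of_le (by rw [rst_pair, rst_tup_zeroMap, rst_idem_assoc])

/-- Linearity in the `j`-th variable, differentiated. -/
theorem IsLin.d_d {g : pow P.mon.carrier n P.pt ⟶ Q.mon.carrier} (hg : IsLin (Q := Q) g)
    (j : Fin n) (b c : T ⟶ P.mon.carrier) (w : T ⟶ pow P.mon.carrier n P.pt) (hb : rst b = 𝟙 T)
    (hc : rst c = 𝟙 T) (hw : rst w = 𝟙 T) :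
    pair (pair ((P.pow n).mon.zeroMap T) (tup n (fun _ => P.mon.zeroMap T) c))
        (pair (single P n j b) w) ≫
      G.d ((P.pow n).vec.prod (P.pow n)) Q.vec (G.d (P.pow n) Q.vec g) =
    pcons c (tup n (Function.update (fun j => w ≫ vproj n j) j b) (w ≫ pproj n)) ≫
      DiffData.der Q.vec g := by
  -- The vector b and the argument w have to vary, so linearity is taken at the two projections of A
  -- × (Aⁿ × X). It is then differentiated there and evaluated at the point (b, w) in the direction
  -- (0, (0, …, 0, c)). The direction of b being zero, `single` of it vanishes.
  let Z := P.vec.prod (P.pow n)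
  have h := hg j (fst _ _ : Z.pt ⟶ P.mon.carrier) (snd _ _)
  have hf : G.d Z P.vec (fst _ _) = fst _ _ ≫ fst _ _ := hG.d_fst P.vec (P.pow n)
  have hs : G.d Z (P.pow n) (snd _ _) = fst _ _ ≫ snd _ _ := hG.d_snd P.vec (P.pow n)
  have hv (i) : G.d Z P.vec (snd _ _ ≫ vproj n i) = fst _ _ ≫ snd _ _ ≫ vproj n i := by
    rw [d_comp_linear Z (P.pow n) P.vec _ (d_vproj P n i), hs, assoc]
  have hp : G.d Z P (snd _ _ ≫ pproj n) = fst _ _ ≫ snd _ _ ≫ pproj n := by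
    rw [d_comp_linear Z (P.pow n) P _ (d_pproj P n), hs, assoc]
  have h' := congrArg (G.d Z Q.vec) h
  rw [hG.d_comp Z ((P.pow n).vec.prod (P.pow n)) Q.vec, hG.d_comp Z (P.pow n) Q.vec,
    hG.d_pair Z (P.pow n).vec (P.pow n), d_single, d_tup_update, hf, hs, hp] at h'
  simp only [hv] at h'
  have hcs : rst (tup n (fun _ => P.mon.zeroMap T) c) = 𝟙 T := by rw [rst_tup_zeroMap, hc]
  have h₂ := congrArg (fun k => pair (pair (P.mon.zeroMap T) (tup n (fun _ => P.mon.zeroMap T) c))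
        (pair b w) ≫ k) h'
  simp only [Z, comp_pair_assoc, comp_pair, comp_single_of_total, comp_tup_update, pair_fst_assoc,
    pair_snd_assoc, pair_fst, pair_snd, rst_pair, hcs, hb, hw, zeroMap_rst, id_comp, rst_id,
    tup_vproj, tup_pproj, Function.update_eq_self_iff.2] at h₂
  rw [← single_zeroMap P n j, pcons_der (Q := Q.vec), h₂]

/-- The new variable is handled by `der_lin_zero`, with no hypothesis on g. For an old variable,
DR.7 exchanges its direction with the new variable; the result is the derivative of the linearity of
g, `IsLin.d_d`. -/
theorem IsLin.der {g : pow P.mon.carrier n P.pt ⟶ Q.mon.carrier} (hg : IsLin (Q := Q) g) :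
    IsLin (Q := Q) (der Q.vec g) := by
  -- For total elements no restrictions have to be tracked. The general case follows by taking the
  -- projections for b and w and precomposing with `pair b w`.
  have key {T : C} (i : Fin (n + 1)) (b : T ⟶ P.mon.carrier)
      (w : T ⟶ pow P.mon.carrier (n + 1) P.pt) (hb : rst b = 𝟙 T) (hw : rst w = 𝟙 T) :
      pair (single P (n + 1) i b) w ≫ G.d (P.pow (n + 1)) Q.vec (DiffData.der Q.vec g) =
        tup (n + 1) (Function.update (fun j => w ≫ vproj (n + 1) j) i b) (w ≫ pproj (n + 1)) ≫
          DiffData.der Q.vec g := by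
    refine Fin.cases ?_ (fun j => ?_) i
    · rw [tup_update_zero]
      exact der_lin_zero (Q := Q.vec) g b w
    · rw [tup_update_succ, pair_d_der (Q := Q.vec), single_succ, pcons_phead, pcons_ptail,
        zeroMap_rst, id_comp, rst_single, hb, id_comp, ← MonData.powMon_zeroMap,
        hG.d_d_symm (P.pow n) Q.vec,
        hg.d_d j b _ _ hb (by rw [rst_comp_of_total _ (phead_total _ _ _), hw])
          (by rw [rst_comp_of_total _ (ptail_total _ _ _), hw])]
  intro T i b w
  have h := congrArg (fun k => pair b w ≫ k) (key i (fst _ _) (snd _ _)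
    (fst_total P.mon.carrier (pow P.mon.carrier (n + 1) P.pt)) (snd_total _ _))
  have h₁ : pair b w ≫ tup (n + 1) (Function.update (fun j => snd P.mon.carrier _ ≫
      vproj (n + 1) j) i (fst _ _)) (snd _ _ ≫ pproj (n + 1)) =
      rst (pair b w) ≫ tup (n + 1) (Function.update (fun j => w ≫ vproj (n + 1) j) i b)
        (w ≫ pproj (n + 1)) := by
    rw [comp_tup_update, comp_tup_update]
    simp only [pair_fst, pair_snd_assoc, rst_pair, assoc, rst_self_comp_assoc]
    rw [rst_left_comm, rst_self_comp]
  have h₂ : rst (pair b w) ≫ tup (n + 1) (Function.update (fun j => w ≫ vproj (n + 1) j) i b)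
        (w ≫ pproj (n + 1)) = tup (n + 1) (Function.update (fun j => w ≫ vproj (n + 1) j) i b)
        (w ≫ pproj (n + 1)) := by
    apply rst_comp_of_le
    have h₃ := rst_vec_comp_rst_tup (n + 1) (Function.update (fun j => w ≫ vproj (n + 1) j) i b)
        (w ≫ pproj (n + 1)) i
    have h₄ := rst_comp_rst_tup (n + 1) (Function.update (fun j => w ≫ vproj (n + 1) j) i b)
        (w ≫ pproj (n + 1))
    rw [Function.update_self] at h₃
    rw [rst_comp_of_total _ (pproj_total _)] at h₄
    rw [rst_pair, assoc, h₄, h₃]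
  rw [← assoc _ (tup _ _ _), h₁, h₂, comp_pair_assoc, comp_single, pair_fst, pair_snd, single_rst,
    pair_rst_left, pair_rst_left, pair_rst_right] at h
  rw [← h]
  congr 1
  have h₅ : rst (pair b w) = rst (pair (single P (n + 1) i b) w) := by
    rw [rst_pair, rst_pair, rst_single]
  rw [h₅, rst_left_comm w b, rst_comp_of_le (e := w), rst_comp_of_le (e := b), rst_self_comp]
  · rw [rst_pair, rst_single, rst_idem_assoc]
  · rw [rst_pair, rst_left_comm, rst_idem]

/-! ### Symmetry -/

/-- `g` is invariant under permutations of its first `n` variables. -/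
def IsSymm {A X B : C} {n : ℕ} (g : pow A n X ⟶ B) : Prop :=
  ∀ σ : Equiv.Perm (Fin n), tup n (fun i => vproj n (σ i)) (pproj n) ≫ g = g

/-- Reordering variables is linear, so differentiating the symmetry of g yields the permutations of
`der Q g` that fix the new variable. -/
theorem IsSymm.tail {g : pow P.mon.carrier n P.pt ⟶ Q.pt} (hg : IsSymm g)
    (τ : Equiv.Perm (Fin n)) (σ : Equiv.Perm (Fin (n + 1))) (h₀ : σ 0 = 0)
    (hσ : ∀ j : Fin n, σ j.succ = (τ j).succ) :
    tup (n + 1) (fun i => vproj (n + 1) (σ i)) (pproj (n + 1)) ≫ der Q g = der Q g := by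
  have h₁ : tup (n + 1) (fun i => vproj (n + 1) (σ i)) (pproj (n + 1)) =
      pcons (phead _ _ n) (ptail P.mon.carrier P.pt n ≫ tup n (fun i => vproj n (τ i)) (pproj n)) := by
    rw [tup_succ, comp_tup]
    simp only [h₀, hσ, vproj_zero, vproj_succ, pproj_succ]
  have h₂ := congrArg (G.d (P.pow n) Q) (hg τ)
  rw [hG.d_comp (P.pow n) (P.pow n) Q, d_tup, d_pproj] at h₂
  simp only [d_vproj] at h₂
  have h₃ := congrArg (fun k => inc P n ≫ k) h₂
  rw [h₁, pcons_der, der, ← h₃, comp_pair_assoc]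
  congr 2
  · rw [← comp_tup, ← assoc, inc, pair_fst, rst_ptail, id_comp, tup_comp_perm]
  · rw [← assoc, inc, pair_snd, rst_tup_zeroMap, rst_phead, id_comp]

/-- Both sides are second derivatives of g in the directions (0, …, 0, b) and (0, …, 0, c), in the
two orders; DR.7 identifies them. -/
theorem der_der_swap (g : pow P.mon.carrier n P.pt ⟶ Q.pt) (b c : T ⟶ P.mon.carrier)
    (w : T ⟶ pow P.mon.carrier n P.pt) (hb : rst b = 𝟙 T) (hc : rst c = 𝟙 T) (hw : rst w = 𝟙 T) :
    pcons b (pcons c w) ≫ der Q.vec (der Q g) = pcons c (pcons b w) ≫ der Q.vec (der Q g) := by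
  have key {T : C} (b c : T ⟶ P.mon.carrier) (w : T ⟶ pow P.mon.carrier n P.pt)
      (hb : rst b = 𝟙 T) (hc : rst c = 𝟙 T) (hw : rst w = 𝟙 T) :
      pcons b (pcons c w) ≫ der Q.vec (der Q g) =
        pair (pair ((P.pow n).mon.zeroMap T) (tup n (fun _ => P.mon.zeroMap T) b))
          (pair (tup n (fun _ => P.mon.zeroMap T) c) w) ≫
        G.d ((P.pow n).vec.prod (P.pow n)) Q.vec (G.d (P.pow n) Q g) := by
    rw [pcons_der, pair_d_der, tup_succ, pcons_phead, pcons_ptail, pcons_phead, pcons_ptail,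
      rst_tup_zeroMap, hb, hc, hw, zeroMap_rst, MonData.powMon_zeroMap]
    simp only [id_comp]
  rw [key b c w hb hc hw, key c b w hc hb hw, hG.d_d_symm (P.pow n) Q]

/-- Adjacent transpositions generate the symmetric group. The first one exchanges the two newest
variables, which is `der_der_swap`; all the others fix the newest variable and are inherited through
`IsSymm.tail`. -/
theorem IsSymm.der_der {g : pow P.mon.carrier n P.pt ⟶ Q.pt} (hg : IsSymm (der Q g)) :
    IsSymm (der Q.vec (der Q g)) := by
  intro σ
  have hσ : σ ∈ Submonoid.closure
      (Set.range fun i : Fin (n + 1) => Equiv.swap i.castSucc i.succ) := by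
    rw [Equiv.Perm.mclosure_swap_castSucc_succ]; trivial
  induction hσ using Submonoid.closure_induction with
  | one => simp
  | mul σ τ _ _ h₁ h₂ =>
    have h := tup_comp_perm τ (fun i => vproj (A := P.mon.carrier) (X := P.pt) (n + 2) (σ i))
      (pproj (n + 2))
    simp only [Equiv.Perm.coe_mul, Function.comp_apply]
    rw [← h, assoc, h₂, h₁]
  | mem σ hσ =>
    obtain ⟨i, rfl⟩ := hσ
    refine Fin.cases ?_ (fun j => ?_) i
    · have h := der_der_swap (P := P) (Q := Q) g (vproj (n + 2) 1) (vproj (n + 2) 0)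
        (ptail _ _ (n + 1) ≫ ptail _ _ n) (vproj_total _ _) (vproj_total _ _)
        ((ptail_total _ _ _).comp (ptail_total _ _ _))
      have h₁ : tup (n + 2) (fun i => vproj (A := P.mon.carrier) (X := P.pt) (n + 2)
          (Equiv.swap (Fin.castSucc (0 : Fin (n + 1))) (Fin.succ 0) i)) (pproj (n + 2)) =
          pcons (vproj (n + 2) 1) (pcons (vproj (n + 2) 0) (ptail _ _ (n + 1) ≫ ptail _ _ n)) := by
        have h₃ (i : Fin n) : Equiv.swap (Fin.castSucc (0 : Fin (n + 1))) (Fin.succ 0) i.succ.succ =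
            i.succ.succ :=
          Equiv.swap_apply_of_ne_of_ne (by simp [Fin.ext_iff]) (by simp [Fin.ext_iff])
        rw [tup_succ, tup_succ, ← tup_comp_self (ptail _ _ (n + 1) ≫ ptail _ _ n)]
        congr 2
        refine tup_congr (fun i => ?_) ?_
        · rw [h₃, vproj_succ, vproj_succ, assoc]
        · rw [pproj_succ, pproj_succ, assoc]
      have h₂ : pcons (vproj (n + 2) 0) (pcons (vproj (n + 2) 1)
          (ptail P.mon.carrier P.pt (n + 1) ≫ ptail _ _ n)) = 𝟙 _ := by
        rw [show vproj (n + 2) 1 = ptail P.mon.carrier P.pt (n + 1) ≫ phead _ _ n from rfl,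
          ← comp_pcons, pcons_phead_ptail, comp_id, vproj_zero, pcons_phead_ptail]
      rw [h₁, h, h₂, id_comp]
    · refine hg.tail (Q := Q.vec) (Equiv.swap j.castSucc j.succ) _ ?_ fun k => ?_
      · exact Equiv.swap_apply_of_ne_of_ne (by simp [Fin.ext_iff]) (by simp [Fin.ext_iff])
      · exact (Fin.succ_injective _).swap_apply j.castSucc j.succ k

theorem hi_symm (f : P.pt ⟶ Q.pt) (n : ℕ) : IsSymm (hi P Q f (n + 1)) := by
  induction n with
  | zero =>
    intro σ
    obtain rfl : σ = 1 := Equiv.ext fun i => Subsingleton.elim (α := Fin 1) _ _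
    simp
  | succ n ih =>
    rcases Nat.eq_zero_or_pos n with rfl | h
    -- The second derivative of f is `der (der f)` with f regarded as a map of arity 0, since `hi P
    -- Q f 0` is not f.
    · have h := IsSymm.der_der (Q := Q) (n := 0) (g := f) (by rw [der_zero]; exact ih)
      rw [der_zero] at h
      exact h
    · rw [hi_succ f (Nat.succ_pos n), hi_succ f h]
      rw [hi_succ f h] at ih
      exact ih.der_der (Q := Q.vec)

end DiffData

end HigherDerivatives

/-! ### The sequence of higher derivatives is a map of Faà, and its derivative -/

section Sequence

set_option linter.unusedSectionVars false

variable {C : Type u} [CartRestrStruct.{v} C] [IsCartRestrCat C] {G : DiffData C} [G.IsCoherent]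
  [hG : G.Laws] {P Q : DiffObj G} (R : DiffObj G) {T Z : C} {n : ℕ}

namespace DiffData

theorem IsSymm.apply {A X B : C} {g : pow A n X ⟶ B} (hg : IsSymm g) (σ : Equiv.Perm (Fin n))
    (a : Fin n → (T ⟶ A)) (x : T ⟶ X) :
    tup n (fun i => a (σ i)) x ≫ g = tup n a x ≫ g := by
  rw [← tup_comp_perm, assoc, hg]

/-- A symmetric map as a function of its `i`-th variable. -/
theorem IsSymm.tup_update {A X B : C} {g : pow A (n + 1) X ⟶ B} (hg : IsSymm g)
    (w : Fin (n + 1) → (T ⟶ A)) (x : T ⟶ X) (i : Fin (n + 1)) (b : T ⟶ A) :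
    tup (n + 1) (Function.update w i b) x ≫ g =
      pcons b (tup n (fun j => w (Equiv.swap 0 i j.succ)) x) ≫ g := by
  rw [← hg.apply (Equiv.swap 0 i), tup_succ, Equiv.swap_apply_left, Function.update_self]
  congr 3
  funext j
  rw [Function.update_of_ne]
  intro h
  rw [Equiv.swap_apply_eq_iff, Equiv.swap_apply_right] at h
  exact Fin.succ_ne_zero j h

theorem pcons_sum_der (g : pow P.mon.carrier n P.pt ⟶ Q.pt) (a b : T ⟶ P.mon.carrier)
    (w : T ⟶ pow P.mon.carrier n P.pt) :
    pcons (P.mon.sum a b) w ≫ der Q g = Q.mon.sum (pcons a w ≫ der Q g) (pcons b w ≫ der Q g) := by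
  rw [pcons_der, pcons_der, pcons_der, ← hG.pair_sum_d (P.pow n) Q, MonData.powMon_sum]
  simp only [P.isMonoid.zero_sum]

theorem pcons_zeroMap_der (g : pow P.mon.carrier n P.pt ⟶ Q.pt)
    (w : T ⟶ pow P.mon.carrier n P.pt) :
    pcons (P.mon.zeroMap T) w ≫ der Q g = rst (w ≫ g) ≫ Q.mon.zeroMap T := by
  rw [pcons_der, ← MonData.powMon_zeroMap, hG.pair_zero_d (P.pow n) Q]

theorem pcons_sum_hi (f : P.pt ⟶ Q.pt) (n : ℕ) (a b : T ⟶ P.mon.carrier)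
    (w : T ⟶ pow P.mon.carrier n P.pt) :
    pcons (P.mon.sum a b) w ≫ hi P Q f (n + 1) =
      Q.mon.sum (pcons a w ≫ hi P Q f (n + 1)) (pcons b w ≫ hi P Q f (n + 1)) := by
  rcases Nat.eq_zero_or_pos n with rfl | h
  · exact hG.pair_sum_d P Q f a b w
  · rw [hi_succ f h]; exact pcons_sum_der (Q := Q.vec) _ a b w

theorem pcons_zeroMap_hi (f : P.pt ⟶ Q.pt) (n : ℕ) (w : T ⟶ pow P.mon.carrier n P.pt) :
    pcons (P.mon.zeroMap T) w ≫ hi P Q f (n + 1) =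
      rst (pcons (P.mon.zeroMap T) w ≫ hi P Q f (n + 1)) ≫ Q.mon.zeroMap T := by
  have h (k : T ⟶ Q.mon.carrier) {W : C} (e : T ⟶ W) (hk : k = rst e ≫ Q.mon.zeroMap T) :
      k = rst k ≫ Q.mon.zeroMap T := by
    rw [hk, rst_rst_comp, zeroMap_rst, comp_id]
  rcases Nat.eq_zero_or_pos n with rfl | hn
  · exact h _ _ (hG.pair_zero_d P Q f w)
  · rw [hi_succ f hn]; exact h _ _ (pcons_zeroMap_der (Q := Q.vec) _ w)

variable (P Q) in
/-- The sequence of the higher derivatives of `f`. -/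
def seq (f : P.pt ⟶ Q.pt) : FaaSeq P.toPreFaa Q.toPreFaa where
  base := f
  hi n _ := hi P Q f n

/-- DR.2 gives additivity in the newest variable, which is the first one; by symmetry every variable
can be moved there. -/
theorem seq_isMap (f : P.pt ⟶ Q.pt) : (seq P Q f).IsMap where
  rst_hi n hn := rst_hi f hn
  symm n hn σ := by
    obtain ⟨n, rfl⟩ := Nat.exists_eq_succ_of_ne_zero hn.ne'
    exact hi_symm f n σ
  map_add n hn T w x i a b := by
    obtain ⟨n, rfl⟩ := Nat.exists_eq_succ_of_ne_zero hn.ne'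
    have h := hi_symm f n
    simp only [seq, Nat.succ_eq_add_one]
    rw [h.tup_update, h.tup_update, h.tup_update, pcons_sum_hi]
  map_zero n hn T w x i := by
    obtain ⟨n, rfl⟩ := Nat.exists_eq_succ_of_ne_zero hn.ne'
    have h := hi_symm f n
    simp only [seq, Nat.succ_eq_add_one]
    rw [h.tup_update]
    exact pcons_zeroMap_hi f n _

theorem hi_isLin (f : P.pt ⟶ Q.pt) (n : ℕ) : IsLin (Q := Q) (hi P Q f (n + 1)) := by
  induction n with
  | zero =>
    intro T i b w
    have h := der_lin_zero (n := 0) f b w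
    rw [der_zero] at h
    obtain rfl : i = 0 := Subsingleton.elim (α := Fin 1) _ _
    rw [tup_update_zero]
    exact h
  | succ n ih => rw [hi_succ f (Nat.succ_pos n)]; exact ih.der

/-- The derivative of `hi P Q f n`. -/
theorem pair_d_hi (f : P.pt ⟶ Q.pt) (hn : 0 < n) (a : T ⟶ pow P.mon.carrier n P.mon.carrier)
    (w : T ⟶ pow P.mon.carrier n P.pt) :
    pair a w ≫ G.d (P.pow n) Q.vec (hi P Q f n) =
      Q.mon.sum (Q.mon.finSum Finset.univ fun i =>
        tup n (Function.update (fun j => w ≫ vproj n j) i (a ≫ vproj n i)) (w ≫ pproj n) ≫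
          hi P Q f n)
        (pcons (a ≫ pproj n) w ≫ hi P Q f (n + 1)) := by
  -- The vector components of the direction are switched on one at a time. For empty s the direction
  -- is (0, …, 0, b), which gives the next derivative. Each further component splits off by DR.2 and
  -- is evaluated by linearity.
  have key : ∀ s : Finset (Fin n),
      pair (tup n (fun i => if i ∈ s then a ≫ vproj n i else P.mon.zeroMap T) (a ≫ pproj n)) w ≫
        G.d (P.pow n) Q.vec (hi P Q f n) =
      Q.mon.sum (Q.mon.finSum s fun i =>
        tup n (Function.update (fun j => w ≫ vproj n j) i (a ≫ vproj n i)) (w ≫ pproj n) ≫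
          hi P Q f n)
        (pcons (a ≫ pproj n) w ≫ hi P Q f (n + 1)) := by
    intro s
    induction s using Finset.induction_on with
    | empty => 
      rw [Q.isMonoid.finSum_empty, Q.isMonoid.zero_sum, hi_succ f hn, pcons_der (Q := Q.vec)]
      simp
    | insert i s hi ih =>
      have h₁ : tup n (fun j => if j ∈ insert i s then a ≫ vproj n j else P.mon.zeroMap T)
          (a ≫ pproj n) = (P.pow n).mon.sum (single P n i (a ≫ vproj n i))
            (tup n (fun i => if i ∈ s then a ≫ vproj n i else P.mon.zeroMap T) (a ≫ pproj n)) := by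
        rw [single, MonData.powMon_sum, P.isMonoid.zero_sum]
        refine tup_congr (fun j => ?_) rfl
        by_cases hij : j = i
        · subst hij; simp [hi, P.isMonoid.sum_zero]
        · simp [hij, P.isMonoid.zero_sum]
      obtain ⟨m, rfl⟩ := Nat.exists_eq_succ_of_ne_zero hn.ne'
      rw [h₁, hG.pair_sum_d (P.pow (m + 1)) Q.vec, ih, Q.isMonoid.finSum_insert hi,
        Q.isMonoid.sum_assoc, hi_isLin f m]
  have h := key Finset.univ
  simp only [Finset.mem_univ, if_true] at h
  rw [← h, tup_comp_self]

/-- The derivative of an iterated derivative evaluated at a tuple. -/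
theorem d_tup_hi (f : P.pt ⟶ Q.pt) (hn : 0 < n) (a : Fin n → (R.pt ⟶ P.mon.carrier))
    (x : R.pt ⟶ P.pt) :
    G.d R Q.vec (tup n a x ≫ hi P Q f n) =
      Q.mon.sum (Q.mon.finSum Finset.univ fun i =>
        tup n (Function.update (fun j => snd _ _ ≫ a j) i (G.d R P.vec (a i))) (snd _ _ ≫ x) ≫
          hi P Q f n)
        (pcons (G.d R P x) (tup n (fun j => snd _ _ ≫ a j) (snd _ _ ≫ x)) ≫ hi P Q f (n + 1)) := by
  have h₀ : rst (tup n (fun i => G.d R P.vec (a i)) (G.d R P x)) =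
      rst (tup n (fun i => snd R.mon.carrier _ ≫ a i) (snd _ _ ≫ x)) :=
    rst_tup_congr (fun i => hG.rst_d R P.vec _) (hG.rst_d R P _)
  rw [hG.d_comp R (P.pow n) Q.vec, d_tup, comp_tup, pair_d_hi f hn]
  simp only [tup_vproj, tup_pproj, h₀]
  congr 2
  · funext i
    rw [← comp_tup_update, rst_comp_of_eq]
    refine rst_tup_congr (fun j => ?_) rfl
    by_cases hij : j = i
    · subst hij; simpa using (hG.rst_d R P.vec (a j)).symm
    · simp [hij]
  · rw [← comp_tup, pcons_rst_left, ← pcons_rst_right, rst_self_comp]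

/-- The derivative of the value of `seq P Q f` at a finite family. -/
theorem d_ev {ι : Type} [Fintype ι] [DecidableEq ι] [Nonempty ι] (f : P.pt ⟶ Q.pt)
    (a : ι → (R.pt ⟶ P.mon.carrier)) (x : R.pt ⟶ P.pt) :
    G.d R Q.vec ((seq P Q f).ev a x) =
      Q.mon.sum (Q.mon.finSum Finset.univ fun i =>
        (seq P Q f).ev (Function.update (fun j => snd _ _ ≫ a j) i (G.d R P.vec (a i)))
          (snd _ _ ≫ x))
        ((seq P Q f).ev (ι := Option ι) (fun o => o.elim (G.d R P x) fun j => snd _ _ ≫ a j)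
          (snd _ _ ≫ x)) := by
  let e := Fintype.equivFin ι
  refine (d_tup_hi R f Fintype.card_pos _ x).trans ?_
  congr 1
  · refine Q.isMonoid.finSum_equiv e.symm fun i => ?_
    rw [FaaSeq.ev]
    congr 2
    funext j
    simp [Function.update_apply, e]
  -- The new first argument is indexed by `none`.
  · rw [(seq_isMap f).ev_eq (Nat.succ_pos _) ((finSuccEquiv _).trans (Equiv.optionCongr e.symm))]
    rw [tup_succ]
    simp only [seq, e]
    rfl

end DiffData
end Sequence

/-- A one-element set has a single partition. The formula serves both as the start of the induction
for the higher chain rule and as the source of DR.5 for a coalgebra. -/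
theorem FaaSeq.comp_hi_one {C : Type u} [CartRestrStruct.{v} C] [IsCartRestrCat C] {P Q R : PreFaa C}
    (hR : R.mon.IsTotalCommMonoid) (f : FaaSeq P Q) (g : FaaSeq Q R) :
    (f.comp g).hi 1 Nat.one_pos =
      pair (f.hi 1 Nat.one_pos) (snd P.mon.carrier P.pt ≫ f.base) ≫ g.hi 1 Nat.one_pos := by
  have h₁ : tup 1 (vproj 1) (pproj 1) = 𝟙 (pow P.mon.carrier 1 P.pt) := tup_self 1
  have h₂ : pproj 1 = snd P.mon.carrier P.pt := comp_id _
  refine (hR.finSum_unique (ι := OrderedFinpartition 1) _).trans ?_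
  refine (?_ : _ = tup 1 (fun _ => tup 1 (vproj 1) (pproj 1) ≫ f.hi 1 Nat.one_pos)
    (pproj 1 ≫ f.base) ≫ g.hi 1 Nat.one_pos).trans ?_
  · refine congrArg (fun k => k ≫ g.hi 1 Nat.one_pos) (tup_congr (fun i => ?_) rfl)
    refine congrArg (fun k => k ≫ f.hi 1 Nat.one_pos) (tup_congr (fun j => ?_) rfl)
    exact congrArg (vproj 1) (Subsingleton.elim (α := Fin 1) _ _)
  · rw [h₁, id_comp, h₂]
    rfl

/-! ### The sequences respect identities, restrictions and composition -/

section Functoriality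

set_option linter.unusedSectionVars false

variable {C : Type u} [CartRestrStruct.{v} C] [IsCartRestrCat C] {G : DiffData C} [G.IsCoherent]
  [hG : G.Laws] {P Q R : DiffObj G} {S T Z : C} {n : ℕ}

namespace DiffData

theorem rst_inc (P : DiffObj G) (n : ℕ) : rst (inc P n) = 𝟙 _ := by
  rw [inc, rst_pair, rst_tup_zeroMap, rst_phead, rst_ptail, id_comp]

theorem inc_snd (P : DiffObj G) (n : ℕ) : inc P n ≫ snd _ _ = ptail _ _ n := by
  rw [inc, pair_snd, rst_tup_zeroMap, rst_phead, id_comp]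

theorem inc_snd_assoc (P : DiffObj G) (n : ℕ) (k : pow P.mon.carrier n P.pt ⟶ Z) :
    inc P n ≫ snd _ _ ≫ k = ptail _ _ n ≫ k := by
  rw [← assoc, inc_snd]

theorem inc_fst (P : DiffObj G) (n : ℕ) :
    inc P n ≫ fst _ _ = tup n (fun _ => P.mon.zeroMap _) (phead _ _ n) := by
  rw [inc, pair_fst, rst_ptail, id_comp]

theorem inc_fst_vproj (P : DiffObj G) (n : ℕ) (i : Fin n) :
    inc P n ≫ fst _ _ ≫ vproj n i = P.mon.zeroMap _ := by
  rw [← assoc, inc_fst, tup_vproj, rst_tup_zeroMap, rst_phead, id_comp]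

theorem inc_fst_pproj (P : DiffObj G) (n : ℕ) :
    inc P n ≫ fst _ _ ≫ pproj n = phead _ _ n := by
  rw [← assoc, inc_fst, tup_pproj, rst_tup_zeroMap, rst_phead, id_comp]

theorem der_rst_comp (e : pow P.mon.carrier n P.pt ⟶ Z) (g : pow P.mon.carrier n P.pt ⟶ Q.pt) :
    der Q (rst e ≫ g) = rst (ptail _ _ n ≫ e) ≫ der Q g := by
  rw [der, d_rst_comp (P.pow n) Q, comp_rst_assoc, inc_snd_assoc, der]

theorem der_zeroMap (P Q : DiffObj G) (n : ℕ) :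
    der (P := P) (n := n) Q.vec (Q.mon.zeroMap _) = Q.mon.zeroMap _ := by
  rw [der, d_zeroMap (P.pow n) Q, MonData.comp_zeroMap, rst_inc, id_comp]

/-- The new direction moves only the point of A × X, and the vector component does not depend on it.
This is why the terms from the second on vanish for linear maps and for restrictions. -/
theorem der_fst (P : DiffObj G) :
    der (P := P) (n := 1) P.vec (fst P.mon.carrier P.pt) = P.mon.zeroMap _ :=
  (congrArg (fun k => inc P 1 ≫ k) (d_phead P 0)).trans (inc_fst_vproj P 1 0)

theorem der_comp_linear {g : pow P.mon.carrier n P.pt ⟶ Q.mon.carrier}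
    {k : Q.mon.carrier ⟶ R.mon.carrier} (hk : G.d Q.vec R.vec k = fst _ _ ≫ k) :
    der R.vec (g ≫ k) = der Q.vec g ≫ k := by
  rw [der, d_comp_linear (P.pow n) Q.vec R.vec g hk, der, assoc]

/-- Linear maps preserve zero because D[k] does (DR.2) and D[k] is k applied to the direction. -/
theorem zeroMap_comp_linear {k : Q.mon.carrier ⟶ R.mon.carrier} (hk : IsTotal k)
    (hd : G.d Q.vec R.vec k = fst _ _ ≫ k) (T : C) :
    Q.mon.zeroMap T ≫ k = R.mon.zeroMap T := by
  have h := hG.pair_zero_d Q.vec R.vec k (Q.mon.zeroMap T)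
  rwa [hd, pair_fst_assoc, rst_comp_of_total _ hk, zeroMap_rst, id_comp, id_comp] at h

/-- The sequence of a map with constant derivative. -/
theorem seq_of_linear {f : P.pt ⟶ Q.pt} {k : P.mon.carrier ⟶ Q.mon.carrier} (hk : IsTotal k)
    (hf : G.d P Q f = fst _ _ ≫ k) (hd : G.d P.vec Q.vec k = fst _ _ ≫ k) :
    seq P Q f = FaaSeq.ofTwo f (fst _ _ ≫ k) := by
  have h (n) : hi P Q f (n + 2) = Q.mon.zeroMap _ := by
    induction n with
    | zero =>
      rw [hi_succ f Nat.one_pos, show hi P Q f (0 + 1) = G.d P Q f from rfl, hf]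
      refine (der_comp_linear hd).trans ?_
      refine (congrArg (fun l => l ≫ k) (der_fst P)).trans ?_
      exact zeroMap_comp_linear hk hd _
    | succ n ih => rw [hi_succ f (Nat.succ_pos _), ih, der_zeroMap]
  apply FaaSeq.ext
  · rfl
  · funext n hn
    match n, hn with
    | 1, _ => exact hf
    | n + 2, _ => exact h n

theorem seq_id (P : DiffObj G) : seq P P (𝟙 P.pt) = FaaSeq.ofTwo (𝟙 P.pt) (fst _ _) := by
  have h := seq_of_linear (isTotal_id P.mon.carrier) (f := 𝟙 P.pt) (P := P) (Q := P)
    (by rw [d_id, comp_id]) (by rw [d_id P.vec, comp_id])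
  rwa [comp_id] at h

theorem seq_rst (f : P.pt ⟶ Q.pt) : seq P P (rst f) = FaaSeq.rstSeq (seq P Q f) := by
  have h (n) : hi P P (rst f) (n + 2) = rst (pproj (n + 2) ≫ f) ≫ P.mon.zeroMap _ := by
    induction n with
    | zero =>
      rw [hi_succ _ Nat.one_pos, show hi P P (rst f) (0 + 1) = G.d P P (rst f) from rfl,
        hG.d_rst P Q]
      refine (der_rst_comp (n := 1) _ _).trans ?_
      have e : pproj 2 ≫ f = ptail P.mon.carrier P.pt 1 ≫ snd P.mon.carrier P.pt ≫ f :=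
        (assoc _ _ _).trans (congrArg (fun k => ptail P.mon.carrier P.pt 1 ≫ k ≫ f) (comp_id _))
      rw [der_fst]
      exact congrArg (fun k => rst k ≫ P.mon.zeroMap _) e.symm
    | succ n ih =>
      rw [hi_succ _ (Nat.succ_pos _), ih, der_rst_comp (n := n + 2) (Q := P.vec), der_zeroMap,
        pproj_succ _ _ (n + 2), assoc]
  apply FaaSeq.ext
  · rfl
  · funext n hn
    match n, hn with
    | 1, _ => exact hG.d_rst P Q f
    | n + 2, _ => exact h n

/-! ### The higher order chain rule -/

/-- The derivative of `fₛ` at a selection of variables, in the direction of a new variable. -/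
theorem inc_d_block (f : P.pt ⟶ Q.pt) {s : ℕ} (hs : 0 < s) (σ : Fin s → Fin n) :
    inc P n ≫ G.d (P.pow n) Q.vec (tup s (fun j => vproj n (σ j)) (pproj n) ≫ hi P Q f s) =
      tup (s + 1) (Fin.cases (vproj (n + 1) 0) fun j => vproj (n + 1) (σ j).succ) (pproj (n + 1)) ≫
        hi P Q f (s + 1) := by
  have hw (j : Fin s) : rst (ptail P.mon.carrier P.pt n ≫ vproj n (σ j)) ≫
      rst (ptail P.mon.carrier P.pt n ≫ pproj n) = rst (ptail P.mon.carrier P.pt n ≫ pproj n) := by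
    rw [rst_comp_of_total _ (vproj_total _ _), rst_ptail, id_comp]
  have h₁ : inc P n ≫ pcons (G.d (P.pow n) P (pproj n)) (tup s (fun j => snd _ _ ≫ vproj n (σ j))
      (snd _ _ ≫ pproj n)) ≫ hi P Q f (s + 1) = tup (s + 1) (Fin.cases (vproj (n + 1) 0)
        fun j => vproj (n + 1) (σ j).succ) (pproj (n + 1)) ≫ hi P Q f (s + 1) := by
    rw [← assoc, comp_pcons, comp_tup, d_pproj, inc_fst_pproj, inc_snd_assoc, tup_succ]
    simp only [inc_snd_assoc]
    rfl
  -- The direction supplied by `inc` is zero in all vector variables, so every term that replaces a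
  -- selected variable is a restricted zero. Only the term of order s + 1 survives, and its domain
  -- absorbs those zeros.
  rw [d_tup_hi (P.pow n) f hs, MonData.comp_sum,
    Q.isMonoid.comp_finSum (Finset.univ_nonempty_iff.2 ⟨⟨0, hs⟩⟩),
    MonData.finSum_congr (l := fun _ => rst ((ptail P.mon.carrier P.pt n ≫ pproj n) ≫ f) ≫
      Q.mon.zeroMap _)]
  · rw [h₁, Q.isMonoid.sum_finSum_rst_zero]
    apply rst_comp_of_eq
    refine ((seq_isMap f).rst_tup_hi (s + 1) (Nat.succ_pos s) fun i => ?_).symm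
    refine Fin.cases ?_ (fun j => ?_) i
    · exact (congrArg (fun k => k ≫ rst (pproj (A := P.mon.carrier) (X := P.pt) (n + 1)))
        (vproj_total (n + 1) 0)).trans (id_comp _)
    · exact (congrArg (fun k => k ≫ rst (pproj (A := P.mon.carrier) (X := P.pt) (n + 1)))
        (vproj_total (n + 1) (σ j).succ)).trans (id_comp _)
  · intro i _
    rw [← assoc, comp_tup_update, d_vproj, inc_fst_vproj, inc_snd_assoc]
    simp only [inc_snd_assoc]
    exact (seq_isMap f).tup_update_zero P.isMonoid hs hw i

/-- A term of the sum for the composite of the sequences of `f` and `g`. -/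
noncomputable def compTerm (f : P.pt ⟶ Q.pt) (g : Q.pt ⟶ R.pt) (c : OrderedFinpartition n) :
    pow P.mon.carrier n P.pt ⟶ R.mon.carrier :=
  tup c.length (fun i => tup (c.partSize i) (fun j => vproj n (c.emb i j)) (pproj n) ≫
    hi P Q f (c.partSize i)) (pproj n ≫ f) ≫ hi Q R g c.length

/-- In an extended partition the size of the enlarged block is a value of `Function.update`, equal
to the expected number only propositionally. -/
theorem block_cast (f : P.pt ⟶ Q.pt) {s s' : ℕ} (h : s = s') (σ : Fin s' → Fin n) :
    tup s (fun j => vproj n (σ (Fin.cast h j))) (pproj n) ≫ hi P Q f s =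
      tup s' (fun j => vproj n (σ j)) (pproj n) ≫ hi P Q f s' := by
  subst h; rfl

theorem ptail_block (f : P.pt ⟶ Q.pt) {s : ℕ} (σ : Fin s → Fin n) :
    inc P n ≫ snd _ _ ≫ tup s (fun j => vproj n (σ j)) (pproj n) ≫ hi P Q f s =
      tup s (fun j => vproj (n + 1) (σ j).succ) (pproj (n + 1)) ≫ hi P Q f s := by
  rw [inc_snd_assoc, comp_tup_assoc]
  rfl

theorem inc_d_base (f : P.pt ⟶ Q.pt) : inc P n ≫ G.d (P.pow n) Q (pproj n ≫ f) =
    tup 1 (fun _ => vproj (n + 1) 0) (pproj (n + 1)) ≫ hi P Q f 1 := by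
  rw [hG.d_comp (P.pow n) P Q, comp_pair_assoc, d_pproj, inc_fst_pproj, inc_snd_assoc]
  rfl

/-- Differentiating the last argument πₙ f of the outer term raises its order by one and creates the
singleton block {0}. Differentiating the i-th vector argument adds 0 to the i-th block. These are
exactly the extensions of the partition. -/
theorem inc_d_compTerm (hn : 0 < n) (f : P.pt ⟶ Q.pt) (g : Q.pt ⟶ R.pt)
    (c : OrderedFinpartition n) :
    inc P n ≫ G.d (P.pow n) R.vec (compTerm f g c) =
      R.mon.finSum Finset.univ fun o => compTerm f g (c.extend o) := by
  have hc := c.length_pos hn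
  rw [compTerm, d_tup_hi (P.pow n) g hc, MonData.comp_sum,
    R.isMonoid.comp_finSum (Finset.univ_nonempty_iff.2 ⟨⟨0, hc⟩⟩), R.isMonoid.sum_comm,
    R.isMonoid.finSum_option]
  congr 1
  · rw [← assoc, comp_pcons, comp_tup, inc_d_base, inc_snd_assoc, ← assoc, ← pproj_succ]
    refine congrArg (fun k => k ≫ hi Q R g (c.length + 1)) (congrArg (pcons _)
      (tup_congr (fun i => ?_) rfl))
    exact ptail_block f (c.emb i)
  · apply MonData.finSum_congr
    intro i _
    rw [← assoc, comp_tup_update, inc_d_block f (c.partSize_pos i), inc_snd_assoc, ← assoc,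
      ← pproj_succ]
    refine congrArg (fun k => k ≫ hi Q R g c.length) (tup_congr (fun m => ?_) rfl)
    by_cases h : m = i
    · subst h
      simp only [Function.update_self, OrderedFinpartition.extend_some,
        OrderedFinpartition.extendMiddle, dif_pos]
      refine Eq.trans ?_ (block_cast f (Function.update_self m (c.partSize m + 1) c.partSize)
        (Fin.cases (motive := fun _ => Fin (n + 1)) 0 (Fin.succ ∘ c.emb m))).symm
      refine congrArg (fun k => k ≫ hi P Q f (c.partSize m + 1)) (tup_congr (fun j => ?_) rfl)
      exact Fin.cases rfl (fun _ => rfl) j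
    · simp only [Function.update_of_ne h, OrderedFinpartition.extend_some,
        OrderedFinpartition.extendMiddle, dif_neg h]
      refine (ptail_block f (c.emb m)).trans ?_
      exact (block_cast f (Function.update_of_ne h (c.partSize i + 1) c.partSize)
        (Fin.succ ∘ c.emb m)).symm

/-- Every partition of n + 1 variables extends a unique partition of the last n, so summing
`inc_d_compTerm` over partitions of n gives each partition of n + 1 once. -/
theorem hi_comp (f : P.pt ⟶ Q.pt) (g : Q.pt ⟶ R.pt) (hn : 0 < n) :
    hi P R (f ≫ g) n = R.mon.finSum Finset.univ fun c => compTerm (n := n) f g c := by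
  induction n with
  | zero => exact absurd hn (lt_irrefl 0)
  | succ n ih =>
    rcases Nat.eq_zero_or_pos n with rfl | h
    · exact (hG.d_comp P Q R f g).trans
        (FaaSeq.comp_hi_one R.isMonoid (seq P Q f) (seq Q R g)).symm
    · rw [hi_succ _ h, ih h, der, d_finSum (P.pow n) R Finset.univ_nonempty,
        R.isMonoid.comp_finSum Finset.univ_nonempty,
        ← R.isMonoid.finSum_equiv (OrderedFinpartition.extendEquiv n)
          (k := fun p => compTerm f g (p.1.extend p.2)) (fun _ => rfl), R.isMonoid.finSum_sigma]
      exact MonData.finSum_congr fun c _ => inc_d_compTerm h f g c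

theorem seq_comp (f : P.pt ⟶ Q.pt) (g : Q.pt ⟶ R.pt) :
    seq P R (f ≫ g) = (seq P Q f).comp (seq Q R g) := by
  apply FaaSeq.ext
  · rfl
  · funext n hn
    exact hi_comp f g hn

end DiffData
end Functoriality

/-! ### Arguments of the terms of the comultiplication -/

section ReplArg

variable {C : Type u} [CartRestrStruct.{v} C] {A M X : C} {n m : ℕ}

/-- Arguments `a` and a point of `X`, some of the arguments replaced by components `a'` of direction
vectors from `M`, followed by the last components `x'` of the remaining direction vectors. -/
def replArg (a : Fin n → (X ⟶ A)) (a' : Fin n → (M ⟶ A)) (x' : M ⟶ A) (e : Repl n m) :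
    Fin n ⊕ {j // j ∈ e.free} → (pow M m X ⟶ A) :=
  Sum.elim (fun i => match e.1 i with
    | some j => vproj m j ≫ a' i
    | none => pproj m ≫ a i) fun j => vproj m j.1 ≫ x'

variable {a : Fin n → (X ⟶ A)} {a' : Fin n → (M ⟶ A)} {x' : M ⟶ A} {e : Repl n m}

theorem replArg_some {i : Fin n} {j : Fin m} (h : e.1 i = some j) :
    replArg a a' x' e (.inl i) = vproj m j ≫ a' i := by
  simp [replArg, h]

theorem replArg_none {i : Fin n} (h : e.1 i = none) :
    replArg a a' x' e (.inl i) = pproj m ≫ a i := by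
  simp [replArg, h]

theorem replArg_inr (j : {j // j ∈ e.free}) :
    replArg a a' x' e (.inr j) = vproj m j.1 ≫ x' := rfl

end ReplArg

/-! ### Higher derivatives of higher derivatives -/

section Comultiplication

set_option linter.unusedSectionVars false

variable {C : Type u} [CartRestrStruct.{v} C] [IsCartRestrCat C] {G : DiffData C} [G.IsCoherent]
  [hG : G.Laws] {P Q R S : DiffObj G} {T Z : C} {n : ℕ}

namespace DiffData

/-- A total map with constant derivative `f'`, where `f'` is its own derivative. -/
structure IsLinear (P Q : DiffObj G) (f : P.pt ⟶ Q.pt) (f' : P.mon.carrier ⟶ Q.mon.carrier) :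
    Prop where
  total : IsTotal f
  total' : IsTotal f'
  d_eq : G.d P Q f = fst _ _ ≫ f'
  d_eq' : G.d P.vec Q.vec f' = fst _ _ ≫ f'

namespace IsLinear

theorem seq_eq {f : P.pt ⟶ Q.pt} {f' : P.mon.carrier ⟶ Q.mon.carrier} (h : IsLinear P Q f f') :
    seq P Q f = FaaSeq.ofTwo f (fst _ _ ≫ f') :=
  seq_of_linear h.total' h.d_eq h.d_eq'

theorem comp {f : P.pt ⟶ Q.pt} {f' : P.mon.carrier ⟶ Q.mon.carrier} (hf : IsLinear P Q f f')
    {g : Q.pt ⟶ R.pt} {g' : Q.mon.carrier ⟶ R.mon.carrier} (hg : IsLinear Q R g g') :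
    IsLinear P R (f ≫ g) (f' ≫ g') where
  total := hf.total.comp hg.total
  total' := hf.total'.comp hg.total'
  d_eq := by rw [d_comp_linear P Q R f hg.d_eq, hf.d_eq, assoc]
  d_eq' := by rw [d_comp_linear P.vec Q.vec R.vec f' hg.d_eq', hf.d_eq', assoc]

theorem id (P : DiffObj G) : IsLinear P P (𝟙 _) (𝟙 _) where
  total := isTotal_id _
  total' := isTotal_id _
  d_eq := by rw [d_id, comp_id]
  d_eq' := by rw [d_id P.vec, comp_id]

theorem fst (P Q : DiffObj G) :
    IsLinear (P.prod Q) P (fst P.pt Q.pt) (fst P.mon.carrier Q.mon.carrier) where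
  total := fst_total _ _
  total' := fst_total _ _
  d_eq := hG.d_fst P Q
  d_eq' := hG.d_fst P.vec Q.vec

theorem snd (P Q : DiffObj G) :
    IsLinear (P.prod Q) Q (snd P.pt Q.pt) (snd P.mon.carrier Q.mon.carrier) where
  total := snd_total _ _
  total' := snd_total _ _
  d_eq := hG.d_snd P Q
  d_eq' := hG.d_snd P.vec Q.vec

theorem add (P : DiffObj G) : IsLinear (P.vec.prod P.vec) P.vec P.mon.add P.mon.add where
  total := P.isMonoid.add_total
  total' := P.isMonoid.add_total
  d_eq := hG.d_add P
  d_eq' := hG.d_add P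

theorem zero (P : DiffObj G) : IsLinear .one P.vec P.mon.zero P.mon.zero where
  total := P.isMonoid.zero_total
  total' := P.isMonoid.zero_total
  d_eq := hG.d_zero P
  d_eq' := hG.d_zero P

variable {f : R.pt ⟶ S.pt} {f' : R.mon.carrier ⟶ S.mon.carrier} (h : IsLinear R S f f') (m : ℕ)
include h

theorem inc_d_pproj : inc R m ≫ G.d (R.pow m) S (pproj m ≫ f) = phead _ _ m ≫ f' := by
  rw [d_comp_linear (R.pow m) R S _ h.d_eq, d_pproj, assoc, ← assoc (inc R m), ← assoc, assoc (inc R m),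
    inc_fst_pproj]

theorem inc_d_vproj (j : Fin m) :
    inc R m ≫ G.d (R.pow m) S.vec (vproj m j ≫ f') = S.mon.zeroMap _ := by
  rw [d_comp_linear (R.pow m) R.vec S.vec _ h.d_eq', d_vproj, assoc, ← assoc (inc R m), ← assoc,
    assoc (inc R m), inc_fst_vproj]
  exact zeroMap_comp_linear h.total' h.d_eq' _

end IsLinear

/-! ### Iterated derivatives of iterated derivatives -/

section

variable [NeZero n] {a : Fin n → (R.pt ⟶ P.mon.carrier)} {a' : Fin n → (R.mon.carrier ⟶ P.mon.carrier)}
  {x : R.pt ⟶ P.pt} {x' : R.mon.carrier ⟶ P.mon.carrier} {m : ℕ}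

/-- A term of the derivative of order `m` of `⟨a, x⟩ fₙ`. -/
noncomputable def replTerm (f : P.pt ⟶ Q.pt) (a : Fin n → (R.pt ⟶ P.mon.carrier))
    (a' : Fin n → (R.mon.carrier ⟶ P.mon.carrier)) (x : R.pt ⟶ P.pt)
    (x' : R.mon.carrier ⟶ P.mon.carrier) {m : ℕ} (e : Repl n m) :
    pow R.mon.carrier m R.pt ⟶ Q.mon.carrier :=
  (seq P Q f).ev (replArg a a' x' e) (pproj m ≫ x)

theorem inc_snd_replArg_inl {e : Repl n m} {e' : Repl n (m + 1)} {i : Fin n}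
    (h : e'.1 i = (e.1 i).map Fin.succ) :
    inc R m ≫ snd _ _ ≫ replArg a a' x' e (.inl i) = replArg a a' x' e' (.inl i) := by
  rw [inc_snd_assoc]
  rcases he : e.1 i with _ | j
  · rw [replArg_none he, replArg_none (by rw [h, he]; rfl), ← assoc, ← pproj_succ]
  · rw [replArg_some he, replArg_some (j := j.succ) (by rw [h, he]; rfl), ← assoc]
    rfl

theorem inc_snd_replArg_inr {e : Repl n m} {e' : Repl n (m + 1)} {j : {j // j ∈ e.free}}
    (h : j.1.succ ∈ e'.free) :
    inc R m ≫ snd _ _ ≫ replArg a a' x' e (.inr j) = replArg a a' x' e' (.inr ⟨j.1.succ, h⟩) := by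
  rw [inc_snd_assoc, replArg_inr, replArg_inr, ← assoc]
  rfl

theorem inc_snd_pproj (R : DiffObj G) (m : ℕ) (k : R.pt ⟶ Z) :
    inc R m ≫ snd _ _ ≫ pproj m ≫ k = pproj (m + 1) ≫ k := by
  rw [inc_snd_assoc, ← assoc, ← pproj_succ]

variable (ha : ∀ i, IsLinear R P.vec (a i) (a' i)) (hx : IsLinear R P x x')
include ha hx

theorem replArg_total (e : Repl n m) (i) : IsTotal (replArg a a' x' e i) := by
  rcases i with i | j
  · rcases h : e.1 i with _ | j
    · rw [replArg_none h]; exact (pproj_total m).comp (ha i).total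
    · rw [replArg_some h]; exact (vproj_total m j).comp (ha i).total'
  · exact (vproj_total m j.1).comp hx.total'

theorem rst_replTerm (f : P.pt ⟶ Q.pt) (e : Repl n m) :
    rst (replTerm f a a' x x' e) = rst (pproj m ≫ x ≫ f) := by
  rw [replTerm, (seq_isMap f).rst_ev, assoc]
  · rfl
  · intro i; rw [replArg_total ha hx e i, id_comp]

/-- An argument still equal to some aᵢ depends on the point, and its derivative replaces it by a
component of the new direction. An argument already taken from an earlier direction does not depend
on the point, so its term vanishes. The term of next order leaves the new direction free. -/
theorem inc_d_replTerm (f : P.pt ⟶ Q.pt) (e : Repl n m) :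
    inc R m ≫ G.d (R.pow m) Q.vec (replTerm f a a' x x' e) =
      Q.mon.finSum Finset.univ fun o => replTerm f a a' x x' (e.extend o) := by
  classical
  -- The additional argument of next order is identified with direction 0, which is free in
  -- `e.extend none`.
  have h_none : (seq P Q f).ev (ι := Option (Fin n ⊕ {j // j ∈ e.free}))
      (fun o => inc R m ≫ o.elim (G.d (R.pow m) P (pproj m ≫ x))
        fun i => snd _ _ ≫ replArg a a' x' e i) (inc R m ≫ snd _ _ ≫ pproj m ≫ x) =
      replTerm f a a' x x' (e.extend none) := by
    let E : Option (Fin n ⊕ {j // j ∈ e.free}) ≃ Fin n ⊕ {j // j ∈ (e.extend none).free} :=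
      (Equiv.optionEquivSumPUnit.{0} _).trans ((Equiv.sumAssoc _ _ _).trans ((Equiv.refl _).sumCongr
        ((Equiv.optionEquivSumPUnit.{0} _).symm.trans e.freeExtendNone)))
    rw [replTerm, ← (seq_isMap f).ev_reindex E, inc_snd_pproj]
    congr 1
    funext o
    rcases o with _ | i | j
    · exact hx.inc_d_pproj m
    · exact inc_snd_replArg_inl (hG := hG) (P := P) (e.extend_none_apply i)
    · exact inc_snd_replArg_inr (hG := hG) (P := P) _
  have h_some (i : {i // e.1 i = none}) : (seq P Q f).ev (fun k => inc R m ≫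
      Function.update (fun j => snd _ _ ≫ replArg a a' x' e j) (.inl i.1)
        (G.d (R.pow m) P.vec (replArg a a' x' e (.inl i.1))) k) (inc R m ≫ snd _ _ ≫ pproj m ≫ x) =
      replTerm f a a' x x' (e.extend (some i)) := by
    rw [replTerm, ← (seq_isMap f).ev_reindex ((Equiv.refl (Fin n)).sumCongr (e.freeExtendSome i)),
      inc_snd_pproj]
    congr 1
    funext k
    rcases k with k | j
    · by_cases hk : k = i.1
      · subst hk
        rw [Function.update_self, replArg_none i.2, (ha i.1).inc_d_pproj m]
        exact (replArg_some (X := R.pt) (a := a) (a' := a') (x' := x') (e.extend_some_self i)).symm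
      · rw [Function.update_of_ne (by simpa using hk)]
        exact inc_snd_replArg_inl (hG := hG) (P := P) (e.extend_some_of_ne i hk)
    · rw [Function.update_of_ne Sum.inr_ne_inl]
      exact inc_snd_replArg_inr (hG := hG) (P := P) _
  -- Arguments outside the image of the unreplaced indices come from earlier directions; their
  -- derivative along `inc` is zero.
  have h_zero (i) (hi : ∀ j : {i // e.1 i = none}, Sum.inl j.1 ≠ i) :
      (seq P Q f).ev (fun k => inc R m ≫ Function.update (fun j => snd _ _ ≫ replArg a a' x' e j) i
        (G.d (R.pow m) P.vec (replArg a a' x' e i)) k) (inc R m ≫ snd _ _ ≫ pproj m ≫ x) =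
      rst (pproj (m + 1) ≫ x ≫ f) ≫ Q.mon.zeroMap _ := by
    have h₀ : inc R m ≫ G.d (R.pow m) P.vec (replArg a a' x' e i) = P.mon.zeroMap _ := by
      rcases i with i | j
      · rcases h : e.1 i with _ | j
        · exact absurd rfl (hi ⟨i, h⟩)
        · rw [replArg_some h]; exact (ha i).inc_d_vproj m j
      · exact hx.inc_d_vproj m j.1
    rw [(seq_isMap f).ev_zero P.isMonoid (fun k => ?_) i (by rw [Function.update_self, h₀]),
      inc_snd_pproj, assoc]
    · rfl
    · by_cases hk : k = i
      · subst hk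
        rw [Function.update_self, h₀, zeroMap_rst, id_comp]
      · rw [Function.update_of_ne hk, inc_snd_assoc,
          (ptail_total _ _ m).comp (replArg_total ha hx e k), id_comp]
  rw [replTerm, d_ev (R.pow m), MonData.comp_sum, Q.isMonoid.comp_finSum Finset.univ_nonempty]
  simp only [FaaSeq.comp_ev]
  rw [h_none, Q.isMonoid.finSum_sum_of_injective (φ := fun i : {i // e.1 i = none} => Sum.inl i.1)
    (e := pproj (m + 1) ≫ x ≫ f) (fun i j h => Subtype.ext (Sum.inl_injective h)) h_zero
    (rst_comp_of_eq (rst_replTerm ha hx f (e.extend none)).symm),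
    Q.isMonoid.sum_comm, Q.isMonoid.finSum_option]
  exact congrArg _ (MonData.finSum_congr fun i _ => h_some i)

theorem inc_d_finSum_replTerm (f : P.pt ⟶ Q.pt) :
    inc R m ≫ G.d (R.pow m) Q.vec
        (Q.mon.finSum Finset.univ fun e : Repl n m => replTerm f a a' x x' e) =
      Q.mon.finSum Finset.univ fun e : Repl n (m + 1) => replTerm f a a' x x' e := by
  have : Nonempty (Repl n m) := ⟨⟨fun _ => none, by simp⟩⟩
  rw [d_finSum (R.pow m) Q Finset.univ_nonempty, Q.isMonoid.comp_finSum Finset.univ_nonempty,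
    ← Q.isMonoid.finSum_equiv (Equiv.ofBijective _ Repl.extend_bijective)
      (k := fun p => replTerm f a a' x x' (p.1.extend p.2)) (fun _ => rfl),
    Q.isMonoid.finSum_sigma]
  exact MonData.finSum_congr fun e _ => inc_d_replTerm ha hx f e

theorem hi_tup_hi (f : P.pt ⟶ Q.pt) (hm : 0 < m) :
    hi R Q.vec (tup n a x ≫ hi P Q f n) m =
      Q.mon.finSum Finset.univ fun e : Repl n m => replTerm f a a' x x' e := by
  induction m with
  | zero => exact absurd hm (lt_irrefl 0)
  | succ m ih =>
    rw [← inc_d_finSum_replTerm ha hx f]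
    rcases Nat.eq_zero_or_pos m with rfl | h
    -- For m = 0 the only replacement is the empty one and the sum is ⟨a, x⟩ fₙ. It takes the place
    -- of the default value of `hi` at 0.
    · refine (der_zero (Q := Q.vec) (tup n a x ≫ hi P Q f n)).symm.trans
        (congrArg (der (n := 0) Q.vec) ?_)
      rw [Q.isMonoid.finSum_unique, replTerm, (seq_isMap f).ev_eq (Nat.pos_of_neZero n)
        (Equiv.sumEmpty _ _).symm]
      refine congrArg (fun k => k ≫ hi P Q f n) (tup_congr (fun i => ?_) (id_comp _).symm)
      exact (id_comp _).symm
    · rw [hi_succ _ h, ih h]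
      rfl

end

end DiffData
end Comultiplication

/-! ### From a differential structure to a coalgebra -/

section Coalgebra

set_option linter.unusedSectionVars false

variable {C : Type u} [CartRestrStruct.{v} C] [IsCartRestrCat C]

/-- The pair of a monoid and its underlying object. -/
abbrev PreFaa.vec (P : PreFaa C) : PreFaa C := ⟨P.mon, P.mon.carrier⟩

/-- A summand of the comultiplication as the value at a family of vectors. -/
theorem FaaSeq.IsMap.comultHi_eq {P Q : PreFaa C} {f : FaaSeq P Q} (hf : f.IsMap) (n : ℕ)
    [NeZero n] (m : ℕ) : comultHi f n (Nat.pos_of_neZero n) m =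
      Q.mon.finSum Finset.univ fun e : Repl n m => f.ev
        (replArg (A := P.mon.carrier) (ptV (P := P.vec) n) (vecV (P := P.vec) n) (vecP n) e)
        (pproj m ≫ ptP n) := by
  refine MonData.finSum_congr fun e _ => Eq.symm ?_
  rw [hf.ev_eq (Nat.add_pos_left (Nat.pos_of_neZero n) _) (finSumFinEquiv.symm.trans
    ((Equiv.refl _).sumCongr (e.free.orderIsoOfFin rfl).toEquiv))]
  refine congrArg (fun k => k ≫ f.hi _ _) (tup_congr (fun i => ?_) rfl)
  refine Fin.addCases (fun i => ?_) (fun i => ?_) i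
  · rw [Fin.append_left]
    simp only [Equiv.trans_apply, finSumFinEquiv_symm_apply_castAdd]
    rcases h : e.1 i with _ | j
    · exact replArg_none h
    · exact replArg_some h
  · rw [Fin.append_right]
    simp only [Equiv.trans_apply, finSumFinEquiv_symm_apply_natAdd]
    rfl

theorem MonData.ext_heq {E : Type u₂} [CartRestrStruct.{v₂} E] {M N : MonData E}
    (h : M.carrier = N.carrier) (h₁ : HEq M.add N.add) (h₂ : HEq M.zero N.zero) : M = N := by
  obtain ⟨A, a, z⟩ := M
  obtain ⟨B, b, w⟩ := N
  obtain rfl : A = B := h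
  obtain rfl : a = b := eq_of_heq h₁
  obtain rfl : z = w := eq_of_heq h₂
  rfl

theorem FaaSeq.heq {E : Type u₂} [CartRestrStruct.{v₂} E] {M M' N N' : MonData E} {X Y : E}
    (hM : M = M') (hN : N = N') {f : FaaSeq ⟨M, X⟩ ⟨N, Y⟩} {g : FaaSeq ⟨M', X⟩ ⟨N', Y⟩}
    (hb : f.base = g.base) (hh : ∀ n hn, HEq (f.hi n hn) (g.hi n hn)) : HEq f g := by
  subst hM hN
  exact heq_of_eq (FaaSeq.ext hb (funext fun n => funext fun hn => eq_of_heq (hh n hn)))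

theorem Prefunctor.hext {V : Type u₁} [Quiver.{v₁} V] {W : Type u₂} [Quiver.{v₂} W] {F F' : V ⥤q W}
    (h : ∀ X, F.obj X = F'.obj X) (h' : ∀ (X Y : V) (f : X ⟶ Y), HEq (F.map f) (F'.map f)) :
    F = F' := by
  obtain ⟨o, m⟩ := F
  obtain ⟨o', m'⟩ := F'
  obtain rfl : o = o' := funext h
  congr
  funext X Y f
  exact eq_of_heq (h' X Y f)

theorem comp_heq {Z W V : C} (h : Z = W) {t : Z ⟶ W} (ht : HEq t (𝟙 W)) (k : W ⟶ V) :
    HEq (t ≫ k) k := by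
  subst h
  rw [eq_of_heq ht, id_comp]

variable {G : DiffData C} [G.IsCoherent]

/-- The product of `n` copies of `P.vec` and one of `P`, formed in `PreFaa C`. -/
noncomputable def DiffObj.faaPow (P : DiffObj G) (n : ℕ) : DiffObj G where
  toPreFaa := RestrictionFaa.pow P.vec.toPreFaa n P.toPreFaa
  L_pt := by
    induction n with
    | zero => exact P.L_pt
    | succ n ih => exact (P.vec.prod ⟨_, ih⟩).L_pt

namespace DiffData

variable [hG : G.Laws] {P Q R S : DiffObj G} {T Z : C} {n : ℕ}

theorem isLinear_ptV (P : DiffObj G) (n : ℕ) (i : Fin n) : IsLinear (P.faaPow n) P.vec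
    (ptV (P := P.vec.toPreFaa) (Q := P.toPreFaa) n i) (vecV n i) := by
  induction n with
  | zero => exact i.elim0
  | succ n ih =>
    refine Fin.cases ?_ (fun j => ?_) i
    · exact IsLinear.fst P.vec (P.faaPow n)
    · exact (IsLinear.snd P.vec (P.faaPow n)).comp (ih j)

theorem isLinear_ptP (P : DiffObj G) (n : ℕ) : IsLinear (P.faaPow n) P
    (ptP (P := P.vec.toPreFaa) (Q := P.toPreFaa) n) (vecP n) := by
  induction n with
  | zero => exact IsLinear.id P
  | succ n ih => exact (IsLinear.snd P.vec (P.faaPow n)).comp ih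

/-- The comultiplication at the sequence of `f` is the sequence of its terms. -/
theorem comult_seq (f : P.pt ⟶ Q.pt) (hn : 0 < n) :
    ((comult C).map (X := P.toPreFaa) (Y := Q.toPreFaa) (seq P Q f)).hi n hn =
      seq (P.faaPow n) Q.vec
        (tup n (fun i => ptV (P := P.vec.toPreFaa) (Q := P.toPreFaa) n i) (ptP n) ≫ hi P Q f n) := by
  have : NeZero n := .of_pos hn
  apply FaaSeq.ext
  · rfl
  · funext m hm
    refine Eq.trans ?_ (hi_tup_hi (isLinear_ptV P n) (isLinear_ptP P n) f hm).symm
    exact (seq_isMap f).comultHi_eq n m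

/-! ### The coalgebra of a generalized differential restriction structure -/

/-- The monoid is L of the point, hence determined by it. Sequences between differently presented
objects can thus be compared through their points alone. -/
theorem _root_.RestrictionFaa.DiffObj.ext_pt {P Q : DiffObj G} (h : P.pt = Q.pt) : P = Q := by
  obtain ⟨X, rfl⟩ := P.exists_eq_of
  obtain ⟨Y, rfl⟩ := Q.exists_eq_of
  exact congrArg (DiffObj.of G) h

theorem seq_heq {P' Q' : DiffObj G} (hP : P.pt = P'.pt) (hQ : Q.pt = Q'.pt) {f : P.pt ⟶ Q.pt}
    {f' : P'.pt ⟶ Q'.pt} (hf : HEq f f') : HEq (seq P Q f) (seq P' Q' f') := by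
  obtain rfl := DiffObj.ext_pt hP
  obtain rfl := DiffObj.ext_pt hQ
  rw [eq_of_heq hf]

/-- Powers in `PreFaa C` and in C are built by separate recursions, so they agree by induction on n
and not by definition. -/
theorem pt_pow_eq (P Q : PreFaa C) (n : ℕ) : (pow P n Q).pt = pow P.pt n Q.pt := by
  induction n with
  | zero => rfl
  | succ n ih => exact congrArg (prod P.pt) ih

theorem tup_ptV_ptP_heq (P Q : PreFaa C) (n : ℕ) :
    HEq (tup n (fun i => ptV (P := P) (Q := Q) n i) (ptP n)) (𝟙 (pow P.pt n Q.pt)) := by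
  have key {A Z W : C} (h : Z = W) {t : Z ⟶ W} (ht : HEq t (𝟙 W)) :
      HEq (pair (fst A Z) (snd A Z ≫ t)) (𝟙 (prod A W)) := by
    subst h
    rw [eq_of_heq ht, comp_id, pair_fst_snd]
  induction n with
  | zero => rfl
  | succ n ih =>
    refine HEq.trans (heq_of_eq ?_) (key (pt_pow_eq P Q n) ih)
    rw [comp_tup]
    rfl

variable (G) in
/-- The functor `X ↦ (L X, X)`, `f ↦ (f, D f, …)`. -/
noncomputable def faaFunctor : StrictFunctor C (PreFaa C) where
  obj X := ⟨G.L X, X⟩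
  map {X Y} f := seq (.of G X) (.of G Y) f
  map_id X := seq_id (.of G X)
  map_comp {X Y Z} f g := seq_comp (P := .of G X) (Q := .of G Y) (R := .of G Z) f g
  map_rst {X Y} f := seq_rst (P := .of G X) (Q := .of G Y) f
  obj_prod X Y := congrArg (fun M => (⟨M, prod X Y⟩ : PreFaa C)) (IsCoherent.L_prod X Y)
  obj_one := congrArg (fun M => (⟨M, one⟩ : PreFaa C)) IsCoherent.L_one
  map_fst X Y := (Quiver.Hom.cast_eq_iff_heq _ _ _ _).2 <|
    (seq_heq (P := .of G (prod X Y)) (P' := (DiffObj.of G X).prod (.of G Y)) rfl rfl HEq.rfl).trans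
      (heq_of_eq (IsLinear.fst (DiffObj.of G X) (.of G Y)).seq_eq)
  map_snd X Y := (Quiver.Hom.cast_eq_iff_heq _ _ _ _).2 <|
    (seq_heq (P := .of G (prod X Y)) (P' := (DiffObj.of G X).prod (.of G Y)) rfl rfl HEq.rfl).trans
      (heq_of_eq (IsLinear.snd (DiffObj.of G X) (.of G Y)).seq_eq)

/-- On objects, coassociativity asks that L(L₀ X) = L X and that the sequences of + and 0 stop after
their first derivative. The latter holds because both maps are linear by DR.1. -/
theorem comultObj_mon_eq (X : C) : (comultObj (⟨G.L X, X⟩ : PreFaa C)).mon =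
    ((faaFunctor G).faa.obj ⟨G.L X, X⟩).mon := by
  refine MonData.ext_heq ?_ ?_ ?_
  · exact congrArg (fun M => (⟨M, (G.L X).carrier⟩ : PreFaa C)) (IsCoherent.L_L X).symm
  · refine HEq.trans ?_ (Quiver.Hom.cast_heq ((faaFunctor G).obj_prod _ _) rfl
      ((faaFunctor G).map (G.L X).add)).symm
    exact (heq_of_eq (IsLinear.add (DiffObj.of G X)).seq_eq.symm).trans
      (seq_heq (P := (DiffObj.of G X).vec.prod (DiffObj.of G X).vec) (Q := (DiffObj.of G X).vec)
        (P' := .of G (prod (G.L X).carrier (G.L X).carrier)) (Q' := .of G (G.L X).carrier)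
        rfl rfl HEq.rfl)
  · refine HEq.trans ?_ (Quiver.Hom.cast_heq (faaFunctor G).obj_one rfl
      ((faaFunctor G).map (G.L X).zero)).symm
    exact (heq_of_eq (IsLinear.zero (DiffObj.of G X)).seq_eq.symm).trans
      (seq_heq (P := .one) (Q := (DiffObj.of G X).vec) (P' := .of G one)
        (Q' := .of G (G.L X).carrier) rfl rfl HEq.rfl)

variable (G) in
/-- The coalgebra of a generalized differential restriction structure. -/
noncomputable def coalgebra : FaaCoalgebra C where
  toStrictFunctor := faaFunctor G
  isObj X := IsCoherent.isMonoid X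
  isMap {X Y} f := seq_isMap (P := .of G X) (Q := .of G Y) f
  counit_eq := rfl
  coassoc := by
    refine Prefunctor.hext (fun X => ?_) (fun X Y f => ?_)
    · exact congrArg (fun M => (⟨M, ⟨G.L X, X⟩⟩ : PreFaa (PreFaa C))) (comultObj_mon_eq X)
    · refine FaaSeq.heq (comultObj_mon_eq X) (comultObj_mon_eq Y) rfl fun n hn => ?_
      refine HEq.trans ?_ (Quiver.Hom.cast_heq ((faaFunctor G).obj_pow _ _ n) rfl
        ((faaFunctor G).map (hi (.of G X) (.of G Y) f n))).symm
      -- The comultiplication differentiates fₙ precomposed with the comparison between the two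
      -- powers. That comparison is the identity up to `pt_pow_eq`, so both sides are the sequence
      -- of fₙ.
      refine (heq_of_eq (comult_seq (P := .of G X) (Q := .of G Y) f hn)).trans ?_
      refine seq_heq (P := (DiffObj.of G X).faaPow n) (Q := (DiffObj.of G Y).vec)
        (P' := .of G (pow (G.L X).carrier n X)) (Q' := .of G (G.L Y).carrier) (pt_pow_eq _ _ n) rfl ?_
      exact comp_heq (pt_pow_eq _ _ n) (tup_ptV_ptP_heq _ _ n) _

end DiffData
end Coalgebra

/-! ### From a coalgebra to a differential structure -/

section Family

set_option linter.unusedSectionVars false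

variable {C : Type u} [CartRestrStruct.{v} C] [IsCartRestrCat C]

/-- The first derivative of the `n`-th term of the comultiplication. -/
theorem FaaSeq.IsMap.tup_comultHi_one {P Q : PreFaa C} {f : FaaSeq P Q} (hf : f.IsMap)
    (hQ : Q.mon.IsTotalCommMonoid) (n : ℕ) [NeZero n] {T : C}
    {b : T ⟶ (pow P.vec n P).mon.carrier}
    {y : T ⟶ (pow P.vec n P).pt} (hb : IsTotal b) (hy : IsTotal y) :
    tup 1 (fun _ => b) y ≫ comultHi f n (Nat.pos_of_neZero n) 1 =
      Q.mon.sum (pcons (b ≫ vecP n) (tup n (fun i => y ≫ ptV n i) (y ≫ ptP n)) ≫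
          f.hi (n + 1) (Nat.succ_pos n))
        (Q.mon.finSum Finset.univ fun i : Fin n =>
          tup n (Function.update (fun j => y ≫ ptV n j) i (b ≫ vecV n i)) (y ≫ ptP n) ≫
            f.hi n (Nat.pos_of_neZero n)) := by
  have hr : rst (tup 1 (fun _ => b) y) = 𝟙 T := by rw [rst_tup_of_total fun _ => hb, hy]
  have hv {Z : C} (k : _ ⟶ Z) : tup 1 (fun _ => b) y ≫ vproj 1 0 ≫ k = b ≫ k := by
    rw [← assoc, tup_vproj, hr, id_comp]
  have hp {Z : C} (k : _ ⟶ Z) : tup 1 (fun _ => b) y ≫ pproj 1 ≫ k = y ≫ k := by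
    rw [← assoc, tup_pproj, hr, id_comp]
  let e₀ : Repl n 0 := default
  let E : Fin n ≃ {i // e₀.1 i = none} := (Equiv.subtypeUnivEquiv fun _ => rfl).symm
  have : Nonempty {i // e₀.1 i = none} := ⟨E 0⟩
  -- The replacements for one direction are the extensions of the empty one: the free case gives the
  -- term of order n + 1, and replacing argument i gives the i-th summand.
  rw [hf.comultHi_eq, ← hQ.finSum_equiv (Equiv.ofBijective _ Repl.extend_bijective)
    (k := fun p => f.ev (replArg (A := P.mon.carrier) (ptV (P := P.vec) n)
      (vecV (P := P.vec) n) (vecP n) (p.1.extend p.2)) (pproj 1 ≫ ptP n))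
    (fun _ => rfl), hQ.finSum_sigma, hQ.finSum_unique, hQ.finSum_option, MonData.comp_sum,
    hQ.comp_finSum Finset.univ_nonempty, FaaSeq.comp_ev]
  simp only [FaaSeq.comp_ev, hp]
  congr 1
  · let U : Unique {j // j ∈ (e₀.extend none).free} :=
      ⟨⟨⟨0, e₀.zero_mem_free_extend_none⟩⟩, fun j =>
        Subtype.ext (Subsingleton.elim (α := Fin 1) _ _)⟩
    rw [hf.ev_eq (Nat.succ_pos n) ((finSuccEquiv n).trans
      ((Equiv.optionEquivSumPUnit.{0} _).trans ((Equiv.refl _).sumCongr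
        (Equiv.ofUnique PUnit {j // j ∈ (e₀.extend none).free}))))]
    refine congrArg (fun k => k ≫ f.hi (n + 1) _) (tup_congr (n := n + 1)
      (b := Fin.cases (b ≫ vecP n) fun i => y ≫ ptV n i) (fun i => ?_) rfl)
    refine Fin.cases ?_ (fun i => ?_) i
    · exact hv _
    · exact hp _
  · rw [← hQ.finSum_equiv E (fun _ => rfl)]
    refine MonData.finSum_congr fun i _ => ?_
    have : IsEmpty {j // j ∈ (e₀.extend (some (E i))).free} := ⟨fun j => by
      have h := e₀.zero_notMem_free_extend_some (E i)
      rw [Subsingleton.elim (α := Fin 1) 0 j.1] at h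
      exact h j.2⟩
    rw [hf.ev_eq (Nat.pos_of_neZero n) (Equiv.sumEmpty (Fin n) _).symm]
    refine congrArg (fun k => k ≫ f.hi n _) (tup_congr (fun j => ?_) rfl)
    by_cases hj : j = i
    · subst hj
      rw [Function.update_self]
      exact (congrArg _ (replArg_some (e₀.extend_some_self (E j)))).trans (hv _)
    · rw [Function.update_of_ne hj]
      exact (congrArg _ (replArg_none (e₀.extend_some_of_ne (E i) hj))).trans (hp _)

end Family

section Family

set_option linter.unusedSectionVars false

variable {C : Type u} [CartRestrStruct.{v} C] [IsCartRestrCat C] {G : DiffData C} [G.IsCoherent]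

/-- The properties of the sequences `F P Q f` of a coalgebra that determine them. -/
structure IsFaaFamily (F : ∀ P Q : DiffObj G, (P.pt ⟶ Q.pt) → FaaSeq P.toPreFaa Q.toPreFaa) :
    Prop where
  base_eq : ∀ (P Q : DiffObj G) (f : P.pt ⟶ Q.pt), (F P Q f).base = f
  hi_one : ∀ (P Q : DiffObj G) (f : P.pt ⟶ Q.pt), (F P Q f).hi 1 Nat.one_pos = G.d P Q f
  isMap : ∀ (P Q : DiffObj G) (f : P.pt ⟶ Q.pt), (F P Q f).IsMap
  map_comp : ∀ (P Q R : DiffObj G) (f : P.pt ⟶ Q.pt) (g : Q.pt ⟶ R.pt),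
    F P R (f ≫ g) = (F P Q f).comp (F Q R g)
  map_rst : ∀ (P Q : DiffObj G) (f : P.pt ⟶ Q.pt), F P P (rst f) = (F P Q f).rstSeq
  map_fst : ∀ P Q : DiffObj G, F (P.prod Q) P (fst P.pt Q.pt) =
    FaaSeq.ofTwo (fst P.pt Q.pt) (fst _ _ ≫ fst P.mon.carrier Q.mon.carrier)
  map_snd : ∀ P Q : DiffObj G, F (P.prod Q) Q (snd P.pt Q.pt) =
    FaaSeq.ofTwo (snd P.pt Q.pt) (fst _ _ ≫ snd P.mon.carrier Q.mon.carrier)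
  map_add : ∀ P : DiffObj G, F (P.vec.prod P.vec) P.vec P.mon.add =
    FaaSeq.ofTwo P.mon.add (fst _ _ ≫ P.mon.add)
  map_zero : ∀ P : DiffObj G, F .one P.vec P.mon.zero =
    FaaSeq.ofTwo P.mon.zero (fst _ _ ≫ P.mon.zero)
  coassoc : ∀ (P Q : DiffObj G) (f : P.pt ⟶ Q.pt) (n : ℕ) (hn : 0 < n),
    (F (P.faaPow n) Q.vec
      (tup n (fun i => ptV (P := P.vec.toPreFaa) (Q := P.toPreFaa) n i) (ptP n) ≫
        (F P Q f).hi n hn)).hi 1 Nat.one_pos = comultHi (F P Q f) n hn 1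

namespace IsFaaFamily

variable {F : ∀ P Q : DiffObj G, (P.pt ⟶ Q.pt) → FaaSeq P.toPreFaa Q.toPreFaa}
  (hF : IsFaaFamily F) (P Q R : DiffObj G) {T Z : C}
include hF

theorem d_comp (f : P.pt ⟶ Q.pt) (g : Q.pt ⟶ R.pt) :
    G.d P R (f ≫ g) = pair (G.d P Q f) (snd P.mon.carrier P.pt ≫ f) ≫
      G.d Q R g := by
  rw [← hF.hi_one P R, hF.map_comp P Q R, FaaSeq.comp_hi_one R.isMonoid, hF.hi_one, hF.hi_one, hF.base_eq]
  rfl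

theorem d_rst (f : P.pt ⟶ Q.pt) : G.d P P (rst f) =
    rst (snd P.mon.carrier P.pt ≫ f) ≫
      fst P.mon.carrier P.pt := by
  rw [← hF.hi_one P P, hF.map_rst P Q]
  exact congrArg (fun k => rst (snd _ _ ≫ k) ≫ fst P.mon.carrier P.pt) (hF.base_eq P Q f)

theorem rst_d (f : P.pt ⟶ Q.pt) : rst (G.d P Q f) =
    rst (snd P.mon.carrier P.pt ≫ f) := by
  have h := (hF.isMap P Q f).rst_hi 1 Nat.one_pos
  rw [hF.hi_one, hF.base_eq] at h
  refine h.trans ?_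
  exact congrArg (fun k => rst (k ≫ f)) (comp_id _)

theorem d_fst : G.d (P.prod Q) P (fst P.pt Q.pt) =
    fst _ _ ≫ fst P.mon.carrier Q.mon.carrier := by
  rw [← hF.hi_one (P.prod Q) P, hF.map_fst]
  rfl

theorem d_snd : G.d (P.prod Q) Q (snd P.pt Q.pt) =
    fst _ _ ≫ snd P.mon.carrier Q.mon.carrier := by
  rw [← hF.hi_one (P.prod Q) Q, hF.map_snd]
  rfl

theorem d_rst_comp (e : P.pt ⟶ R.pt) (f : P.pt ⟶ Q.pt) : G.d P Q (rst e ≫ f) =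
    rst (G.d P R e) ≫ G.d P Q f := by
  rw [hF.d_comp P P Q, hF.d_rst P R, comp_rst, pair_rst_left, pair_rst_right, rst_idem_assoc,
    pair_fst_snd, comp_id, hF.rst_d]

/-- A coalgebra is required to preserve projections, not pairings. The derivative of a pairing is
found by composing with the projections through the chain rule; the restrictions that appear there
are those of D[f] and D[g]. -/
theorem d_pair (f : P.pt ⟶ Q.pt) (g : P.pt ⟶ R.pt) :
    G.d P (Q.prod R) (pair f g) = pair (G.d P Q f) (G.d P R g) := by
  have h : rst (snd P.mon.carrier P.pt ≫ pair f g) =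
      rst (G.d P (Q.prod R) (pair f g)) := (hF.rst_d P (Q.prod R) _).symm
  apply prod_hom_ext
  · have h₁ := hF.d_comp P (Q.prod R) Q (pair f g) (fst Q.pt R.pt)
    rw [hF.d_fst, pair_fst_assoc, h, rst_self_comp_assoc, pair_fst, hF.d_rst_comp P Q R] at h₁
    rw [← h₁, pair_fst]
  · have h₁ := hF.d_comp P (Q.prod R) R (pair f g) (snd Q.pt R.pt)
    rw [hF.d_snd, pair_fst_assoc, h, rst_self_comp_assoc, pair_snd, hF.d_rst_comp P R Q] at h₁
    rw [← h₁, pair_snd]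

theorem pair_sum_d (f : P.pt ⟶ Q.pt) (a b : T ⟶ P.mon.carrier) (c : T ⟶ P.pt) :
    pair (P.mon.sum a b) c ≫ G.d P Q f =
      Q.mon.sum (pair a c ≫ G.d P Q f) (pair b c ≫ G.d P Q f) := by
  have h := (hF.isMap P Q f).map_add 1 Nat.one_pos T (fun _ => a) c 0 a b
  rw [hF.hi_one] at h
  simp only [tup, Function.update_self] at h
  exact h

theorem pair_zero_d (f : P.pt ⟶ Q.pt) (a : T ⟶ P.pt) :
    pair (P.mon.zeroMap T) a ≫ G.d P Q f =
      rst (a ≫ f) ≫ Q.mon.zeroMap T := by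
  have h := (hF.isMap P Q f).tup_update_zero P.isMonoid Nat.one_pos (a := fun _ => P.mon.zeroMap T)
    (x := a) (fun _ => by rw [P.isMonoid.zeroMap_total, id_comp]) 0
  rw [hF.hi_one, hF.base_eq] at h
  simp only [tup, Function.update_self] at h
  exact h

/-- The second derivative at total generalized elements. -/
theorem pair_d_d (f : P.pt ⟶ Q.pt) {a b c : T ⟶ P.mon.carrier} {x : T ⟶ P.pt} (ha : IsTotal a)
    (hb : IsTotal b) (hc : IsTotal c) (hx : IsTotal x) :
    pair (pair a b) (pair c x) ≫ G.d (P.vec.prod P) Q.vec (G.d P Q f) =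
      Q.mon.sum (tup 2 (Fin.cases b fun _ => c) x ≫ (F P Q f).hi 2 Nat.two_pos)
        (pair a x ≫ G.d P Q f) := by
  have h₀ : tup 1 (fun i => ptV (P := P.vec.toPreFaa) (Q := P.toPreFaa) 1 i) (ptP 1) ≫
      (F P Q f).hi 1 Nat.one_pos = G.d P Q f := by
    refine (congrArg (fun k => k ≫ (F P Q f).hi 1 Nat.one_pos) (?_ : _ = 𝟙 _)).trans
      ((id_comp _).trans (hF.hi_one P Q f))
    exact tup_self (A := P.mon.carrier) (X := P.pt) 1
  have h₁ := (hF.isMap P Q f).tup_comultHi_one Q.isMonoid 1 (T := T) (b := pair a b)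
    (y := pair c x) ((rst_pair a b).trans (by rw [ha, hb, id_comp]))
    ((rst_pair c x).trans (by rw [hc, hx, id_comp]))
  rw [Q.isMonoid.finSum_unique] at h₁
  refine (congrArg (fun k => pair (pair a b) (pair c x) ≫ G.d (P.vec.prod P) Q.vec k)
    h₀.symm).trans ?_
  refine (congrArg (fun k => pair (pair a b) (pair c x) ≫ k)
    ((hF.hi_one (P.faaPow 1) Q.vec _).symm.trans (hF.coassoc P Q f 1 Nat.one_pos))).trans ?_
  refine h₁.trans ?_
  have h₂ : pair a b ≫ snd P.mon.carrier P.mon.carrier ≫ 𝟙 _ = b := by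
    rw [comp_id, pair_snd, ha, id_comp]
  have h₃ : pair c x ≫ snd P.mon.carrier P.pt ≫ 𝟙 _ = x := by
    rw [comp_id, pair_snd, hc, id_comp]
  have h₄ : pair a b ≫ fst P.mon.carrier P.mon.carrier = a := by
    rw [pair_fst, hb, id_comp]
  have h₅ : pair c x ≫ fst P.mon.carrier P.pt = c := by
    rw [pair_fst, hx, id_comp]
  congr 1
  · exact congrArg (fun k => k ≫ (F P Q f).hi 2 Nat.two_pos)
      (congrArg₂ pair h₂ (congrArg₂ pair h₅ h₃))
  · rw [hF.hi_one]
    refine congrArg (fun k => k ≫ G.d P Q f) (congrArg₂ pair ?_ h₃)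
    exact h₄

/-- Partial elements factor through the universal triple in A × (A × X), whose projections are
total. This reduces DR.6 to `pair_d_d`; the next two lemmas do the same for DR.7. -/
theorem pair_pair_zero_eq (a c : T ⟶ P.mon.carrier) (x : T ⟶ P.pt) :
    pair (pair a (P.mon.zeroMap T)) (pair c x) = pair a (pair c x) ≫
      pair (pair (fst _ _) (P.mon.zeroMap _)) (pair (snd _ _ ≫ fst _ _) (snd _ _ ≫ snd _ _)) := by
  simp only [comp_pair, pair_fst, pair_snd, pair_snd_assoc]
  rw [P.mon.comp_zeroMap (pair _ (pair c x))]
  simp only [pair_rst_left, pair_rst_right, rst_pair, assoc, rst_left_comm, rst_idem_assoc]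
  have hz : rst (P.mon.zeroMap T) = 𝟙 T := P.isMonoid.zeroMap_total T
  have h : rst (pair a (pair c x)) ≫ pair (pair a (P.mon.zeroMap T)) (pair c x) = pair (pair a (P.mon.zeroMap T)) (pair c x) :=
    rst_comp_of_eq (by simp only [rst_pair, hz, comp_id])
  simpa only [rst_pair, assoc] using h.symm

theorem pair_zero_pair_eq (b c : T ⟶ P.mon.carrier) (x : T ⟶ P.pt) :
    pair (pair (P.mon.zeroMap T) b) (pair c x) = pair b (pair c x) ≫
      pair (pair (P.mon.zeroMap _) (fst _ _)) (pair (snd _ _ ≫ fst _ _) (snd _ _ ≫ snd _ _)) := by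
  simp only [comp_pair, pair_fst, pair_snd, pair_snd_assoc]
  rw [P.mon.comp_zeroMap (pair _ (pair c x))]
  simp only [pair_rst_left, pair_rst_right, rst_pair, assoc, rst_left_comm, rst_idem_assoc]
  have hz : rst (P.mon.zeroMap T) = 𝟙 T := P.isMonoid.zeroMap_total T
  have h : rst (pair b (pair c x)) ≫ pair (pair (P.mon.zeroMap T) b) (pair c x) = pair (pair (P.mon.zeroMap T) b) (pair c x) :=
    rst_comp_of_eq (by simp only [rst_pair, hz, id_comp])
  simpa only [rst_pair, assoc] using h.symm

theorem pair_zero_pair_eq' (b c : T ⟶ P.mon.carrier) (x : T ⟶ P.pt) :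
    pair (pair (P.mon.zeroMap T) c) (pair b x) = pair b (pair c x) ≫
      pair (pair (P.mon.zeroMap _) (snd _ _ ≫ fst _ _)) (pair (fst _ _) (snd _ _ ≫ snd _ _)) := by
  simp only [comp_pair, pair_fst, pair_snd, pair_snd_assoc]
  rw [P.mon.comp_zeroMap (pair _ (pair c x))]
  simp only [pair_rst_left, pair_rst_right, rst_pair, assoc, rst_left_comm, rst_idem_assoc]
  have hz : rst (P.mon.zeroMap T) = 𝟙 T := P.isMonoid.zeroMap_total T
  have h : rst (pair b (pair c x)) ≫ pair (pair (P.mon.zeroMap T) c) (pair b x) = pair (pair (P.mon.zeroMap T) c) (pair b x) :=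
    rst_comp_of_eq (by simp only [rst_pair, hz, id_comp, rst_left_comm])
  simpa only [rst_pair, assoc] using h.symm

/-- With b = 0 the f₂ term of `pair_d_d` is a restricted zero, absorbed by the f₁ term. -/
theorem d_d_linear (f : P.pt ⟶ Q.pt) (a c : T ⟶ P.mon.carrier) (x : T ⟶ P.pt) :
    pair (pair a (P.mon.zeroMap T)) (pair c x) ≫ G.d (P.vec.prod P) Q.vec (G.d P Q f) =
      rst c ≫ pair a x ≫ G.d P Q f := by
  have hr : pair a (pair c x) ≫ pair (fst P.mon.carrier (CartRestrStruct.prod P.mon.carrier P.pt))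
      (snd _ _ ≫ snd P.mon.carrier P.pt) = rst c ≫ pair a x := by
    simp only [comp_pair, pair_fst, pair_snd, pair_snd_assoc]
    simp only [pair_rst_left, pair_rst_right, rst_pair, assoc, rst_idem_assoc]
    rw [rst_comp_pair_right, rst_left_comm, rst_comp_pair_left]
  have hz := (hF.isMap P Q f).tup_update_zero P.isMonoid Nat.two_pos
    (T := CartRestrStruct.prod P.mon.carrier (CartRestrStruct.prod P.mon.carrier P.pt))
    (a := fun _ => snd _ _ ≫ fst P.mon.carrier P.pt) (x := snd _ _ ≫ snd P.mon.carrier P.pt)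
    (fun _ => by rw [(snd_total _ _).comp (fst_total _ _), id_comp]) 0
  rw [hF.pair_pair_zero_eq P a c x, assoc, ← assoc (rst c), ← hr, assoc,
    hF.pair_d_d P Q f (fst_total _ _) (P.isMonoid.zeroMap_total _)
      ((snd_total _ _).comp (fst_total _ _)) ((snd_total _ _).comp (snd_total _ _))]
  refine congrArg (fun k => pair a (pair c x) ≫ k) ((congrArg₂ Q.mon.sum
    (?_ : _ = rst ((snd _ _ ≫ snd P.mon.carrier P.pt) ≫ f) ≫ Q.mon.zeroMap _) rfl).trans ?_)
  · rw [hF.base_eq] at hz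
    refine Eq.trans (congrArg (fun k => k ≫ (F P Q f).hi 2 Nat.two_pos)
      (tup_congr (fun i => ?_) rfl)) hz
    fin_cases i <;> rfl
  · rw [Q.isMonoid.rst_zero_sum]
    apply rst_comp_of_eq
    rw [rst_comp_congr _ (hF.rst_d P Q f), pair_snd_assoc, rst_fst_eq, id_comp, assoc]

/-- With a = 0 the f₁ terms of the two sides agree, and the f₂ terms agree by symmetry. -/
theorem d_d_symm (f : P.pt ⟶ Q.pt) (b c : T ⟶ P.mon.carrier) (x : T ⟶ P.pt) :
    pair (pair (P.mon.zeroMap T) b) (pair c x) ≫ G.d (P.vec.prod P) Q.vec (G.d P Q f) =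
      pair (pair (P.mon.zeroMap T) c) (pair b x) ≫ G.d (P.vec.prod P) Q.vec (G.d P Q f) := by
  rw [hF.pair_zero_pair_eq P b c x, hF.pair_zero_pair_eq' P b c x, assoc, assoc,
    hF.pair_d_d P Q f (P.isMonoid.zeroMap_total _) (fst_total _ _)
      ((snd_total _ _).comp (fst_total _ _)) ((snd_total _ _).comp (snd_total _ _)),
    hF.pair_d_d P Q f (P.isMonoid.zeroMap_total _) ((snd_total _ _).comp (fst_total _ _))
      (fst_total _ _) ((snd_total _ _).comp (snd_total _ _))]
  refine congrArg (fun k => pair b (pair c x) ≫ k) (congrArg₂ Q.mon.sum ?_ rfl)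
  rw [← (hF.isMap P Q f).symm_apply 2 Nat.two_pos (Equiv.swap 0 1)]
  refine congrArg (fun k => k ≫ (F P Q f).hi 2 Nat.two_pos) (tup_congr (fun i => ?_) rfl)
  fin_cases i <;> rfl

theorem laws : G.Laws where
  d_add P := by rw [← hF.hi_one (P.vec.prod P.vec) P.vec, hF.map_add]; rfl
  d_zero P := by rw [← hF.hi_one .one P.vec, hF.map_zero]; rfl
  pair_sum_d := hF.pair_sum_d
  pair_zero_d := hF.pair_zero_d
  d_fst := hF.d_fst
  d_snd := hF.d_snd
  d_pair := hF.d_pair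
  d_comp := hF.d_comp
  d_d_linear := hF.d_d_linear
  d_d_symm := hF.d_d_symm
  d_rst := hF.d_rst
  rst_d := hF.rst_d

end IsFaaFamily
end Family

/-! ### A coalgebra is determined by its first derivatives -/

section Uniqueness

set_option linter.unusedSectionVars false

variable {C : Type u} [CartRestrStruct.{v} C] [IsCartRestrCat C]

section

variable {A Z W Y : C} {t : Z ⟶ W}

theorem pair_fst_snd_comp_total (ht : IsTotal t) : IsTotal (pair (fst A Z) (snd A Z ≫ t)) :=
  (rst_pair _ _).trans (by rw [rst_fst_eq, (snd_total _ _).comp ht, id_comp])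

theorem pair_fst_snd_comp_fst (ht : IsTotal t) :
    pair (fst A Z) (snd A Z ≫ t) ≫ fst A W = fst A Z := by
  rw [pair_fst, (snd_total _ _).comp ht, id_comp]

theorem pair_fst_snd_comp_snd (t : Z ⟶ W) (k : W ⟶ Y) :
    pair (fst A Z) (snd A Z ≫ t) ≫ snd A W ≫ k = snd A Z ≫ t ≫ k := by
  rw [pair_snd_assoc, rst_fst_eq, id_comp, assoc]

end

/-- The comparison from a power of points to the points of a power. -/
noncomputable def powPt (P Q : PreFaa C) : (n : ℕ) → (pow P.pt n Q.pt ⟶ (pow P n Q).pt)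
  | 0 => 𝟙 Q.pt
  | n + 1 => pair (fst P.pt (pow P.pt n Q.pt)) (snd P.pt (pow P.pt n Q.pt) ≫ powPt P Q n)

/-- The comparison from a power of vectors to the vectors of a power. -/
noncomputable def powVec (P Q : PreFaa C) :
    (n : ℕ) → (pow P.mon.carrier n Q.mon.carrier ⟶ (pow P n Q).mon.carrier)
  | 0 => 𝟙 Q.mon.carrier
  | n + 1 => pair (fst P.mon.carrier (pow P.mon.carrier n Q.mon.carrier))
      (snd P.mon.carrier (pow P.mon.carrier n Q.mon.carrier) ≫ powVec P Q n)

theorem powPt_total (P Q : PreFaa C) (n : ℕ) : IsTotal (powPt P Q n) := by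
  induction n with
  | zero => exact isTotal_id _
  | succ n ih => exact pair_fst_snd_comp_total ih

theorem powVec_total (P Q : PreFaa C) (n : ℕ) : IsTotal (powVec P Q n) := by
  induction n with
  | zero => exact isTotal_id _
  | succ n ih => exact pair_fst_snd_comp_total ih

theorem powPt_ptV (P Q : PreFaa C) (n : ℕ) (i : Fin n) : powPt P Q n ≫ ptV n i = vproj n i := by
  induction n with
  | zero => exact i.elim0
  | succ n ih =>
    refine Fin.cases ?_ (fun j => ?_) i
    · exact pair_fst_snd_comp_fst (powPt_total P Q n)
    · exact (pair_fst_snd_comp_snd _ _).trans (congrArg _ (ih j))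

theorem powPt_ptP (P Q : PreFaa C) (n : ℕ) : powPt P Q n ≫ ptP n = pproj n := by
  induction n with
  | zero => exact id_comp _
  | succ n ih =>
    exact (pair_fst_snd_comp_snd _ _).trans (congrArg _ ih)

theorem powVec_vecV (P Q : PreFaa C) (n : ℕ) (i : Fin n) :
    powVec P Q n ≫ vecV n i = vproj n i := by
  induction n with
  | zero => exact i.elim0
  | succ n ih =>
    refine Fin.cases ?_ (fun j => ?_) i
    · exact pair_fst_snd_comp_fst (powVec_total P Q n)
    · exact (pair_fst_snd_comp_snd _ _).trans (congrArg _ (ih j))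

theorem powVec_vecP (P Q : PreFaa C) (n : ℕ) : powVec P Q n ≫ vecP n = pproj n := by
  induction n with
  | zero => exact id_comp _
  | succ n ih =>
    exact (pair_fst_snd_comp_snd _ _).trans (congrArg _ ih)

variable {G : DiffData C} [G.IsCoherent]

theorem DiffData.d_powPt [hG : G.Laws] (P : DiffObj G) (n : ℕ) :
    G.d (P.pow n) (P.faaPow n) (powPt P.vec.toPreFaa P.toPreFaa n) =
      fst _ _ ≫ powVec P.vec.toPreFaa P.toPreFaa n := by
  induction n with
  | zero => exact (d_id P).trans (comp_id _).symm
  | succ n ih =>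
    refine (hG.d_pair (P.pow (n + 1)) P.vec (P.faaPow n) _ _).trans ?_
    have h₁ := hG.d_fst P.vec (P.pow n)
    have h₂ := (d_comp_linear (P.vec.prod (P.pow n)) (P.pow n) (P.faaPow n) (snd _ _) ih).trans
      (congrArg (fun k => k ≫ powVec P.vec.toPreFaa P.toPreFaa n) (hG.d_snd P.vec (P.pow n)))
    refine (congrArg₂ pair h₁ (h₂.trans (assoc _ _ _))).trans ?_
    exact (comp_pair _ _ _).symm

namespace IsFaaFamily

variable {F : ∀ P Q : DiffObj G, (P.pt ⟶ Q.pt) → FaaSeq P.toPreFaa Q.toPreFaa}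
  (hF : IsFaaFamily F) [hG : G.Laws] (P Q : DiffObj G)
include hF

/-- Coassociativity at m = 1 is evaluated in the direction (0, …, 0, b). All replaced terms contain
a zero vector, and the term of order n + 1 absorbs them. -/
theorem hi_succ (f : P.pt ⟶ Q.pt) (n : ℕ) [NeZero n] :
    (F P Q f).hi (n + 1) (Nat.succ_pos n) =
      DiffData.der (P := P) Q.vec ((F P Q f).hi n (Nat.pos_of_neZero n)) := by
  let s := powPt P.vec.toPreFaa P.toPreFaa n
  let s' := powVec P.vec.toPreFaa P.toPreFaa n
  have h₁ := (hF.isMap P Q f).tup_comultHi_one Q.isMonoid n (b := DiffData.inc P n ≫ fst _ _ ≫ s')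
    (y := ptail _ _ n ≫ s)
    ((rst_comp_of_total _ ((fst_total _ _).comp (powVec_total P.vec.toPreFaa P.toPreFaa n))).trans (DiffData.rst_inc P n))
    ((ptail_total _ _ n).comp (powPt_total P.vec.toPreFaa P.toPreFaa n))
  let t := tup n (fun i => ptV (P := P.vec.toPreFaa) (Q := P.toPreFaa) n i) (ptP n)
  -- The comparison maps `s` and `s'` carry the argument from powers in C to the powers in `PreFaa
  -- C` used by the comultiplication. As `s` is a section of `t`, the derivative of fₙ is obtained
  -- from that of `t ≫ fₙ`.
  have hst : s ≫ t = 𝟙 _ := by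
    refine (comp_tup _ _ _ _).trans ?_
    refine (tup_congr (fun i => powPt_ptV _ _ n i) (powPt_ptP _ _ n)).trans ?_
    exact tup_self n
  have h₂ : DiffData.der Q.vec ((F P Q f).hi n (Nat.pos_of_neZero n)) =
      tup 1 (fun _ => DiffData.inc P n ≫ fst _ _ ≫ s') (ptail _ _ n ≫ s) ≫
        comultHi (F P Q f) n (Nat.pos_of_neZero n) 1 := by
    rw [← hF.coassoc P Q f n (Nat.pos_of_neZero n), hF.hi_one (P.faaPow n) Q.vec, DiffData.der]
    have h₃ := hG.d_comp (P.pow n) (P.faaPow n) Q.vec s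
      (t ≫ (F P Q f).hi n (Nat.pos_of_neZero n))
    have h₄ : s ≫ t ≫ (F P Q f).hi n (Nat.pos_of_neZero n) =
        (F P Q f).hi n (Nat.pos_of_neZero n) :=
      (assoc _ _ _).symm.trans ((congrArg (fun k => k ≫ _) hst).trans (id_comp _))
    refine (congrArg (fun k => DiffData.inc P n ≫ G.d (P.pow n) Q.vec k) h₄.symm).trans ?_
    refine (congrArg (fun k => DiffData.inc P n ≫ k) h₃).trans ?_
    refine (comp_pair_assoc _ _ _ _).trans ?_
    refine congrArg (fun k => k ≫ G.d (P.faaPow n) Q.vec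
      (t ≫ (F P Q f).hi n (Nat.pos_of_neZero n))) (congrArg₂ pair ?_ ?_)
    · exact congrArg (fun k => DiffData.inc P n ≫ k) (DiffData.d_powPt P n)
    · exact DiffData.inc_snd_assoc P n s
  have hb {Z : C} {k : _ ⟶ Z} {l : pow P.mon.carrier n P.mon.carrier ⟶ Z} (h : s' ≫ k = l) :
      (DiffData.inc P n ≫ fst _ _ ≫ s') ≫ k = DiffData.inc P n ≫ fst _ _ ≫ l := by
    rw [assoc, assoc, h]
  have hy {Z : C} {k : _ ⟶ Z} {l : pow P.mon.carrier n P.pt ⟶ Z} (h : s ≫ k = l) :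
      (ptail P.mon.carrier P.pt n ≫ s) ≫ k = ptail _ _ n ≫ l := by
    rw [assoc, h]
  have hyV (i : Fin n) := hy (powPt_ptV P.vec.toPreFaa P.toPreFaa n i)
  have hyP := hy (powPt_ptP P.vec.toPreFaa P.toPreFaa n)
  rw [h₂, h₁, Q.isMonoid.sum_comm, MonData.finSum_congr (l := fun _ =>
    rst ((ptail _ _ n ≫ pproj n) ≫ (F P Q f).base) ≫ Q.mon.zeroMap _)]
  · have h₅ : pcons ((DiffData.inc P n ≫ fst _ _ ≫ s') ≫ vecP n)
        (tup n (fun i => (ptail P.mon.carrier P.pt n ≫ s) ≫ ptV n i)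
          ((ptail P.mon.carrier P.pt n ≫ s) ≫ ptP n)) = 𝟙 (pow P.mon.carrier (n + 1) P.pt) := by
      refine (congrArg₂ pcons ((hb (powVec_vecP _ _ n)).trans (DiffData.inc_fst_pproj P n))
        ((tup_congr hyV hyP).trans (tup_comp_self _))).trans ?_
      exact pcons_phead_ptail _ _ _
    refine Eq.trans ?_ (Q.isMonoid.sum_finSum_rst_zero _ ?_).symm
    · exact ((congrArg (fun k => k ≫ (F P Q f).hi (n + 1) (Nat.succ_pos n)) h₅).trans
        (id_comp _)).symm
    · apply rst_comp_of_eq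
      refine Eq.trans ?_ (congrArg rst (((congrArg (fun k => k ≫
        (F P Q f).hi (n + 1) (Nat.succ_pos n)) h₅).trans (id_comp _)))).symm
      rw [(hF.isMap P Q f).rst_hi, pproj_succ]
  · intro i _
    refine Eq.trans ?_ ((hF.isMap P Q f).tup_update_zero P.isMonoid (Nat.pos_of_neZero n)
      (a := fun j => ptail _ _ n ≫ vproj n j) (fun j => ?_) i)
    · refine congrArg (fun k => k ≫ (F P Q f).hi n (Nat.pos_of_neZero n)) (tup_congr (fun j => ?_) hyP)
      by_cases hj : j = i
      · subst hj
        rw [Function.update_self, Function.update_self]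
        exact (hb (powVec_vecV _ _ n j)).trans (DiffData.inc_fst_vproj P n j)
      · rw [Function.update_of_ne hj, Function.update_of_ne hj]
        exact hyV j
    · rw [(ptail_total _ _ n).comp (vproj_total n j), id_comp]

theorem eq_seq (f : P.pt ⟶ Q.pt) : F P Q f = DiffData.seq P Q f := by
  have h (n : ℕ) : (F P Q f).hi (n + 1) (Nat.succ_pos n) = DiffData.hi P Q f (n + 1) := by
    induction n with
    | zero => exact hF.hi_one P Q f
    | succ n ih => rw [hF.hi_succ P Q f (n + 1), ih, DiffData.hi_succ f (Nat.succ_pos n)]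
  apply FaaSeq.ext
  · exact hF.base_eq P Q f
  · funext n hn
    obtain ⟨n, rfl⟩ := Nat.exists_eq_succ_of_ne_zero hn.ne'
    exact h n

end IsFaaFamily
end Uniqueness

/-! ### The bijection -/

section Bijection

theorem MonData.add_heq {C : Type u} [CartRestrStruct.{v} C] {M N : MonData C} (h : M = N) :
    HEq M.add N.add := by
  subst h; rfl

theorem MonData.zero_heq {C : Type u} [CartRestrStruct.{v} C] {M N : MonData C} (h : M = N) :
    HEq M.zero N.zero := by
  subst h; rfl

theorem FaaSeq.hi_heq {C : Type u} [CartRestrStruct.{v} C] {P P' Q Q' : PreFaa C} (hP : P = P')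
    (hQ : Q = Q') {f : FaaSeq P Q} {g : FaaSeq P' Q'} (h : HEq f g) (n : ℕ) (hn : 0 < n) :
    HEq (f.hi n hn) (g.hi n hn) := by
  subst hP hQ
  rw [eq_of_heq h]

theorem Prefunctor.map_heq {V : Type u₁} [Quiver.{v₁} V] {W : Type u₂} [Quiver.{v₂} W]
    {F F' : V ⥤q W} (h : F = F') {X Y : V} (f : X ⟶ Y) : HEq (F.map f) (F'.map f) := by
  subst h; rfl

theorem FaaCoalgebra.ext_heq {C : Type u} [CartRestrStruct.{v} C] {K K' : FaaCoalgebra C}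
    (h : ∀ X, K.obj X = K'.obj X) (h' : ∀ (X Y : C) (f : X ⟶ Y), HEq (K.map f) (K'.map f)) :
    K = K' := by
  have e := Prefunctor.hext h h'
  obtain ⟨⟨F, _⟩, _⟩ := K
  obtain ⟨⟨F', _⟩, _⟩ := K'
  obtain rfl : F = F' := e
  rfl

variable {C : Type u} [CartRestrStruct.{v} C] [IsCartRestrCat C]

/-- The object part and the sequences of a coalgebra, without transports. -/
theorem FaaCoalgebra.exists_isFaaFamily (K : FaaCoalgebra C) :
    ∃ _ : K.toDiffData.IsCoherent, ∃ F, IsFaaFamily (G := K.toDiffData) F ∧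
      ∀ (X Y : C) (f : X ⟶ Y), HEq (F (.of _ X) (.of _ Y) f) (K.map f) := by
  obtain ⟨⟨⟨obj, map⟩, map_id, map_comp, map_rst, obj_prod, obj_one, map_fst, map_snd⟩, isObj, isMap,
    counit_eq, coassoc⟩ := K
  -- The counit equation forces the second component of 𝒟(X) to be X. Substituting this form removes
  -- the transport in `toDiffData`.
  obtain ⟨L, rfl⟩ : ∃ L : C → MonData C, obj = fun X => ⟨L X, X⟩ :=
    ⟨fun X => (obj X).mon, funext fun X =>
      congrArg (PreFaa.mk (obj X).mon) (congrArg (fun F : C ⥤q C => F.obj X) counit_eq)⟩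
  have hbase {X Y : C} (f : X ⟶ Y) : (map f).base = f :=
    eq_of_heq (Prefunctor.map_heq counit_eq f)
  have hobj (X : C) := congrArg (fun F : C ⥤q PreFaa (PreFaa C) => F.obj X) coassoc
  have hmap {X Y : C} (f : X ⟶ Y) := Prefunctor.map_heq coassoc f
  have hmap_heq {X X' Y Y' : C} (hX : X = X') (hY : Y = Y') {f : X ⟶ Y} {f' : X' ⟶ Y'}
      (h : HEq f f') : HEq (map f) (map f') := by
    subst hX hY
    rw [eq_of_heq h]
  let G : DiffData C := ⟨L, fun f => (map f).hi 1 Nat.one_pos⟩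
  have hG : G.IsCoherent :=
    { isMonoid := isObj
      -- Coassociativity on objects compares the carriers ((L X), L₀ X) and ((L (L₀ X)), L₀ X) of
      -- the two monoids in Faà.
      L_L := fun X => (congrArg (fun O => O.mon.carrier.mon) (hobj X)).symm
      L_prod := fun X Y => congrArg PreFaa.mon (obj_prod X Y)
      L_one := congrArg PreFaa.mon obj_one }
  let F (P Q : DiffObj G) (f : P.pt ⟶ Q.pt) : FaaSeq P.toPreFaa Q.toPreFaa :=
    Quiver.Hom.cast (U := PreFaa C) (congrArg (fun M => PreFaa.mk M P.pt) P.L_pt)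
      (congrArg (fun M => PreFaa.mk M Q.pt) Q.L_pt) (map f)
  have hF (P Q : DiffObj G) (f : P.pt ⟶ Q.pt) : HEq (F P Q f) (map f) :=
    Quiver.Hom.cast_heq _ _ _
  suffices h : IsFaaFamily F from ⟨hG, F, h, fun X Y f => HEq.rfl⟩
  refine ⟨?_, ?_, ?_, ?_, ?_, ?_, ?_, ?_, ?_, ?_⟩
  · intro P Q f
    obtain ⟨X, rfl⟩ := P.exists_eq_of
    obtain ⟨Y, rfl⟩ := Q.exists_eq_of
    exact hbase f
  · intro P Q f
    obtain ⟨X, rfl⟩ := P.exists_eq_of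
    obtain ⟨Y, rfl⟩ := Q.exists_eq_of
    rfl
  · intro P Q f
    obtain ⟨X, rfl⟩ := P.exists_eq_of
    obtain ⟨Y, rfl⟩ := Q.exists_eq_of
    exact isMap f
  · intro P Q R f g
    obtain ⟨X, rfl⟩ := P.exists_eq_of
    obtain ⟨Y, rfl⟩ := Q.exists_eq_of
    obtain ⟨Z, rfl⟩ := R.exists_eq_of
    exact map_comp f g
  · intro P Q f
    obtain ⟨X, rfl⟩ := P.exists_eq_of
    obtain ⟨Y, rfl⟩ := Q.exists_eq_of
    exact map_rst f
  · intro P Q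
    obtain ⟨X, rfl⟩ := P.exists_eq_of
    obtain ⟨Y, rfl⟩ := Q.exists_eq_of
    exact map_fst X Y
  · intro P Q
    obtain ⟨X, rfl⟩ := P.exists_eq_of
    obtain ⟨Y, rfl⟩ := Q.exists_eq_of
    exact map_snd X Y
  · intro P
    obtain ⟨X, rfl⟩ := P.exists_eq_of
    refine eq_of_heq ((hF ((DiffObj.of G X).vec.prod (DiffObj.of G X).vec) (DiffObj.of G X).vec
      (L X).add).trans ?_)
    exact ((MonData.add_heq (congrArg PreFaa.mon (hobj X))).trans
      (Quiver.Hom.cast_heq (obj_prod _ _) rfl (map (L X).add))).symm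
  · intro P
    obtain ⟨X, rfl⟩ := P.exists_eq_of
    refine eq_of_heq ((hF .one (DiffObj.of G X).vec (L X).zero).trans ?_)
    exact ((MonData.zero_heq (congrArg PreFaa.mon (hobj X))).trans
      (Quiver.Hom.cast_heq obj_one rfl (map (L X).zero))).symm
  · intro P Q f n hn
    obtain ⟨X, rfl⟩ := P.exists_eq_of
    obtain ⟨Y, rfl⟩ := Q.exists_eq_of
    let S : StrictFunctor C (PreFaa C) :=
      ⟨⟨fun X => ⟨L X, X⟩, map⟩, map_id, map_comp, map_rst, obj_prod, obj_one, map_fst, map_snd⟩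
    -- Coassociativity on maps at the n-th term; the powers on its two sides are then matched as in
    -- the construction of the coalgebra.
    have h : HEq (((comult C).map (X := ⟨L X, X⟩) (Y := ⟨L Y, Y⟩) (map f)).hi n hn)
        (map ((map f).hi n hn)) :=
      (FaaSeq.hi_heq (hobj X) (hobj Y) (hmap f) n hn).trans
        (Quiver.Hom.cast_heq (S.obj_pow (L X).carrier X n) rfl (map ((map f).hi n hn)))
    refine congrArg (fun k : FaaSeq ((DiffObj.of G X).faaPow n).toPreFaa
      (DiffObj.of G Y).vec.toPreFaa => k.hi 1 Nat.one_pos) (eq_of_heq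
        ((hF ((DiffObj.of G X).faaPow n) (DiffObj.of G Y).vec _).trans ((hmap_heq (DiffData.pt_pow_eq _ _ n) rfl ?_).trans h.symm)))
    exact comp_heq (DiffData.pt_pow_eq _ _ n) (DiffData.tup_ptV_ptP_heq _ _ n) _

theorem FaaCoalgebra.isGenDiffRestr (K : FaaCoalgebra C) : K.toDiffData.IsGenDiffRestr := by
  obtain ⟨_, F, hF, -⟩ := K.exists_isFaaFamily
  exact hF.laws.isGenDiffRestr

theorem FaaCoalgebra.eq_coalgebra (K : FaaCoalgebra C) [K.toDiffData.IsCoherent]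
    [K.toDiffData.Laws] : K = DiffData.coalgebra K.toDiffData := by
  obtain ⟨_, F, hF, h⟩ := K.exists_isFaaFamily
  refine FaaCoalgebra.ext_heq (fun X => ?_) fun X Y f => ?_
  · exact congrArg (PreFaa.mk (K.obj X).mon) (congrArg (fun F : C ⥤q C => F.obj X) K.counit_eq)
  · exact (h X Y f).symm.trans (heq_of_eq (hF.eq_seq (.of _ X) (.of _ Y) f))

end Bijection

end RestrictionFaa

/-- For every Cartesian restriction category `C`, the passage from a Faà coalgebra structure `𝒟` on
`C` to `L(X) = 𝒟₀(X)`, `D[f] = 𝒟(f)₁` is a bijection onto the generalized differential restriction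
structures on `C`. -/
theorem mainTheorem6 (C : Type u) [RestrictionFaa.CartRestrStruct.{v} C]
    [RestrictionFaa.IsCartRestrCat C] :
    (∀ K : RestrictionFaa.FaaCoalgebra C, K.toDiffData.IsGenDiffRestr) ∧
    (∀ G : RestrictionFaa.DiffData C, G.IsGenDiffRestr →
      ∃! K : RestrictionFaa.FaaCoalgebra C, K.toDiffData = G) := by
  refine ⟨RestrictionFaa.FaaCoalgebra.isGenDiffRestr, fun G h => ?_⟩
  have := h.isCoherent
  have := h.laws
  refine ⟨RestrictionFaa.DiffData.coalgebra G, rfl, ?_⟩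
  rintro K rfl
  exact K.eq_coalgebra
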